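/- Let $u_0,u_1\in\mathcal S(\mathbb R)$ be real-valued, let $\omega=e^{2\pi i/3}$, $J=\mathrm{diag}(\omega,\omega^2,1)$, and for $\lambda\in\mathbb C\setminus\{0\}$, $j=1,2,3$, put $l_j=\tfrac12\big(\omega^j\lambda+(\omega^j\lambda)^{-1}\big)$ and $\mathcal L=\mathrm{diag}(l_1,l_2,l_3)$. Let $L_1(x,\lambda)=\frac{\lambda}{2}J+U_0(x)+\frac1\lambda U_1(x)-\mathcal L(\lambda)$ with $$U_0=\frac{i\sqrt3\,(u_0'+u_1)}{6}\begin{pmatrix}0&1&-1\\-1&0&1\\1&-1&0\end{pmatrix},\qquad U_1=\frac16\begin{pmatrix}\omega^2a&b&\omega b\\ b&\omega a&\omega^2b\\ \omega b&\omega^2b&a\end{pmatrix},\qquad a=2e^{u_0}+e^{-2u_0},\quad b=e^{-2u_0}-e^{u_0}.$$ Let $\Phi_+$ and $\Phi_+^A$ be defined, column by column, as the continuous solutions bounded as $x\to+\infty$ of the Volterra equations $$\Phi_+(x,\lambda)=I-\int_x^\infty e^{(x-y)\mathcal L}L_1(y,\lambda)\Phi_+(y,\lambda)e^{-(x-y)\mathcal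 L}\,dy,\qquad \Phi_+^A(x,\lambda)=I+\int_x^\infty e^{-(x-y)\mathcal L}L_1(y,\lambda)^T\Phi_+^A(y,\lambda)e^{(x-y)\mathcal L}\,dy,$$ and let $$s(\lambda)=I-\int_{\mathbb R}e^{-y\mathcal L}L_1\Phi_+e^{y\mathcal L}\,dy,\qquad s^A(\lambda)=I+\int_{\mathbb R}e^{y\mathcal L}L_1^T\Phi_+^Ae^{-y\mathcal L}\,dy .$$ Then the reflection coefficients $r_1(\lambda)=s_{12}(\lambda)/s_{11}(\lambda)$, $\lambda\in(0,\infty)$, and $r_2(\lambda)=s^A_{12}(\lambda)/s^A_{11}(\lambda)$, $\lambda\in(-\infty,0)$, are well defined: for every $\lambda>0$ the first and second columns of $\Phi_+(\cdot,\lambda)$ exist and are unique, the integrals defining $s_{11}(\lambda),s_{12}(\lambda)$ converge absolutely, and $s_{11}(\lambda)\ne0$; for every $\lambda<0$ the same holds for the first and second columns of $\Phi_+^A(\cdot,\lambda)$, for $s^A_{11}(\lambda),s^A_{12}(\lambda)$, and $s^A_{11}(\lambda)\neq0$. Moreover: 1. $r_1\in C^\infty(0,\infty)$ and $r_2\in C^\infty(-\infty,0)$,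 and for every $N\ge0$, $r_1(\lambda)=O(\lambda^{-N})$ as $\lambda\to+\infty$ and $r_2(\lambda)=O(|\lambda|^{-N})$ as $\lambda\to-\infty$. 2. For all $m,N\ge0$, $\partial_\lambda^m r_1(\lambda)=O(\lambda^N)$ as $\lambda\to0^+$ and $\partial_\lambda^m r_2(\lambda)=O(|\lambda|^N)$ as $\lambda\to0^-$. -/

import Mathlib

open scoped Matrix ContDiff

namespace Tzitzeica

noncomputable section

/-- The primitive cube root of unity `ω = exp(2πi/3)`. -/
def omega : ℂ := Complex.exp (2 * Real.pi * Complex.I / 3)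

/-- `J = diag(ω, ω², 1)`. -/
def J : Matrix (Fin 3) (Fin 3) ℂ := Matrix.diagonal ![omega, omega ^ 2, 1]

/-- The coefficient `U₀` of the Lax operator, as a function of the value `p` of `u_x + u_t`. -/
def U0 (p : ℝ) : Matrix (Fin 3) (Fin 3) ℂ :=
  (Complex.I * (Real.sqrt 3 : ℂ) * (p : ℂ) / 6) • !![0, 1, -1; -1, 0, 1; 1, -1, 0]

/-- The coefficient `U₁` of the Lax operator, as a function of the value `v` of `u`;
here `a = 2 e^u + e^{-2u}` and `b = e^{-2u} - e^u`. -/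
def U1 (v : ℝ) : Matrix (Fin 3) (Fin 3) ℂ :=
  let a : ℂ := ((2 * Real.exp v + Real.exp (-2 * v) : ℝ) : ℂ)
  let b : ℂ := ((Real.exp (-2 * v) - Real.exp v : ℝ) : ℂ)
  (1 / 6 : ℂ) • !![omega ^ 2 * a, b, omega * b;
                   b, omega * a, omega ^ 2 * b;
                   omega * b, omega ^ 2 * b, a]

/-- The full `x`-part `L(x, z) = (z/2) J + U₀ + (1/z) U₁` of the Lax pair at time `t = 0`, for the
initial data `u(x, 0) = u₀(x)`, `u_t(x, 0) = u₁(x)`; `z` is the spectral parameter. -/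
def L (u₀ u₁ : SchwartzMap ℝ ℝ) (z : ℂ) (x : ℝ) : Matrix (Fin 3) (Fin 3) ℂ :=
  (z / 2) • J + U0 (deriv u₀ x + u₁ x) + z⁻¹ • U1 (u₀ x)

/-- The exponents `l_j(z) = (ω^j z + (ω^j z)⁻¹) / 2`, `j = 1, 2, 3`; the index `j : Fin 3` is
zero-based, so `l j` is the exponent number `j + 1`. -/
def l (z : ℂ) (j : Fin 3) : ℂ :=
  (omega ^ ((j : ℕ) + 1) * z + (omega ^ ((j : ℕ) + 1) * z)⁻¹) / 2

/-- `L₁ = L - diag(l₁, l₂, l₃)`, the part of the Lax operator that vanishes as `|x| → ∞`. -/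
def L1 (u₀ u₁ : SchwartzMap ℝ ℝ) (z : ℂ) (x : ℝ) : Matrix (Fin 3) (Fin 3) ℂ :=
  L u₀ u₁ z x - Matrix.diagonal (l z)

/-- `f` is the `j`-th column of the Jost function `Φ₊(·, z)`, i.e. the `j`-th column of
`Φ₊(x) = I - ∫_x^∞ e^{(x-y) 𝓛} L₁(y) Φ₊(y) e^{-(x-y) 𝓛} dy`, with `𝓛 = diag(l₁, l₂, l₃)`,
in the class of continuous functions bounded near `+∞`. -/
structure IsJostColumn (u₀ u₁ : SchwartzMap ℝ ℝ) (z : ℂ) (j : Fin 3)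
    (f : ℝ → Fin 3 → ℂ) : Prop where
  continuous : Continuous f
  bounded : f =O[Filter.atTop] (fun _ => (1 : ℝ))
  integrable : ∀ (x : ℝ) (i : Fin 3), MeasureTheory.IntegrableOn
    (fun y : ℝ => Complex.exp ((x - y) * (l z i - l z j)) * (L1 u₀ u₁ z y *ᵥ f y) i) (Set.Ioi x)
  volterra : ∀ (x : ℝ) (i : Fin 3), f x i = (if i = j then 1 else 0) -
    ∫ y in Set.Ioi x, Complex.exp ((x - y) * (l z i - l z j)) * (L1 u₀ u₁ z y *ᵥ f y) i

/-- `f` is the `j`-th column of the cofactor Jost function `Φ₊ᴬ(·, z)`, i.e. the `j`-th column of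
`Φ₊ᴬ(x) = I + ∫_x^∞ e^{-(x-y) 𝓛} L₁(y)ᵀ Φ₊ᴬ(y) e^{(x-y) 𝓛} dy`,
in the class of continuous functions bounded near `+∞`. -/
structure IsCofactorJostColumn (u₀ u₁ : SchwartzMap ℝ ℝ) (z : ℂ) (j : Fin 3)
    (f : ℝ → Fin 3 → ℂ) : Prop where
  continuous : Continuous f
  bounded : f =O[Filter.atTop] (fun _ => (1 : ℝ))
  integrable : ∀ (x : ℝ) (i : Fin 3), MeasureTheory.IntegrableOn
    (fun y : ℝ => Complex.exp (-(x - y) * (l z i - l z j)) * ((L1 u₀ u₁ z y)ᵀ *ᵥ f y) i)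
    (Set.Ioi x)
  volterra : ∀ (x : ℝ) (i : Fin 3), f x i = (if i = j then 1 else 0) +
    ∫ y in Set.Ioi x, Complex.exp (-(x - y) * (l z i - l z j)) * ((L1 u₀ u₁ z y)ᵀ *ᵥ f y) i

open Classical in
/-- The `j`-th column of `Φ₊(·, z)` (zero where there is none). -/
def jost (u₀ u₁ : SchwartzMap ℝ ℝ) (z : ℂ) (j : Fin 3) : ℝ → Fin 3 → ℂ :=
  if h : ∃ f, IsJostColumn u₀ u₁ z j f then h.choose else 0

open Classical in
/-- The `j`-th column of `Φ₊ᴬ(·, z)` (zero where there is none). -/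
def cofactorJost (u₀ u₁ : SchwartzMap ℝ ℝ) (z : ℂ) (j : Fin 3) : ℝ → Fin 3 → ℂ :=
  if h : ∃ f, IsCofactorJostColumn u₀ u₁ z j f then h.choose else 0

/-- The `(i, j)` entry of `e^{-y 𝓛} L₁(y, z) Φ₊(y, z) e^{y 𝓛}`. -/
def sIntegrand (u₀ u₁ : SchwartzMap ℝ ℝ) (z : ℂ) (i j : Fin 3) (y : ℝ) : ℂ :=
  Complex.exp (-y * (l z i - l z j)) * (L1 u₀ u₁ z y *ᵥ jost u₀ u₁ z j y) i

/-- The `(i, j)` entry of `e^{y 𝓛} L₁(y, z)ᵀ Φ₊ᴬ(y, z) e^{-y 𝓛}`. -/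
def sAIntegrand (u₀ u₁ : SchwartzMap ℝ ℝ) (z : ℂ) (i j : Fin 3) (y : ℝ) : ℂ :=
  Complex.exp (y * (l z i - l z j)) * ((L1 u₀ u₁ z y)ᵀ *ᵥ cofactorJost u₀ u₁ z j y) i

/-- The scattering matrix `s(z) = I - ∫_ℝ e^{-y 𝓛} L₁ Φ₊ e^{y 𝓛} dy`. -/
def s (u₀ u₁ : SchwartzMap ℝ ℝ) (z : ℂ) (i j : Fin 3) : ℂ :=
  (if i = j then 1 else 0) - ∫ y : ℝ, sIntegrand u₀ u₁ z i j y

/-- The scattering matrix `sᴬ(z) = I + ∫_ℝ e^{y 𝓛} L₁ᵀ Φ₊ᴬ e^{-y 𝓛} dy`. -/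
def sA (u₀ u₁ : SchwartzMap ℝ ℝ) (z : ℂ) (i j : Fin 3) : ℂ :=
  (if i = j then 1 else 0) + ∫ y : ℝ, sAIntegrand u₀ u₁ z i j y

/-- The reflection coefficient `r₁ = s₁₂ / s₁₁`, meaningful on `(0, ∞)`. -/
def r₁ (u₀ u₁ : SchwartzMap ℝ ℝ) (k : ℝ) : ℂ :=
  s u₀ u₁ (k : ℂ) 0 1 / s u₀ u₁ (k : ℂ) 0 0

/-- The reflection coefficient `r₂ = sᴬ₁₂ / sᴬ₁₁`, meaningful on `(-∞, 0)`. -/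
def r₂ (u₀ u₁ : SchwartzMap ℝ ℝ) (k : ℝ) : ℂ :=
  sA u₀ u₁ (k : ℂ) 0 1 / sA u₀ u₁ (k : ℂ) 0 0

end

end Tzitzeica

/-!
Since `-L₁(z)ᵀ = L₁(-z)`, the cofactor Jost function at `z` is the Jost function at `-z`. Hence
`r₂ k = r₁ (-k)`, and only `r₁` on `(0, ∞)` has to be studied. There the exponents `l₁`, `l₂` have
the same real part, which is smaller than that of `l₃`, so the kernels of the Volterra equations for
the first two columns are bounded by `1`.

*Existence, uniqueness and smoothness.* With the oscillating factors moved into the potential, the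
Volterra equation becomes a fixed point equation `g = w - K g` for a triple of bounded continuous
functions, and after conjugation by `exp (β arctan x)` the operator `K` has norm at most `1/2`.
The ingredients of `K` have derivatives of all orders in the spectral parameter `k`, bounded
uniformly on `(k₀, ∞)`; this property (`BddDerivs`) passes through products and inverses in Banach
algebras, and so it reaches `s₁₁` and `s₁₂` (`bddDerivs_s`).

*Decay at infinity.* Translating the potential by `a` multiplies `s₁₂` by an exponential whose
frequency grows linearly in `k`. All derivatives in `a` are bounded uniformly in `k ≥ k₀`, whence
`s₁₂` decays rapidly (`rapidlyDecays_s`). An interpolation between a rapidly decaying function and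
its bounded second derivative extends this to all derivatives (`RapidlyDecays.of_hasDerivAt`).

*Nonvanishing of `s₁₁`.* Let `f` be the first column. The second one is its complex conjugate with
the first two entries exchanged, and three real combinations of the `2 × 2` minors of these columns
(`amplitude`) satisfy a linear system with off-diagonal entries of one sign. They tend to `1` at
`+∞`, hence are positive everywhere. Their mean `|f₀|² - |f₁|²` then satisfies a differential
inequality with an integrable coefficient, which bounds it, and therefore `|s₁₁|²`, from below,
uniformly in `k ≥ k₀` (`exists_le_norm_s`).

*Behaviour at zero.* A circulant gauge transformation, which tends to the identity as `|x| → ∞`,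
turns the Lax operator at `k` into the complex conjugate of the one at `1 / k` for the data
`(u₀, -u₁)`. This gives `r₁(k; u₀, u₁) = conj (r₁(1/k; u₀, -u₁))` (`r₁_inversion`), and the rapid
decay of all derivatives at `+∞` becomes vanishing to infinite order at `0`.
-/

namespace Tzitzeica

open Filter Topology Asymptotics MeasureTheory Set
open scoped BoundedContinuousFunction

/-! ### Functions with uniformly bounded derivatives -/

section Smooth

variable {ι : Type} {E F G : Type*} [NormedAddCommGroup E] [NormedSpace ℝ E]
  [NormedAddCommGroup F] [NormedSpace ℝ F] [NormedAddCommGroup G] [NormedSpace ℝ G]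

/-- A family `f i`, `i : ι`, of functions of a real variable which has `n` derivatives on `S`, all of
them (the function itself included) bounded on `S` uniformly in `i`. The recursive form makes the
closure properties below one-line inductions. -/
def BddDerivs (S : Set ℝ) : ℕ → (ι → ℝ → E) → Prop
  | 0, f => ∃ C, ∀ i, ∀ r ∈ S, ‖f i r‖ ≤ C
  | n + 1, f => (∃ C, ∀ i, ∀ r ∈ S, ‖f i r‖ ≤ C) ∧
      ∃ f' : ι → ℝ → E, (∀ i, ∀ r ∈ S, HasDerivAt (f i) (f' i r) r) ∧ BddDerivs S n f'

variable {S : Set ℝ} {n : ℕ}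

theorem BddDerivs.bdd {f : ι → ℝ → E} (h : BddDerivs S n f) : ∃ C, ∀ i, ∀ r ∈ S, ‖f i r‖ ≤ C := by
  cases n with
  | zero => exact h
  | succ n => exact h.1

theorem BddDerivs.of_succ {f : ι → ℝ → E} (h : BddDerivs S (n + 1) f) : BddDerivs S n f := by
  induction n generalizing f with
  | zero => exact h.1
  | succ n ih =>
    obtain ⟨hb, f', hf', h'⟩ := h
    exact ⟨hb, f', hf', ih h'⟩

theorem BddDerivs.const {f : ι → E} (hf : ∃ C, ∀ i, ‖f i‖ ≤ C) :
    BddDerivs S n (fun i _ => f i) := by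
  induction n generalizing f with
  | zero => obtain ⟨C, hC⟩ := hf; exact ⟨C, fun i _ _ => hC i⟩
  | succ n ih =>
    obtain ⟨C, hC⟩ := hf
    exact ⟨⟨C, fun i _ _ => hC i⟩, fun _ _ => 0, fun i r _ => hasDerivAt_const r _,
      ih (f := fun _ => 0) ⟨0, by simp⟩⟩

theorem BddDerivs.const' (c : E) : BddDerivs S n (fun (_ : ι) _ => c) :=
  BddDerivs.const (f := fun _ => c) ⟨‖c‖, fun _ => le_rfl⟩

theorem BddDerivs.add {f g : ι → ℝ → E} (hf : BddDerivs S n f) (hg : BddDerivs S n g) :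
    BddDerivs S n (fun i r => f i r + g i r) := by
  induction n generalizing f g with
  | zero =>
    obtain ⟨C, hC⟩ := hf
    obtain ⟨D, hD⟩ := hg
    exact ⟨C + D, fun i r hr => (norm_add_le _ _).trans (add_le_add (hC i r hr) (hD i r hr))⟩
  | succ n ih =>
    obtain ⟨⟨C, hC⟩, f', hf', hf⟩ := hf
    obtain ⟨⟨D, hD⟩, g', hg', hg⟩ := hg
    exact ⟨⟨C + D, fun i r hr => (norm_add_le _ _).trans (add_le_add (hC i r hr) (hD i r hr))⟩,
      _, fun i r hr => (hf' i r hr).add (hg' i r hr), ih hf hg⟩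

theorem BddDerivs.clm_comp (A : E →L[ℝ] F) {f : ι → ℝ → E} (hf : BddDerivs S n f) :
    BddDerivs S n (fun i r => A (f i r)) := by
  have key : ∀ f : ι → ℝ → E, (∃ C, ∀ i, ∀ r ∈ S, ‖f i r‖ ≤ C) →
      ∃ C, ∀ i, ∀ r ∈ S, ‖A (f i r)‖ ≤ C := by
    rintro f ⟨C, hC⟩
    exact ⟨‖A‖ * C, fun i r hr => (A.le_opNorm _).trans
      (mul_le_mul_of_nonneg_left (hC i r hr) (norm_nonneg _))⟩
  induction n generalizing f with
  | zero => exact key f hf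
  | succ n ih =>
    obtain ⟨hb, f', hf', hf⟩ := hf
    exact ⟨key f hb, _, fun i r hr => A.hasFDerivAt.comp_hasDerivAt r (hf' i r hr), ih hf⟩

theorem BddDerivs.neg {f : ι → ℝ → E} (hf : BddDerivs S n f) :
    BddDerivs S n (fun i r => -f i r) :=
  hf.clm_comp (-ContinuousLinearMap.id ℝ E)

theorem BddDerivs.sub {f g : ι → ℝ → E} (hf : BddDerivs S n f) (hg : BddDerivs S n g) :
    BddDerivs S n (fun i r => f i r - g i r) := by
  simpa only [sub_eq_add_neg] using hf.add hg.neg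

theorem BddDerivs.sum {α : Type*} (s : Finset α) {f : α → ι → ℝ → E}
    (hf : ∀ a ∈ s, BddDerivs S n (f a)) : BddDerivs S n (fun i r => ∑ a ∈ s, f a i r) := by
  classical
  induction s using Finset.induction_on with
  | empty => simpa using BddDerivs.const' (ι := ι) (S := S) (n := n) (0 : E)
  | insert a s ha ih =>
    simp only [Finset.sum_insert ha]
    exact (hf a (Finset.mem_insert_self _ _)).add
      (ih fun b hb => hf b (Finset.mem_insert_of_mem hb))

theorem BddDerivs.bilin (B : E →L[ℝ] F →L[ℝ] G) {f : ι → ℝ → E} {g : ι → ℝ → F}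
    (hf : BddDerivs S n f) (hg : BddDerivs S n g) :
    BddDerivs S n (fun i r => B (f i r) (g i r)) := by
  have key : ∀ (f : ι → ℝ → E) (g : ι → ℝ → F), (∃ C, ∀ i, ∀ r ∈ S, ‖f i r‖ ≤ C) →
      (∃ C, ∀ i, ∀ r ∈ S, ‖g i r‖ ≤ C) → ∃ C, ∀ i, ∀ r ∈ S, ‖B (f i r) (g i r)‖ ≤ C := by
    rintro f g ⟨C, hC⟩ ⟨D, hD⟩
    refine ⟨‖B‖ * C * D, fun i r hr => (B.le_opNorm₂ _ _).trans ?_⟩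
    have := (norm_nonneg _).trans (hC i r hr)
    have := hC i r hr
    have := hD i r hr
    gcongr
  induction n generalizing f g with
  | zero => exact key f g hf hg
  | succ n ih =>
    have hf0 := hf.of_succ
    have hg0 := hg.of_succ
    obtain ⟨hbf, f', hf', hf⟩ := hf
    obtain ⟨hbg, g', hg', hg⟩ := hg
    refine ⟨key f g hbf hbg, fun i r => B (f i r) (g' i r) + B (f' i r) (g i r),
      fun i r hr => ?_, (ih hf0 hg).add (ih hf hg0)⟩
    exact B.hasDerivAt_of_bilinear (fun _ => hf' i r hr) (fun _ => hg' i r hr)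

theorem BddDerivs.mul {A : Type*} [NormedRing A] [NormedAlgebra ℝ A] {f g : ι → ℝ → A}
    (hf : BddDerivs S n f) (hg : BddDerivs S n g) : BddDerivs S n (fun i r => f i r * g i r) :=
  hf.bilin (ContinuousLinearMap.mul ℝ A) hg

/-- The inverse of a family in a Banach algebra has bounded derivatives as soon as it is itself
bounded, because `(f⁻¹)' = -f⁻¹ f' f⁻¹`. -/
theorem BddDerivs.ringInverse {A : Type*} [NormedRing A] [NormedAlgebra ℝ A]
    [HasSummableGeomSeries A] {f : ι → ℝ → A} (hf : BddDerivs S n f) (hu : ∀ i, ∀ r ∈ S, IsUnit (f i r))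
    (hb : ∃ C, ∀ i, ∀ r ∈ S, ‖Ring.inverse (f i r)‖ ≤ C) :
    BddDerivs S n (fun i r => Ring.inverse (f i r)) := by
  induction n with
  | zero => exact hb
  | succ n ih =>
    have hi := ih hf.of_succ
    obtain ⟨-, f', hf', hf⟩ := hf
    refine ⟨hb, fun i r => -(Ring.inverse (f i r) * f' i r * Ring.inverse (f i r)),
      fun i r hr => ?_, ((hi.mul hf).mul hi).neg⟩
    obtain ⟨u, hu⟩ := hu i r hr
    have h := hasFDerivAt_ringInverse (𝕜 := ℝ) u
    rw [hu] at h
    have := h.comp_hasDerivAt r (hf' i r hr)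
    simpa [← hu, Function.comp_def] using this

theorem BddDerivs.inv {f : ι → ℝ → ℂ} (hf : BddDerivs S n f) {c : ℝ} (hc : 0 < c)
    (h : ∀ i, ∀ r ∈ S, c ≤ ‖f i r‖) : BddDerivs S n (fun i r => (f i r)⁻¹) := by
  have := hf.ringInverse (fun i r hr => (isUnit_iff_ne_zero).2
    (norm_pos_iff.1 (hc.trans_le (h i r hr)))) ⟨c⁻¹, fun i r hr => by
      rw [Ring.inverse_eq_inv', norm_inv]; exact inv_anti₀ hc (h i r hr)⟩
  simpa only [Ring.inverse_eq_inv'] using this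

theorem BddDerivs.congr (hS : IsOpen S) {f g : ι → ℝ → E} (hf : BddDerivs S n f)
    (hfg : ∀ i, ∀ r ∈ S, g i r = f i r) : BddDerivs S n g := by
  cases n with
  | zero =>
    obtain ⟨C, hC⟩ := hf
    exact ⟨C, fun i r hr => hfg i r hr ▸ hC i r hr⟩
  | succ n =>
    obtain ⟨⟨C, hC⟩, f', hf', hf⟩ := hf
    refine ⟨⟨C, fun i r hr => hfg i r hr ▸ hC i r hr⟩, f', fun i r hr => ?_, hf⟩
    exact (hf' i r hr).congr_of_eventuallyEq
      (Filter.eventually_of_mem (hS.mem_nhds hr) (hfg i))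

theorem BddDerivs.deriv (hS : IsOpen S) {f : ι → ℝ → E} (hf : BddDerivs S (n + 1) f) :
    BddDerivs S n (fun i => deriv (f i)) := by
  obtain ⟨-, f', hf', hf⟩ := hf
  exact hf.congr hS fun i r hr => (hf' i r hr).deriv

theorem BddDerivs.contDiffOn (hS : IsOpen S) {f : ι → ℝ → E} (hf : ∀ n, BddDerivs S n f) (i : ι) :
    ContDiffOn ℝ ∞ (f i) S := by
  have key : ∀ (m : ℕ) (f : ι → ℝ → E), BddDerivs S (m + 1) f → ContDiffOn ℝ m (f i) S := by
    intro m
    induction m with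
    | zero =>
      intro f hf
      obtain ⟨-, f', hf', -⟩ := hf
      simp only [CharP.cast_eq_zero, contDiffOn_zero]
      exact fun r hr => (hf' i r hr).continuousAt.continuousWithinAt
    | succ m ih =>
      intro f hf
      have h1 := hf.deriv hS
      obtain ⟨-, f', hf', -⟩ := hf
      push_cast
      rw [contDiffOn_succ_iff_deriv_of_isOpen hS]
      exact ⟨fun r hr => (hf' i r hr).differentiableAt.differentiableWithinAt, by simp, ih _ h1⟩
  exact contDiffOn_infty.2 fun m => key m f (hf _)

/-- The derivatives of a fixed function may be multiplied by chain-rule factors: `φ q` is a family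
of functions of a parameter whose derivative is `φ (D q)`, and `τ` is a change of parameter. -/
theorem BddDerivs.comp_of_step {α : Type*} (P : α → Prop) (φ : α → ℝ → E) (D : α → α) {U : Set ℝ}
    (hD : ∀ q, P q → P (D q)) (hd : ∀ q, P q → ∀ r ∈ U, HasDerivAt (φ q) (φ (D q) r) r)
    (hb : ∀ q, P q → ∃ C, ∀ r ∈ U, ‖φ q r‖ ≤ C)
    {τ τ' : ι → ℝ → ℝ} (hτ : ∀ i, ∀ r ∈ S, τ i r ∈ U)
    (hτd : ∀ i, ∀ r ∈ S, HasDerivAt (τ i) (τ' i r) r) (hτ' : BddDerivs S n τ') {q : α} (hq : P q) :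
    BddDerivs S n (fun i r => φ q (τ i r)) := by
  have hb' : ∀ q, P q → ∃ C, ∀ i, ∀ r ∈ S, ‖φ q (τ i r)‖ ≤ C := fun q hq => by
    obtain ⟨C, hC⟩ := hb q hq
    exact ⟨C, fun i r hr => hC _ (hτ i r hr)⟩
  induction n generalizing q with
  | zero => exact hb' q hq
  | succ n ih =>
    refine ⟨hb' q hq, fun i r => τ' i r • φ (D q) (τ i r), fun i r hr =>
      (hd q hq _ (hτ i r hr)).scomp r (hτd i r hr), ?_⟩
    exact hτ'.of_succ.bilin (ContinuousLinearMap.lsmul ℝ ℝ) (ih hτ'.of_succ (hD q hq))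

end Smooth

/-! ### Taylor estimate and interpolation of decay -/

theorem norm_taylor_le {E : Type*} [NormedAddCommGroup E] [NormedSpace ℝ E] {f f' f'' : ℝ → E}
    {x h C : ℝ} (hf : ∀ s ∈ Set.uIcc x (x + h), HasDerivAt f (f' s) s)
    (hf' : ∀ s ∈ Set.uIcc x (x + h), HasDerivAt f' (f'' s) s)
    (hC : ∀ s ∈ Set.uIcc x (x + h), ‖f'' s‖ ≤ C) :
    ‖f (x + h) - f x - h • f' x‖ ≤ C * h ^ 2 := by
  have hconv : Convex ℝ (Set.uIcc x (x + h)) := convex_uIcc _ _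
  have hx : x ∈ Set.uIcc x (x + h) := Set.left_mem_uIcc
  have hy : x + h ∈ Set.uIcc x (x + h) := Set.right_mem_uIcc
  have h1 : ∀ s ∈ Set.uIcc x (x + h), ‖f' s - f' x‖ ≤ C * |h| := fun s hs => by
    refine (hconv.norm_image_sub_le_of_norm_hasDerivWithin_le
      (fun s hs => (hf' s hs).hasDerivWithinAt) hC hx hs).trans ?_
    have : |s - x| ≤ |h| := by
      have := Set.abs_sub_left_of_mem_uIcc hs
      simpa using this
    exact mul_le_mul_of_nonneg_left this ((norm_nonneg _).trans (hC x hx))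
  have h2 := hconv.norm_image_sub_le_of_norm_hasDerivWithin_le (f := fun s => f s - s • f' x)
    (fun s hs => ((hf s hs).sub ((hasDerivAt_id s).smul_const (f' x))).hasDerivWithinAt)
    (C := C * |h|) (fun s hs => by simpa using h1 s hs) hx hy
  calc ‖f (x + h) - f x - h • f' x‖ = ‖f (x + h) - (x + h) • f' x - (f x - x • f' x)‖ := by
        congr 1; module
    _ ≤ C * |h| * ‖x + h - x‖ := h2
    _ = C * h ^ 2 := by
        rw [add_sub_cancel_left, Real.norm_eq_abs, mul_assoc, ← sq, sq_abs]

theorem hasDerivAt_of_norm_le {E : Type*} [NormedAddCommGroup E] [NormedSpace ℝ E] {f : ℝ → E}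
    {f' : E} {x C δ : ℝ} (hδ : 0 < δ)
    (h : ∀ t : ℝ, |t| < δ → ‖f (x + t) - f x - t • f'‖ ≤ C * t ^ 2) : HasDerivAt f f' x := by
  rw [hasDerivAt_iff_isLittleO_nhds_zero]
  have h1 : (fun t : ℝ => f (x + t) - f x - t • f') =O[𝓝 0] fun t : ℝ => t ^ 2 := by
    refine IsBigO.of_bound C ?_
    filter_upwards [Metric.ball_mem_nhds (0 : ℝ) hδ] with t ht
    simpa using h t (by simpa using ht)
  refine h1.trans_isLittleO ?_
  simpa using isLittleO_pow_pow (𝕜 := ℝ) (m := 1) (n := 2) (by norm_num)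

/-- Decay faster than every power of `k⁻¹` at `+∞`. -/
def RapidlyDecays (f : ℝ → ℂ) : Prop := ∀ N : ℕ, f =O[atTop] fun k : ℝ => (k ^ N)⁻¹

/-- Interpolation: if `f` decays rapidly and `f''` is bounded, then `f'` decays rapidly, since
`h f'(k) = f (k + h) - f k + O(h²)` may be used with `h = k⁻ᴺ`. -/
theorem RapidlyDecays.of_hasDerivAt {f f' f'' : ℝ → ℂ} {a C : ℝ} (hf : RapidlyDecays f)
    (h1 : ∀ k ∈ Set.Ioi a, HasDerivAt f (f' k) k) (h2 : ∀ k ∈ Set.Ioi a, HasDerivAt f' (f'' k) k)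
    (hC : ∀ k ∈ Set.Ioi a, ‖f'' k‖ ≤ C) : RapidlyDecays f' := by
  intro N
  obtain ⟨D, hD⟩ := (hf (2 * N)).bound
  have hD' : ∀ᶠ k : ℝ in atTop, ∀ k' ≥ k, ‖f k'‖ ≤ D * ‖(k' ^ (2 * N))⁻¹‖ :=
    eventually_forall_ge_atTop.2 hD
  refine IsBigO.of_bound (2 * D + C) ?_
  filter_upwards [hD', eventually_gt_atTop a, eventually_ge_atTop 1] with k hk hka hk1
  set h : ℝ := (k ^ N)⁻¹ with hh
  have hpos : 0 < h := by positivity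
  have hsub : Set.uIcc k (k + h) ⊆ Set.Ioi a := by
    rw [Set.uIcc_of_le (by linarith)]
    exact fun s hs => hka.trans_le hs.1
  have ht := norm_taylor_le (fun s hs => h1 s (hsub hs)) (fun s hs => h2 s (hsub hs))
    (fun s hs => hC s (hsub hs))
  have hsq : (k ^ (2 * N))⁻¹ = h ^ 2 := by rw [hh, inv_pow, ← pow_mul, mul_comm]
  have hD0 : ‖f k‖ ≤ D * h ^ 2 := by
    have := hk k le_rfl
    rwa [Real.norm_of_nonneg (by positivity), hsq] at this
  have hDnn : 0 ≤ D := by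
    by_contra hneg
    push Not at hneg
    have := (norm_nonneg _).trans hD0
    nlinarith [sq_nonneg h, pow_pos hpos 2]
  have hD1 : ‖f (k + h)‖ ≤ D * h ^ 2 := by
    refine (hk (k + h) (by linarith)).trans ?_
    rw [Real.norm_of_nonneg (by positivity), ← hsq]
    gcongr
    linarith
  have h3 : ‖h • f' k‖ ≤ (2 * D + C) * h ^ 2 := by
    calc ‖h • f' k‖ = ‖f (k + h) - f k - (f (k + h) - f k - h • f' k)‖ := by congr 1; ring
      _ ≤ ‖f (k + h)‖ + ‖f k‖ + ‖f (k + h) - f k - h • f' k‖ :=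
        (norm_sub_le _ _).trans (add_le_add_left (norm_sub_le _ _) _)
      _ ≤ _ := by linarith
  rw [norm_smul, Real.norm_of_nonneg hpos.le] at h3
  rw [Real.norm_of_nonneg hpos.le]
  have : h * ‖f' k‖ ≤ h * ((2 * D + C) * h) := by linarith [h3]
  exact le_of_mul_le_mul_left this hpos

theorem RapidlyDecays.iteratedDeriv {f : ℝ → ℂ} {a : ℝ} (hf : RapidlyDecays f)
    (h : ∀ n, BddDerivs (Set.Ioi a) n (fun _ : Unit => f)) (m : ℕ) :
    RapidlyDecays (iteratedDeriv m f) := by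
  induction m generalizing f with
  | zero => simpa using hf
  | succ m ih =>
    rw [iteratedDeriv_succ']
    refine ih ?_ fun n => (h (n + 1)).deriv isOpen_Ioi
    obtain ⟨-, f', hf', -, f'', hf'', C, hC⟩ := h 2
    have := hf.of_hasDerivAt (hf' ()) (hf'' ()) (hC ())
    intro N
    refine (this N).congr' ?_ EventuallyEq.rfl
    filter_upwards [eventually_gt_atTop a] with k hk
    exact ((hf' () k hk).deriv).symm

noncomputable section

/-! ### Weighted Volterra operators on bounded continuous functions -/

/-- The integrable weight `1 / (1 + y²)`. -/
def weight (y : ℝ) : ℝ := (1 + y ^ 2)⁻¹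

theorem weight_pos (y : ℝ) : 0 < weight y := by unfold weight; positivity

theorem weight_mul (y : ℝ) : weight y * (1 + y ^ 2) = 1 :=
  inv_mul_cancel₀ (by positivity)

theorem integrable_weight : Integrable weight := integrable_inv_one_add_sq

theorem continuous_weight : Continuous weight := by
  unfold weight
  exact Continuous.inv₀ (by fun_prop) fun y => by positivity

/-- The ratio `e^{β arctan x} / e^{β arctan y}`, at most `1` for `x ≤ y`. Conjugating a Volterra
operator by `e^{β arctan x}` makes its norm as small as one likes. -/
def damping (β x y : ℝ) : ℝ := Real.exp (β * (Real.arctan x - Real.arctan y))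

theorem damping_pos (β x y : ℝ) : 0 < damping β x y := Real.exp_pos _

theorem damping_le_one {β x y : ℝ} (hβ : 0 < β) (h : x ≤ y) : damping β x y ≤ 1 := by
  unfold damping
  rw [Real.exp_le_one_iff]
  have := Real.arctan_strictMono.monotone h
  nlinarith

theorem continuous_damping (β : ℝ) : Continuous fun p : ℝ × ℝ => damping β p.1 p.2 := by
  unfold damping
  fun_prop

theorem hasDerivAt_damping {β : ℝ} (hβ : 0 < β) (x y : ℝ) :
    HasDerivAt (fun y => -damping β x y / β) (damping β x y * weight y) y := by
  have h : HasDerivAt (fun y => -damping β x y / β) _ y :=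
    ((((Real.hasDerivAt_arctan y).const_sub (Real.arctan x)).const_mul β).exp.neg).div_const β
  refine h.congr_deriv ?_
  unfold damping weight
  field_simp

theorem tendsto_damping {β : ℝ} (x : ℝ) :
    Tendsto (fun y => -damping β x y / β) atTop
      (𝓝 (-Real.exp (β * (Real.arctan x - Real.pi / 2)) / β)) := by
  unfold damping
  have h : Tendsto Real.arctan atTop (𝓝 (Real.pi / 2)) :=
    tendsto_nhds_of_tendsto_nhdsWithin Real.tendsto_arctan_atTop
  exact ((Real.continuous_exp.tendsto _).comp
    ((h.const_sub (Real.arctan x)).const_mul β)).neg.div_const β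

theorem integrableOn_damping {β : ℝ} (hβ : 0 < β) (x : ℝ) :
    IntegrableOn (fun y => damping β x y * weight y) (Ioi x) :=
  integrableOn_Ioi_deriv_of_nonneg' (fun y _ => hasDerivAt_damping hβ x y)
    (fun _ _ => mul_nonneg (damping_pos _ _ _).le (weight_pos _).le) (tendsto_damping x)

theorem integral_damping_le {β : ℝ} (hβ : 0 < β) (x : ℝ) :
    ∫ y in Ioi x, damping β x y * weight y ≤ 1 / β := by
  rw [integral_Ioi_of_hasDerivAt_of_tendsto' (fun y _ => hasDerivAt_damping hβ x y)
    (integrableOn_damping hβ x) (tendsto_damping x)]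
  have h1 : damping β x x = 1 := by simp [damping]
  rw [h1]
  have := Real.exp_pos (β * (Real.arctan x - Real.pi / 2))
  rw [div_sub_div_same]
  gcongr
  linarith

open Classical in
/-- The element of `C_b(ℝ, ℂ)` given by a function (zero if it is not bounded and continuous). -/
def toBCF (f : ℝ → ℂ) : ℝ →ᵇ ℂ :=
  if h : Continuous f ∧ ∃ C, ∀ x, ‖f x‖ ≤ C then
    BoundedContinuousFunction.ofNormedAddCommGroup f h.1 h.2.choose h.2.choose_spec else 0

theorem toBCF_apply {f : ℝ → ℂ} (hf : Continuous f) {C : ℝ} (hC : ∀ x, ‖f x‖ ≤ C) (x : ℝ) :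
    toBCF f x = f x := by
  rw [toBCF, dif_pos ⟨hf, C, hC⟩]; rfl

theorem norm_toBCF_le {f : ℝ → ℂ} {C : ℝ} (hC : ∀ x, ‖f x‖ ≤ C) : ‖toBCF f‖ ≤ C := by
  have hC0 := (norm_nonneg _).trans (hC 0)
  unfold toBCF
  split_ifs with h
  · exact (BoundedContinuousFunction.norm_le hC0).2 hC
  · simpa using hC0

/-- The integrand of the weighted Volterra operator, extended by zero to `y ≤ x`. -/
def volterraKernel (β : ℝ) (κ g : ℝ →ᵇ ℂ) (x : ℝ) : ℝ → ℂ :=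
  (Ioi x).indicator fun y => κ (y - x) * (damping β x y * weight y : ℝ) * g y

theorem continuous_volterraIntegrand (β : ℝ) (κ g : ℝ →ᵇ ℂ) :
    Continuous fun p : ℝ × ℝ => κ (p.2 - p.1) * (damping β p.1 p.2 * weight p.2 : ℝ) * g p.2 := by
  have h1 := continuous_damping β
  have h2 := continuous_weight.comp (continuous_snd (X := ℝ) (Y := ℝ))
  have h3 : Continuous fun p : ℝ × ℝ => κ (p.2 - p.1) :=
    κ.continuous.comp (continuous_snd.sub continuous_fst)
  exact (h3.mul (Complex.continuous_ofReal.comp (h1.mul h2))).mul (g.continuous.comp continuous_snd)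

theorem norm_volterraIntegrand_le {β : ℝ} (κ g : ℝ →ᵇ ℂ) (x y : ℝ) :
    ‖κ (y - x) * (damping β x y * weight y : ℝ) * g y‖
      ≤ ‖κ‖ * ‖g‖ * (damping β x y * weight y) := by
  have hd : 0 ≤ damping β x y * weight y := mul_nonneg (damping_pos _ _ _).le (weight_pos _).le
  rw [norm_mul, norm_mul, Complex.norm_real, Real.norm_of_nonneg hd]
  calc _ ≤ ‖κ‖ * (damping β x y * weight y) * ‖g‖ := by
        gcongr
        · exact κ.norm_coe_le_norm _
        · exact g.norm_coe_le_norm _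
    _ = _ := by ring

theorem integrableOn_volterraIntegrand {β : ℝ} (hβ : 0 < β) (κ g : ℝ →ᵇ ℂ) (x : ℝ) :
    IntegrableOn (fun y => κ (y - x) * (damping β x y * weight y : ℝ) * g y) (Ioi x) := by
  refine Integrable.mono' ((integrableOn_damping hβ x).const_mul (‖κ‖ * ‖g‖)) ?_
    (Eventually.of_forall fun y => norm_volterraIntegrand_le κ g x y)
  exact ((continuous_volterraIntegrand β κ g).comp
    (Continuous.prodMk_right x)).aestronglyMeasurable

/-- The weighted Volterra integral
`x ↦ ∫_x^∞ κ(y - x) e^{β (arctan x - arctan y)} g(y) / (1 + y²) dy`. -/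
def volterraFun (β : ℝ) (κ g : ℝ →ᵇ ℂ) (x : ℝ) : ℂ :=
  ∫ y in Ioi x, κ (y - x) * (damping β x y * weight y : ℝ) * g y

theorem norm_volterraFun_le {β : ℝ} (hβ : 0 < β) (κ g : ℝ →ᵇ ℂ) (x : ℝ) :
    ‖volterraFun β κ g x‖ ≤ β⁻¹ * ‖κ‖ * ‖g‖ := by
  calc ‖volterraFun β κ g x‖ ≤ ∫ y in Ioi x, ‖κ‖ * ‖g‖ * (damping β x y * weight y) :=
        norm_integral_le_of_norm_le ((integrableOn_damping hβ x).const_mul _)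
          (Eventually.of_forall fun y => norm_volterraIntegrand_le κ g x y)
    _ = ‖κ‖ * ‖g‖ * ∫ y in Ioi x, damping β x y * weight y := integral_const_mul _ _
    _ ≤ ‖κ‖ * ‖g‖ * (1 / β) := by gcongr; exact integral_damping_le hβ x
    _ = _ := by ring

theorem continuous_volterraFun {β : ℝ} (hβ : 0 < β) (κ g : ℝ →ᵇ ℂ) :
    Continuous (volterraFun β κ g) := by
  have heq : volterraFun β κ g = fun x => ∫ y, volterraKernel β κ g x y := by
    ext x
    exact (integral_indicator measurableSet_Ioi).symm
  rw [heq, continuous_iff_continuousAt]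
  intro x₀
  have hc := continuous_volterraIntegrand β κ g
  refine continuousAt_of_dominated (bound := fun y => ‖κ‖ * ‖g‖ * weight y)
    (Eventually.of_forall fun x => ?_) (Eventually.of_forall fun x => Eventually.of_forall fun y => ?_)
    (integrable_weight.const_mul _) ?_
  · exact ((hc.comp (Continuous.prodMk_right x)).aestronglyMeasurable).indicator measurableSet_Ioi
  · unfold volterraKernel
    by_cases hy : y ∈ Ioi x
    · rw [indicator_of_mem hy]
      refine (norm_volterraIntegrand_le κ g x y).trans ?_
      have := damping_le_one hβ (le_of_lt hy)
      have := weight_pos y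
      gcongr
      nlinarith
    · rw [indicator_of_notMem hy, norm_zero]
      have := weight_pos y
      positivity
  · have hne : ∀ᵐ y : ℝ, y ≠ x₀ := by simp [ae_iff]
    filter_upwards [hne] with y hy
    have hcy : Continuous fun x => κ (y - x) * (damping β x y * weight y : ℝ) * g y :=
      hc.comp (Continuous.prodMk_left y)
    rcases lt_or_gt_of_ne hy with h | h
    · refine (continuousAt_const (y := (0 : ℂ))).congr ?_
      filter_upwards [Ioi_mem_nhds h] with x hx
      exact (indicator_of_notMem (by simpa using le_of_lt hx) _).symm
    · refine hcy.continuousAt.congr ?_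
      filter_upwards [Iio_mem_nhds h] with x hx
      have hx' : y ∈ Ioi x := hx
      simp only [volterraKernel, indicator_of_mem hx']

/-- The weighted Volterra operator, as a bounded bilinear map of its convolution kernel `κ` and its
argument `g`. -/
def volterraOp (β : ℝ) (hβ : 0 < β) : (ℝ →ᵇ ℂ) →L[ℝ] (ℝ →ᵇ ℂ) →L[ℝ] (ℝ →ᵇ ℂ) :=
  LinearMap.mkContinuous₂ (LinearMap.mk₂ ℝ
    (fun κ g => BoundedContinuousFunction.ofNormedAddCommGroup (volterraFun β κ g)
      (continuous_volterraFun hβ κ g) _ (norm_volterraFun_le hβ κ g))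
    (fun κ κ' g => by
      ext x
      simp only [BoundedContinuousFunction.coe_ofNormedAddCommGroup, volterraFun,
        BoundedContinuousFunction.coe_add, Pi.add_apply, add_mul]
      exact integral_add (integrableOn_volterraIntegrand hβ _ _ _)
        (integrableOn_volterraIntegrand hβ _ _ _))
    (fun c κ g => by
      ext x
      simp only [BoundedContinuousFunction.coe_ofNormedAddCommGroup, volterraFun,
        BoundedContinuousFunction.coe_smul, smul_mul_assoc]
      exact integral_smul _ _)
    (fun κ g g' => by
      ext x
      simp only [BoundedContinuousFunction.coe_ofNormedAddCommGroup, volterraFun,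
        BoundedContinuousFunction.coe_add, Pi.add_apply, mul_add]
      exact integral_add (integrableOn_volterraIntegrand hβ _ _ _)
        (integrableOn_volterraIntegrand hβ _ _ _))
    (fun c κ g => by
      ext x
      simp only [BoundedContinuousFunction.coe_ofNormedAddCommGroup, volterraFun,
        BoundedContinuousFunction.coe_smul, mul_smul_comm]
      exact integral_smul _ _)) β⁻¹
    (fun κ g => (BoundedContinuousFunction.norm_le (by positivity)).2 (norm_volterraFun_le hβ κ g))

theorem volterraOp_apply {β : ℝ} (hβ : 0 < β) (κ g : ℝ →ᵇ ℂ) (x : ℝ) :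
    volterraOp β hβ κ g x = volterraFun β κ g x := rfl

theorem norm_volterraOp_le {β : ℝ} (hβ : 0 < β) (κ : ℝ →ᵇ ℂ) :
    ‖volterraOp β hβ κ‖ ≤ β⁻¹ * ‖κ‖ :=
  ContinuousLinearMap.opNorm_le_bound _ (by positivity) fun g =>
    (BoundedContinuousFunction.norm_le (by positivity)).2 (norm_volterraFun_le hβ κ g)

/-- The functional `g ↦ ∫ e^{-β arctan y} g(y) / (1 + y²) dy`. -/
def weightedIntegral (β : ℝ) : (ℝ →ᵇ ℂ) →L[ℝ] ℂ :=
  have hint : ∀ g : ℝ →ᵇ ℂ, Integrable fun y => ((damping β 0 y * weight y : ℝ) : ℂ) * g y := by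
    intro g
    have hw : Integrable fun y => ((damping β 0 y * weight y : ℝ) : ℂ) := by
      refine Integrable.ofReal ?_
      refine Integrable.mono' (integrable_weight.const_mul (Real.exp (|β| * Real.pi)))
        (((continuous_damping β).comp (Continuous.prodMk_right 0)).mul
          continuous_weight).aestronglyMeasurable (Eventually.of_forall fun y => ?_)
      refine (Real.norm_of_nonneg (mul_nonneg (damping_pos β 0 y).le (weight_pos y).le)).le.trans ?_
      refine mul_le_mul_of_nonneg_right (Real.exp_le_exp.2 ?_) (weight_pos _).le
      refine (le_abs_self _).trans ?_
      rw [abs_mul]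
      refine mul_le_mul_of_nonneg_left ?_ (abs_nonneg _)
      rw [Real.arctan_zero, zero_sub, abs_neg, abs_le]
      have := Real.neg_pi_div_two_lt_arctan y
      have := Real.arctan_lt_pi_div_two y
      have := Real.pi_pos
      constructor <;> linarith
    exact hw.mul_bdd g.continuous.aestronglyMeasurable
      (Eventually.of_forall fun y => g.norm_coe_le_norm y)
  LinearMap.mkContinuous
    { toFun := fun g => ∫ y, ((damping β 0 y * weight y : ℝ) : ℂ) * g y
      map_add' := fun g g' => by
        simp only [BoundedContinuousFunction.coe_add, Pi.add_apply, mul_add]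
        exact integral_add (hint g) (hint g')
      map_smul' := fun c g => by
        simp only [BoundedContinuousFunction.coe_smul, mul_smul_comm]
        exact integral_smul _ _ }
    (∫ y, damping β 0 y * weight y) fun g => by
      have h1 : Integrable fun y => damping β 0 y * weight y := by
        have := (hint 1).re
        simpa using this
      calc ‖∫ y, ((damping β 0 y * weight y : ℝ) : ℂ) * g y‖
          ≤ ∫ y, damping β 0 y * weight y * ‖g‖ := by
            refine norm_integral_le_of_norm_le (h1.mul_const _) (Eventually.of_forall fun y => ?_)
            have hd : 0 ≤ damping β 0 y * weight y :=
              mul_nonneg (damping_pos _ _ _).le (weight_pos _).le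
            rw [norm_mul, Complex.norm_real, Real.norm_of_nonneg hd]
            gcongr
            exact g.norm_coe_le_norm y
        _ = _ := integral_mul_const _ _

theorem weightedIntegral_apply (β : ℝ) (g : ℝ →ᵇ ℂ) :
    weightedIntegral β g = ∫ y, ((damping β 0 y * weight y : ℝ) : ℂ) * g y := rfl

/-! ### The Volterra system and its resolvent -/

/-- The Volterra operator of a `3 × 3` system with convolution kernels `κ i` and coefficients
`m i l`. -/
def systemOp (β : ℝ) (hβ : 0 < β) (κ : Fin 3 → ℝ →ᵇ ℂ) (m : Fin 3 → Fin 3 → ℝ →ᵇ ℂ) :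
    (Fin 3 → ℝ →ᵇ ℂ) →L[ℝ] (Fin 3 → ℝ →ᵇ ℂ) :=
  ∑ i, ∑ l, (ContinuousLinearMap.single ℝ (fun _ : Fin 3 => ℝ →ᵇ ℂ) i).comp
    (((volterraOp β hβ (κ i)).comp (ContinuousLinearMap.mul ℝ (ℝ →ᵇ ℂ) (m i l))).comp
      (ContinuousLinearMap.proj l))

theorem systemOp_apply {β : ℝ} (hβ : 0 < β) (κ : Fin 3 → ℝ →ᵇ ℂ) (m : Fin 3 → Fin 3 → ℝ →ᵇ ℂ)
    (G : Fin 3 → ℝ →ᵇ ℂ) (i : Fin 3) :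
    systemOp β hβ κ m G i = ∑ l, volterraOp β hβ (κ i) (m i l * G l) := by
  unfold systemOp
  simp only [_root_.sum_apply, Finset.sum_apply, ContinuousLinearMap.comp_apply,
    ContinuousLinearMap.single_apply, ContinuousLinearMap.proj_apply, Pi.single_apply,
    ContinuousLinearMap.mul_apply']
  simp

theorem norm_systemOp_le {β : ℝ} (hβ : 0 < β) {κ : Fin 3 → ℝ →ᵇ ℂ} {m : Fin 3 → Fin 3 → ℝ →ᵇ ℂ}
    {C : ℝ} (hκ : ∀ i, ‖κ i‖ ≤ 1) (hm : ∀ i l, ‖m i l‖ ≤ C) :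
    ‖systemOp β hβ κ m‖ ≤ 3 * C / β := by
  have hC : 0 ≤ C := (norm_nonneg _).trans (hm 0 0)
  refine ContinuousLinearMap.opNorm_le_bound _ (by positivity) fun G =>
    (pi_norm_le_iff_of_nonneg (by positivity)).2 fun i => ?_
  rw [systemOp_apply]
  calc ‖∑ l, volterraOp β hβ (κ i) (m i l * G l)‖ ≤ ∑ _l : Fin 3, C / β * ‖G‖ := by
        refine norm_sum_le_of_le _ fun l _ => ?_
        calc ‖volterraOp β hβ (κ i) (m i l * G l)‖ ≤ β⁻¹ * ‖κ i‖ * ‖m i l * G l‖ :=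
              ContinuousLinearMap.le_of_opNorm_le _ (norm_volterraOp_le hβ _) _
          _ ≤ β⁻¹ * 1 * (C * ‖G‖) := by
              have h1 := hκ i
              have h2 : ‖m i l * G l‖ ≤ C * ‖G‖ := (norm_mul_le _ _).trans
                (mul_le_mul (hm i l) (norm_le_pi_norm G l) (norm_nonneg _) hC)
              gcongr
          _ = _ := by ring
    _ = _ := by simp; ring

theorem BddDerivs.systemOp {ι : Type} {S : Set ℝ} {n : ℕ} {β : ℝ} (hβ : 0 < β)
    {κ : ι → ℝ → Fin 3 → ℝ →ᵇ ℂ} {m : ι → ℝ → Fin 3 → Fin 3 → ℝ →ᵇ ℂ}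
    (hκ : ∀ i, BddDerivs S n fun a r => κ a r i)
    (hm : ∀ i l, BddDerivs S n fun a r => m a r i l) :
    BddDerivs S n fun a r => systemOp β hβ (κ a r) (m a r) := by
  unfold Tzitzeica.systemOp
  refine BddDerivs.sum _ fun i _ => BddDerivs.sum _ fun l _ => ?_
  have h1 := (hκ i).clm_comp (F := (ℝ →ᵇ ℂ) →L[ℝ] (ℝ →ᵇ ℂ)) (volterraOp β hβ)
  have h2 := (hm i l).clm_comp (F := (ℝ →ᵇ ℂ) →L[ℝ] (ℝ →ᵇ ℂ)) (ContinuousLinearMap.mul ℝ (ℝ →ᵇ ℂ))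
  have h3 := h1.bilin (ContinuousLinearMap.compL ℝ (ℝ →ᵇ ℂ) (ℝ →ᵇ ℂ) (ℝ →ᵇ ℂ)) h2
  have h4 := h3.clm_comp ((ContinuousLinearMap.compL ℝ (Fin 3 → ℝ →ᵇ ℂ) (ℝ →ᵇ ℂ) (ℝ →ᵇ ℂ)).flip
    (ContinuousLinearMap.proj l))
  exact h4.clm_comp (ContinuousLinearMap.compL ℝ (Fin 3 → ℝ →ᵇ ℂ) (ℝ →ᵇ ℂ) (Fin 3 → ℝ →ᵇ ℂ)
    (ContinuousLinearMap.single ℝ (fun _ : Fin 3 => ℝ →ᵇ ℂ) i))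

theorem isUnit_one_add_of_norm_le {A : Type*} [NormedRing A] [CompleteSpace A] {K : A}
    (h : ‖K‖ ≤ 1 / 2) : IsUnit (1 + K) := by
  have := isUnit_one_sub_of_norm_lt_one (x := -K) (by rw [norm_neg]; linarith)
  simpa using this

theorem norm_inverse_one_add_le {A : Type*} [NormedRing A] [CompleteSpace A] {K : A}
    (hA : ‖(1 : A)‖ ≤ 1) (h : ‖K‖ ≤ 1 / 2) : ‖Ring.inverse (1 + K)‖ ≤ 2 := by
  have h1 := Ring.mul_inverse_cancel _ (isUnit_one_add_of_norm_le h)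
  have h2 : Ring.inverse (1 + K) = 1 - K * Ring.inverse (1 + K) := by
    rw [eq_sub_iff_add_eq, ← one_add_mul, h1]
  have h3 : ‖Ring.inverse (1 + K)‖ ≤ 1 + 1 / 2 * ‖Ring.inverse (1 + K)‖ := by
    calc _ = ‖1 - K * Ring.inverse (1 + K)‖ := by rw [← h2]
      _ ≤ ‖(1 : A)‖ + ‖K * Ring.inverse (1 + K)‖ := norm_sub_le _ _
      _ ≤ 1 + 1 / 2 * ‖Ring.inverse (1 + K)‖ := by
        gcongr
        exact (norm_mul_le _ _).trans (by gcongr)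
  linarith

/-- The factor `e^{β arctan x}` that conjugates the Volterra system, as an element of `C_b`. -/
def gauge (β : ℝ) : ℝ →ᵇ ℂ := toBCF fun x => (damping β x 0 : ℝ)

theorem gauge_apply {β : ℝ} (hβ : 0 < β) (x : ℝ) : gauge β x = (damping β x 0 : ℝ) := by
  refine toBCF_apply (C := Real.exp (β * Real.pi)) ?_ (fun x => ?_) x
  · exact Complex.continuous_ofReal.comp ((continuous_damping β).comp (Continuous.prodMk_left 0))
  · rw [Complex.norm_real, Real.norm_of_nonneg (damping_pos _ _ _).le]
    refine Real.exp_le_exp.2 (mul_le_mul_of_nonneg_left ?_ hβ.le)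
    have := Real.arctan_lt_pi_div_two x
    have := Real.pi_pos
    rw [Real.arctan_zero]
    linarith

/-- The solution of the conjugated Volterra system with inhomogeneity `e^{β arctan x} e_j`. -/
def systemSol (β : ℝ) (hβ : 0 < β) (κ : Fin 3 → ℝ →ᵇ ℂ) (m : Fin 3 → Fin 3 → ℝ →ᵇ ℂ) (j : Fin 3) :
    Fin 3 → ℝ →ᵇ ℂ :=
  Ring.inverse (1 + systemOp β hβ κ m) (Pi.single j (gauge β))

theorem systemSol_spec {β : ℝ} (hβ : 0 < β) {κ : Fin 3 → ℝ →ᵇ ℂ} {m : Fin 3 → Fin 3 → ℝ →ᵇ ℂ}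
    (hK : ‖systemOp β hβ κ m‖ ≤ 1 / 2) (j i : Fin 3) (x : ℝ) :
    systemSol β hβ κ m j i x = (if i = j then 1 else 0) * (damping β x 0 : ℝ) -
      ∑ l, volterraFun β (κ i) (m i l * systemSol β hβ κ m j l) x := by
  have h1 := Ring.mul_inverse_cancel _ (isUnit_one_add_of_norm_le
    (A := (Fin 3 → ℝ →ᵇ ℂ) →L[ℝ] (Fin 3 → ℝ →ᵇ ℂ)) hK)
  have h2 := DFunLike.congr_fun (congrFun (DFunLike.congr_fun h1 (Pi.single j (gauge β))) i) x
  have h3 : systemSol β hβ κ m j i x + systemOp β hβ κ m (systemSol β hβ κ m j) i x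
      = (Pi.single j (gauge β) : Fin 3 → ℝ →ᵇ ℂ) i x := h2
  rw [systemOp_apply] at h3
  simp only [BoundedContinuousFunction.coe_sum, Finset.sum_apply, volterraOp_apply] at h3
  rw [eq_sub_iff_add_eq, h3]
  by_cases h : i = j
  · subst h; simp [gauge_apply hβ]
  · simp [h]

/-- The scattering coefficient of the Volterra system. For the coefficients of a potential in the
interaction picture it is the scattering coefficient of that potential, see
`exists_isVolterraSolution`. -/
def systemScattering (β : ℝ) (hβ : 0 < β) (κ : Fin 3 → ℝ →ᵇ ℂ) (m : Fin 3 → Fin 3 → ℝ →ᵇ ℂ)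
    (i j : Fin 3) : ℂ :=
  (if i = j then 1 else 0) - weightedIntegral β (∑ l, m i l * systemSol β hβ κ m j l)

theorem BddDerivs.systemScattering {ι : Type} {S : Set ℝ} {n : ℕ} {β : ℝ} (hβ : 0 < β)
    {κ : ι → ℝ → Fin 3 → ℝ →ᵇ ℂ} {m : ι → ℝ → Fin 3 → Fin 3 → ℝ →ᵇ ℂ}
    (hκ : ∀ i, BddDerivs S n fun a r => κ a r i)
    (hm : ∀ i l, BddDerivs S n fun a r => m a r i l)
    (hK : ∀ a, ∀ r ∈ S, ‖Tzitzeica.systemOp β hβ (κ a r) (m a r)‖ ≤ 1 / 2) (i j : Fin 3) :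
    BddDerivs S n fun a r => systemScattering β hβ (κ a r) (m a r) i j := by
  unfold Tzitzeica.systemScattering
  refine (BddDerivs.const' _).sub (BddDerivs.clm_comp (weightedIntegral β) ?_)
  refine BddDerivs.sum _ fun l _ => (hm i l).mul ?_
  have h1 := ((BddDerivs.const' (ι := ι) (S := S) (n := n)
    (1 : (Fin 3 → ℝ →ᵇ ℂ) →L[ℝ] (Fin 3 → ℝ →ᵇ ℂ))).add (BddDerivs.systemOp hβ hκ hm)).ringInverse
    (fun a r hr => isUnit_one_add_of_norm_le
      (A := (Fin 3 → ℝ →ᵇ ℂ) →L[ℝ] (Fin 3 → ℝ →ᵇ ℂ)) (hK a r hr))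
    ⟨2, fun a r hr => norm_inverse_one_add_le
      (A := (Fin 3 → ℝ →ᵇ ℂ) →L[ℝ] (Fin 3 → ℝ →ᵇ ℂ)) ContinuousLinearMap.norm_id_le (hK a r hr)⟩
  exact h1.clm_comp ((ContinuousLinearMap.proj (R := ℝ) (φ := fun _ : Fin 3 => ℝ →ᵇ ℂ) l).comp
    (ContinuousLinearMap.apply ℝ _ (Pi.single j (gauge β))))

end

noncomputable section

/-! ### Jost solutions of a general decaying potential -/

/-- A continuous matrix potential bounded entrywise by `C / (1 + y²)`. -/
structure IsPotential (Q : ℝ → Matrix (Fin 3) (Fin 3) ℂ) (C : ℝ) : Prop where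
  continuous : ∀ i l, Continuous fun y => Q y i l
  bound : ∀ i l y, ‖Q y i l‖ ≤ C * weight y

/-- `f` is a continuous solution, bounded near `+∞`, of
`f i x = δ i j - ∫_x^∞ e^{(x - y) Δ i} (Q(y) f(y)) i dy`: the defining property of a Jost column, for
a general potential `Q` and general exponent differences `Δ`. -/
structure IsVolterraSolution (Q : ℝ → Matrix (Fin 3) (Fin 3) ℂ) (Δ : Fin 3 → ℂ) (j : Fin 3)
    (f : ℝ → Fin 3 → ℂ) : Prop where
  continuous : Continuous f
  bounded : f =O[atTop] (fun _ => (1 : ℝ))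
  integrable : ∀ (x : ℝ) (i : Fin 3), IntegrableOn
    (fun y : ℝ => Complex.exp ((x - y) * Δ i) * (Q y *ᵥ f y) i) (Ioi x)
  volterra : ∀ (x : ℝ) (i : Fin 3), f x i = (if i = j then 1 else 0) -
    ∫ y in Ioi x, Complex.exp ((x - y) * Δ i) * (Q y *ᵥ f y) i

/-- The scattering coefficient `δ i j - ∫ e^{-y Δ i} (Q(y) f(y)) i dy` of a Jost column `f`. -/
def scattering (Q : ℝ → Matrix (Fin 3) (Fin 3) ℂ) (Δ : Fin 3 → ℂ) (f : ℝ → Fin 3 → ℂ)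
    (i j : Fin 3) : ℂ :=
  (if i = j then 1 else 0) - ∫ y : ℝ, Complex.exp (-y * Δ i) * (Q y *ᵥ f y) i

variable {Q : ℝ → Matrix (Fin 3) (Fin 3) ℂ} {C : ℝ} {Δ : Fin 3 → ℂ} {j : Fin 3}
  {f g : ℝ → Fin 3 → ℂ}

theorem IsPotential.norm_mulVec_le (hQ : IsPotential Q C) (y : ℝ) (v : Fin 3 → ℂ) (i : Fin 3) :
    ‖(Q y *ᵥ v) i‖ ≤ 3 * C * weight y * ‖v‖ := by
  calc ‖(Q y *ᵥ v) i‖ = ‖∑ l, Q y i l * v l‖ := rfl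
    _ ≤ ∑ _l : Fin 3, C * weight y * ‖v‖ := by
        refine norm_sum_le_of_le _ fun l _ => ?_
        rw [norm_mul]
        exact mul_le_mul (hQ.bound i l y) (norm_le_pi_norm v l) (norm_nonneg _)
          ((norm_nonneg _).trans (hQ.bound i l y))
    _ = _ := by simp; ring

theorem IsPotential.nonneg (hQ : IsPotential Q C) : 0 ≤ C := by
  have := (norm_nonneg _).trans (hQ.bound 0 0 0)
  have := weight_pos 0
  by_contra h
  push Not at h
  nlinarith

theorem IsPotential.continuous_mulVec (hQ : IsPotential Q C) (hf : Continuous f) (i : Fin 3) :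
    Continuous fun y => (Q y *ᵥ f y) i := by
  change Continuous fun y => ∑ l, Q y i l * f y l
  exact continuous_finsetSum _ fun l _ => (hQ.continuous i l).mul ((continuous_apply l).comp hf)

theorem exists_bound_Ici {E : Type*} [NormedAddCommGroup E] {f : ℝ → E} (hf : Continuous f)
    (hb : f =O[atTop] (fun _ => (1 : ℝ))) (X : ℝ) : ∃ M, ∀ x ≥ X, ‖f x‖ ≤ M := by
  obtain ⟨c, hc⟩ := hb.bound
  obtain ⟨Y, hY⟩ := eventually_atTop.1 hc
  obtain ⟨M, hM⟩ := (isCompact_Icc (a := X) (b := Y)).exists_bound_of_continuousOn hf.continuousOn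
  refine ⟨max c M, fun x hx => ?_⟩
  rcases le_total Y x with h | h
  · exact le_max_of_le_left (by simpa using hY x h)
  · exact le_max_of_le_right (hM x ⟨hx, h⟩)

theorem norm_cexp_mul_le_one {x y : ℝ} (h : x ≤ y) {d : ℂ} (hd : 0 ≤ d.re) :
    ‖Complex.exp ((x - y) * d)‖ ≤ 1 := by
  rw [Complex.norm_exp, Real.exp_le_one_iff]
  have : ((x - y : ℂ) * d).re = (x - y) * d.re := by
    rw [← Complex.ofReal_sub, Complex.re_ofReal_mul]
  rw [this]
  nlinarith

/-- Gronwall from `+∞`: iterating the estimate with the weight `e^{β arctan x}` gains a factor `1/2`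
each time. -/
theorem eq_zero_of_norm_le_integral {E : Type*} [NormedAddCommGroup E] {d : ℝ → E}
    {X c : ℝ} (hc : 0 ≤ c) (hd : Continuous d) (hb : d =O[atTop] (fun _ => (1 : ℝ)))
    (h : ∀ x ≥ X, ‖d x‖ ≤ ∫ y in Ioi x, c * weight y * ‖d y‖) : ∀ x ≥ X, d x = 0 := by
  obtain ⟨M, hM⟩ := exists_bound_Ici hd hb X
  set β : ℝ := 2 * c + 1 with hβ
  have hβ0 : 0 < β := by positivity
  set D : ℝ := Real.exp (β * Real.pi) * M with hD
  have hint : ∀ x ≥ X, IntegrableOn (fun y => c * weight y * ‖d y‖) (Ioi x) := fun x hx => by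
    refine Integrable.mono' ((integrable_weight.const_mul (c * M)).integrableOn)
      ((continuous_const.mul continuous_weight).mul hd.norm).aestronglyMeasurable ?_
    refine (ae_restrict_mem measurableSet_Ioi).mono fun y hy => ?_
    have := hM y (hx.le.trans (le_of_lt hy))
    have hw := weight_pos y
    rw [Real.norm_of_nonneg (by positivity)]
    calc c * weight y * ‖d y‖ ≤ c * weight y * M := by gcongr
      _ = _ := by ring
  have key : ∀ n : ℕ, ∀ x ≥ X, damping β x 0 * ‖d x‖ ≤ D * (1 / 2) ^ n := by
    intro n
    induction n with
    | zero =>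
      intro x hx
      rw [pow_zero, mul_one]
      refine mul_le_mul (Real.exp_le_exp.2 (mul_le_mul_of_nonneg_left ?_ hβ0.le)) (hM x hx)
        (norm_nonneg _) (Real.exp_pos _).le
      have := Real.arctan_lt_pi_div_two x
      have := Real.pi_pos
      rw [Real.arctan_zero]
      linarith
    | succ n ih =>
      intro x hx
      have hB : 0 ≤ D * (1 / 2) ^ n :=
        (mul_nonneg (damping_pos _ _ _).le (norm_nonneg _)).trans (ih x hx)
      calc damping β x 0 * ‖d x‖
          ≤ damping β x 0 * ∫ y in Ioi x, c * weight y * ‖d y‖ :=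
            mul_le_mul_of_nonneg_left (h x hx) (damping_pos _ _ _).le
        _ = ∫ y in Ioi x, damping β x 0 * (c * weight y * ‖d y‖) := (integral_const_mul _ _).symm
        _ ≤ ∫ y in Ioi x, (c * (D * (1 / 2) ^ n)) * (damping β x y * weight y) := by
            refine setIntegral_mono_on ((hint x hx).const_mul _)
              ((integrableOn_damping hβ0 x).const_mul _) measurableSet_Ioi fun y hy => ?_
            have h1 := ih y (hx.le.trans (le_of_lt hy))
            have h2 : damping β x 0 = damping β x y * damping β y 0 := by
              unfold damping
              rw [← Real.exp_add]
              ring_nf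
            rw [h2]
            have h3 := damping_pos β x y
            have h4 := weight_pos y
            calc _ = c * (damping β y 0 * ‖d y‖) * (damping β x y * weight y) := by ring
              _ ≤ _ := by gcongr
        _ = c * (D * (1 / 2) ^ n) * ∫ y in Ioi x, damping β x y * weight y :=
            integral_const_mul _ _
        _ ≤ c * (D * (1 / 2) ^ n) * (1 / β) := by
            gcongr
            exact integral_damping_le hβ0 x
        _ = (D * (1 / 2) ^ n) * (c / β) := by ring
        _ ≤ (D * (1 / 2) ^ n) * (1 / 2) := by
            refine mul_le_mul_of_nonneg_left ?_ hB
            rw [div_le_div_iff₀ hβ0 two_pos]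
            linarith
        _ = _ := by ring
  intro x hx
  have hlim : Tendsto (fun n : ℕ => D * (1 / 2 : ℝ) ^ n) atTop (𝓝 (D * 0)) :=
    (tendsto_pow_atTop_nhds_zero_of_lt_one (by norm_num) (by norm_num)).const_mul _
  rw [mul_zero] at hlim
  have h0 := ge_of_tendsto' hlim fun n => key n x hx
  have := damping_pos β x 0
  have h1 : ‖d x‖ ≤ 0 := by
    by_contra hneg
    push Not at hneg
    nlinarith
  exact norm_le_zero_iff.1 h1

theorem IsPotential.integrable_mul (hQ : IsPotential Q C) (hf : Continuous f) {M : ℝ} {s : Set ℝ}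
    (hs : MeasurableSet s) (hM : ∀ x ∈ s, ‖f x‖ ≤ M) {e : ℝ → ℂ} (he : Continuous e)
    (he1 : ∀ y ∈ s, ‖e y‖ ≤ 1) (i : Fin 3) :
    IntegrableOn (fun y => e y * (Q y *ᵥ f y) i) s := by
  refine Integrable.mono' ((integrable_weight.const_mul (3 * C * M)).integrableOn)
    (he.mul (hQ.continuous_mulVec hf i)).aestronglyMeasurable ?_
  refine (ae_restrict_mem hs).mono fun y hy => ?_
  have h1 := hQ.norm_mulVec_le y (f y) i
  have h2 := hM y hy
  have h3 := weight_pos y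
  have h4 := hQ.nonneg
  rw [norm_mul]
  calc ‖e y‖ * ‖(Q y *ᵥ f y) i‖ ≤ 1 * (3 * C * weight y * M) :=
        mul_le_mul (he1 y hy) (h1.trans (by gcongr)) (norm_nonneg _) zero_le_one
    _ = _ := by ring

theorem continuous_cexp_sub_mul (x : ℝ) (d : ℂ) :
    Continuous fun y : ℝ => Complex.exp ((x - y) * d) := by fun_prop

theorem IsVolterraSolution.unique (hQ : IsPotential Q C) (hΔ : ∀ i, 0 ≤ (Δ i).re)
    (hf : IsVolterraSolution Q Δ j f) (hg : IsVolterraSolution Q Δ j g) : f = g := by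
  have hC := hQ.nonneg
  have hd : Continuous (f - g) := hf.continuous.sub hg.continuous
  have hdb : (f - g) =O[atTop] (fun _ => (1 : ℝ)) := hf.bounded.sub hg.bounded
  funext X
  have := eq_zero_of_norm_le_integral (d := f - g) (X := X) (c := 3 * C) (by positivity) hd hdb ?_ X
    le_rfl
  · exact sub_eq_zero.1 this
  intro x hx
  obtain ⟨M, hM⟩ := exists_bound_Ici hd hdb x
  have hi : IntegrableOn (fun y => 3 * C * weight y * ‖(f - g) y‖) (Ioi x) := by
    refine Integrable.mono' ((integrable_weight.const_mul (3 * C * M)).integrableOn)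
      ((continuous_const.mul continuous_weight).mul hd.norm).aestronglyMeasurable ?_
    refine (ae_restrict_mem measurableSet_Ioi).mono fun y hy => ?_
    have := hM y (le_of_lt hy)
    have hw := weight_pos y
    rw [Real.norm_of_nonneg (by positivity)]
    calc 3 * C * weight y * ‖(f - g) y‖ ≤ 3 * C * weight y * M := by gcongr
      _ = _ := by ring
  refine (pi_norm_le_iff_of_nonneg (integral_nonneg fun y => ?_)).2 fun i => ?_
  · have := weight_pos y
    positivity
  rw [Pi.sub_apply, Pi.sub_apply, hf.volterra x i, hg.volterra x i, sub_sub_sub_cancel_left,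
    ← integral_sub (hg.integrable x i) (hf.integrable x i)]
  refine norm_integral_le_of_norm_le hi ((ae_restrict_mem measurableSet_Ioi).mono fun y hy => ?_)
  have h1 : (Q y *ᵥ g y) i - (Q y *ᵥ f y) i = -(Q y *ᵥ (f - g) y) i := by
    rw [Pi.sub_apply, Matrix.mulVec_sub]; simp
  rw [← mul_sub, h1, norm_mul, norm_neg]
  have h2 := norm_cexp_mul_le_one (le_of_lt hy) (hΔ i)
  calc _ ≤ 1 * (3 * C * weight y * ‖(f - g) y‖) :=
        mul_le_mul h2 (hQ.norm_mulVec_le y _ i) (norm_nonneg _) zero_le_one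
    _ = _ := one_mul _

/-- A Jost column solves the differential equation `f' = (Δ + Q) f`. -/
theorem IsVolterraSolution.hasDerivAt (hQ : IsPotential Q C) (hj : Δ j = 0)
    (hf : IsVolterraSolution Q Δ j f) (i : Fin 3) (x : ℝ) :
    HasDerivAt (fun x => f x i) (Δ i * f x i + (Q x *ᵥ f x) i) x := by
  set h : ℝ → ℂ := fun y => Complex.exp (-y * Δ i) * (Q y *ᵥ f y) i with hh
  have hc : Continuous h := by
    have h1 := hQ.continuous_mulVec hf.continuous i
    have h2 : Continuous fun y : ℝ => Complex.exp (-y * Δ i) := by fun_prop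
    exact h2.mul h1
  have hfac : ∀ x y : ℝ, Complex.exp ((x - y) * Δ i) * (Q y *ᵥ f y) i
      = Complex.exp (x * Δ i) * h y := fun x y => by
    rw [hh, ← mul_assoc, ← Complex.exp_add]
    ring_nf
  have hint : ∀ x, IntegrableOn h (Ioi x) := fun x => by
    have h1 := (hf.integrable x i).const_mul (Complex.exp (-(x * Δ i)))
    refine h1.congr (Eventually.of_forall fun y => ?_)
    simp only [hfac]
    rw [← mul_assoc, ← Complex.exp_add, neg_add_cancel, Complex.exp_zero, one_mul]
  have hsub : ∀ z : ℝ, f z i = (if i = j then 1 else 0) -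
      Complex.exp (z * Δ i) * ((∫ y in Ioi x, h y) - ∫ y in x..z, h y) := fun z => by
    rw [hf.volterra z i]
    simp only [hfac]
    rw [integral_const_mul, ← intervalIntegral.integral_Ioi_sub_Ioi' (hint x) (hint z)]
    ring
  have hI : HasDerivAt (fun z => ∫ y in x..z, h y) (h x) x :=
    intervalIntegral.integral_hasDerivAt_right (hc.intervalIntegrable _ _)
      (hc.stronglyMeasurableAtFilter _ _) hc.continuousAt
  have he : HasDerivAt (fun z : ℝ => Complex.exp (z * Δ i)) (Complex.exp (x * Δ i) * Δ i) x := by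
    have := ((Complex.ofRealCLM.hasDerivAt (x := x)).mul_const (Δ i)).cexp
    simpa using this
  have hmain := (he.mul (hI.const_sub (∫ y in Ioi x, h y))).const_sub (if i = j then (1 : ℂ) else 0)
  have heq : (fun x => f x i) = fun z : ℝ => (if i = j then 1 else 0) -
      Complex.exp (z * Δ i) * ((∫ y in Ioi x, h y) - ∫ y in x..z, h y) := funext hsub
  rw [heq]
  refine hmain.congr_deriv ?_
  have h0 : Complex.exp (x * Δ i) * h x = (Q x *ᵥ f x) i := by
    rw [← hfac]; simp
  have h1 := hsub x
  rw [intervalIntegral.integral_same, sub_zero] at h1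
  simp only [intervalIntegral.integral_same, sub_zero]
  rw [h1]
  by_cases hij : i = j
  · subst hij
    rw [hj]
    rw [hj] at h0
    linear_combination h0
  · simp only [if_neg hij]
    linear_combination h0

theorem IsVolterraSolution.tendsto_atTop (hΔ : ∀ i, 0 ≤ (Δ i).re)
    (hQ : IsPotential Q C) (hf : IsVolterraSolution Q Δ j f) (i : Fin 3) :
    Tendsto (fun x => f x i) atTop (𝓝 (if i = j then 1 else 0)) := by
  obtain ⟨M, hM⟩ := exists_bound_Ici hf.continuous hf.bounded 0
  have hb : ∀ x ≥ 0, ‖f x i - (if i = j then 1 else 0)‖ ≤ ∫ y in Ioi x, 3 * C * M * weight y := by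
    intro x hx
    rw [hf.volterra x i, sub_sub_cancel_left, norm_neg]
    refine norm_integral_le_of_norm_le ((integrable_weight.const_mul _).integrableOn)
      ((ae_restrict_mem measurableSet_Ioi).mono fun y hy => ?_)
    have h1 := hQ.norm_mulVec_le y (f y) i
    have h2 := hM y (hx.le.trans (le_of_lt hy))
    have h3 := weight_pos y
    have h4 := hQ.nonneg
    rw [norm_mul]
    calc _ ≤ 1 * (3 * C * weight y * M) :=
          mul_le_mul (norm_cexp_mul_le_one (le_of_lt hy) (hΔ i)) (h1.trans (by gcongr))
            (norm_nonneg _) zero_le_one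
      _ = _ := by ring
  have hlim : Tendsto (fun x => ∫ y in Ioi x, 3 * C * M * weight y) atTop (𝓝 0) :=
    tendsto_integral_Ioi_zero tendsto_id
  rw [tendsto_iff_norm_sub_tendsto_zero]
  exact squeeze_zero' (Eventually.of_forall fun _ => norm_nonneg _)
    ((eventually_ge_atTop 0).mono hb) hlim

/-- Conversely, a solution of `f' = (Δ + Q) f` with `f → e_j` at `+∞` is a Jost column. -/
theorem IsVolterraSolution.of_hasDerivAt (hQ : IsPotential Q C) (hΔ : ∀ i, 0 ≤ (Δ i).re)
    (hj : Δ j = 0) (hd : ∀ i x, HasDerivAt (fun x => f x i) (Δ i * f x i + (Q x *ᵥ f x) i) x)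
    (hlim : ∀ i, Tendsto (fun x => f x i) atTop (𝓝 (if i = j then 1 else 0))) :
    IsVolterraSolution Q Δ j f := by
  have hc : Continuous f := continuous_pi fun i =>
    continuous_iff_continuousAt.2 fun x => (hd i x).continuousAt
  have hb : f =O[atTop] (fun _ => (1 : ℝ)) :=
    (tendsto_pi_nhds.2 hlim).isBigO_one ℝ
  have hint : ∀ (x : ℝ) (i : Fin 3), IntegrableOn
      (fun y : ℝ => Complex.exp ((x - y) * Δ i) * (Q y *ᵥ f y) i) (Ioi x) := fun x i => by
    obtain ⟨M, hM⟩ := exists_bound_Ici hc hb x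
    exact hQ.integrable_mul hc measurableSet_Ioi (fun y hy => hM y (le_of_lt hy))
      (continuous_cexp_sub_mul x _) (fun y hy => norm_cexp_mul_le_one (le_of_lt hy) (hΔ i)) i
  refine ⟨hc, hb, hint, fun x i => ?_⟩
  have hder : ∀ y : ℝ, HasDerivAt (fun y : ℝ => Complex.exp ((x - y) * Δ i) * f y i)
      (Complex.exp ((x - y) * Δ i) * (Q y *ᵥ f y) i) y := fun y => by
    have h1 : HasDerivAt (fun y : ℝ => Complex.exp ((x - y) * Δ i))
        (Complex.exp ((x - y) * Δ i) * -Δ i) y := by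
      have := (((Complex.ofRealCLM.hasDerivAt (x := y)).const_sub (x : ℂ)).mul_const (Δ i)).cexp
      simpa using this
    refine (h1.mul (hd i y)).congr_deriv ?_
    ring
  have htend : Tendsto (fun y : ℝ => Complex.exp ((x - y) * Δ i) * f y i) atTop
      (𝓝 (if i = j then 1 else 0)) := by
    by_cases hij : i = j
    · subst hij
      simpa [hj] using hlim i
    · rw [if_neg hij]
      have h0 := (hlim i).norm
      rw [if_neg hij, norm_zero] at h0
      refine squeeze_zero_norm' ?_ h0
      filter_upwards [eventually_ge_atTop x] with y hy
      rw [norm_mul]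
      exact mul_le_of_le_one_left (norm_nonneg _) (norm_cexp_mul_le_one hy (hΔ i))
  have := integral_Ioi_of_hasDerivAt_of_tendsto' (fun y _ => hder y) (hint x i) htend
  rw [this]
  simp

/-- The scattering coefficients are the asymptotic amplitudes of the Jost column at `-∞`. -/
theorem IsVolterraSolution.tendsto_scattering (hf : IsVolterraSolution Q Δ j f) (hj : Δ j = 0)
    {i : Fin 3} (hi : Integrable fun y : ℝ => Complex.exp (-y * Δ i) * (Q y *ᵥ f y) i) :
    Tendsto (fun x : ℝ => Complex.exp (-x * Δ i) * f x i) atBot (𝓝 (scattering Q Δ f i j)) := by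
  have heq : ∀ x : ℝ, Complex.exp (-x * Δ i) * f x i = (if i = j then 1 else 0) -
      ∫ y in Ioi x, Complex.exp (-y * Δ i) * (Q y *ᵥ f y) i := fun x => by
    rw [hf.volterra x i, mul_sub, ← integral_const_mul]
    congr 1
    · by_cases hij : i = j
      · subst hij; simp [hj]
      · simp [hij]
    · congr 1
      ext y
      rw [← mul_assoc, ← Complex.exp_add]
      ring_nf
  simp only [heq]
  exact ((aecover_Ioi (μ := volume) tendsto_id).integral_tendsto_of_countably_generated hi).const_sub _

theorem setIntegral_Ioi_comp_add_right {E : Type*} [NormedAddCommGroup E] [NormedSpace ℝ E]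
    (h : ℝ → E) (x a : ℝ) : ∫ y in Ioi x, h (y + a) = ∫ y in Ioi (x + a), h y := by
  have := (measurePreserving_add_right volume a).setIntegral_preimage_emb
    (MeasurableEquiv.addRight a).measurableEmbedding h (Ioi (x + a))
  rw [← this]
  congr 2
  ext y
  simp

theorem integrableOn_Ioi_comp_add_right {E : Type*} [NormedAddCommGroup E]
    {h : ℝ → E} {x a : ℝ} (hh : IntegrableOn h (Ioi (x + a))) :
    IntegrableOn (fun y => h (y + a)) (Ioi x) := by
  have := ((measurePreserving_add_right volume a).integrableOn_comp_preimage
    (MeasurableEquiv.addRight a).measurableEmbedding (f := h) (s := Ioi (x + a))).2 hh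
  have hs : (fun y => y + a) ⁻¹' Ioi (x + a) = Ioi x := by ext y; simp
  rwa [hs] at this

/-- Translating the potential translates the Jost column. -/
theorem IsVolterraSolution.translate (hf : IsVolterraSolution Q Δ j f) (a : ℝ) :
    IsVolterraSolution (fun y => Q (y + a)) Δ j (fun y => f (y + a)) := by
  have heq : ∀ (x : ℝ) (i : Fin 3), (fun y : ℝ => Complex.exp ((x - y) * Δ i) *
      (Q (y + a) *ᵥ f (y + a)) i) = fun y : ℝ => (fun y : ℝ =>
      Complex.exp (((x + a : ℝ) - y) * Δ i) * (Q y *ᵥ f y) i) (y + a) := fun x i => by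
    ext y
    push_cast
    ring_nf
  refine ⟨hf.continuous.comp (by fun_prop), ?_, fun x i => ?_, fun x i => ?_⟩
  · exact hf.bounded.comp_tendsto (tendsto_atTop_add_const_right _ a tendsto_id)
  · rw [heq]
    exact integrableOn_Ioi_comp_add_right (hf.integrable (x + a) i)
  · rw [heq, setIntegral_Ioi_comp_add_right
      (fun y : ℝ => Complex.exp (((x + a : ℝ) - y) * Δ i) * (Q y *ᵥ f y) i), hf.volterra (x + a) i]

theorem scattering_translate (Q : ℝ → Matrix (Fin 3) (Fin 3) ℂ) (Δ : Fin 3 → ℂ)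
    (f : ℝ → Fin 3 → ℂ) {i j : Fin 3} (hij : i ≠ j) (a : ℝ) :
    scattering (fun y => Q (y + a)) Δ (fun y => f (y + a)) i j
      = Complex.exp (a * Δ i) * scattering Q Δ f i j := by
  unfold scattering
  rw [if_neg hij, zero_sub, zero_sub, mul_neg, ← integral_const_mul,
    ← integral_add_right_eq_self (fun y : ℝ => Complex.exp (a * Δ i) *
      (Complex.exp (-y * Δ i) * (Q y *ᵥ f y) i)) a]
  congr 2
  ext y
  rw [← mul_assoc, ← Complex.exp_add]
  push_cast
  ring_nf

end

noncomputable section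

/-! ### Existence of Jost solutions -/

/-- Exponent differences with real parts `ρ i` and imaginary parts `σ i - σ j`. -/
def exponents (ρ σ : Fin 3 → ℝ) (j i : Fin 3) : ℂ := ρ i + Complex.I * ((σ i - σ j : ℝ) : ℂ)

theorem exponents_re (ρ σ : Fin 3 → ℝ) (j i : Fin 3) : (exponents ρ σ j i).re = ρ i := by
  simp [exponents]

theorem exponents_self {ρ : Fin 3 → ℝ} {j : Fin 3} (hj : ρ j = 0) (σ : Fin 3 → ℝ) :
    exponents ρ σ j j = 0 := by
  simp [exponents, hj]

/-- The convolution kernel `e^{-ρ|t|}`. Only its values for `t > 0` enter the Volterra equation; the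
absolute value makes it a bounded function on the whole line. -/
def decayKernel (ρ : ℝ) : ℝ →ᵇ ℂ := toBCF fun t => Complex.exp (-(ρ * |t| : ℝ))

theorem norm_decayKernel_aux {ρ : ℝ} (hρ : 0 ≤ ρ) (t : ℝ) :
    ‖Complex.exp (-(ρ * |t| : ℝ))‖ ≤ 1 := by
  rw [← Complex.ofReal_neg, Complex.norm_exp_ofReal, Real.exp_le_one_iff]
  have : 0 ≤ ρ * |t| := by positivity
  linarith

theorem decayKernel_apply {ρ : ℝ} (hρ : 0 ≤ ρ) (t : ℝ) :
    decayKernel ρ t = Complex.exp (-(ρ * |t| : ℝ)) :=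
  toBCF_apply (by fun_prop) (norm_decayKernel_aux hρ) t

theorem norm_decayKernel_le {ρ : ℝ} (hρ : 0 ≤ ρ) : ‖decayKernel ρ‖ ≤ 1 :=
  norm_toBCF_le (norm_decayKernel_aux hρ)

/-- The entry `Q i l` of the potential in the interaction picture, where conjugation by the unitary
matrices `diag (e^{i y σ})` has moved the oscillating exponentials onto the potential; the factor
`1 + y²` compensates for the weight of the Volterra operator. -/
def phasedCoeff (Q : ℝ → Matrix (Fin 3) (Fin 3) ℂ) (σ : Fin 3 → ℝ) (i l : Fin 3) : ℝ →ᵇ ℂ :=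
  toBCF fun y => ((1 + y ^ 2 : ℝ) : ℂ) * (Complex.exp (-(y * (σ i - σ l) : ℝ) * Complex.I) * Q y i l)

variable {Q : ℝ → Matrix (Fin 3) (Fin 3) ℂ} {C : ℝ}

theorem norm_phasedCoeff_aux (hQ : IsPotential Q C) (σ : Fin 3 → ℝ) (i l : Fin 3) (y : ℝ) :
    ‖((1 + y ^ 2 : ℝ) : ℂ) * (Complex.exp (-(y * (σ i - σ l) : ℝ) * Complex.I) * Q y i l)‖ ≤ C := by
  rw [norm_mul, norm_mul, ← Complex.ofReal_neg, Complex.norm_exp_ofReal_mul_I, one_mul,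
    Complex.norm_real, Real.norm_of_nonneg (by positivity)]
  calc (1 + y ^ 2) * ‖Q y i l‖ ≤ (1 + y ^ 2) * (C * weight y) := by
        gcongr
        exact hQ.bound i l y
    _ = C := by linear_combination C * weight_mul y

theorem phasedCoeff_apply (hQ : IsPotential Q C) (σ : Fin 3 → ℝ) (i l : Fin 3) (y : ℝ) :
    phasedCoeff Q σ i l y =
      ((1 + y ^ 2 : ℝ) : ℂ) * (Complex.exp (-(y * (σ i - σ l) : ℝ) * Complex.I) * Q y i l) := by
  have := hQ.continuous i l
  exact toBCF_apply (by fun_prop) (norm_phasedCoeff_aux hQ σ i l) y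

theorem norm_phasedCoeff_le (hQ : IsPotential Q C) (σ : Fin 3 → ℝ) (i l : Fin 3) :
    ‖phasedCoeff Q σ i l‖ ≤ C :=
  norm_toBCF_le (norm_phasedCoeff_aux hQ σ i l)

theorem norm_systemOp_le_half (hQ : IsPotential Q C) {ρ : Fin 3 → ℝ} (hρ : ∀ i, 0 ≤ ρ i)
    (σ : Fin 3 → ℝ) {β : ℝ} (hβ : 0 < β) (hC : 6 * C ≤ β) :
    ‖systemOp β hβ (fun i => decayKernel (ρ i)) (phasedCoeff Q σ)‖ ≤ 1 / 2 := by
  refine (norm_systemOp_le hβ (fun i => norm_decayKernel_le (hρ i))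
    (norm_phasedCoeff_le hQ σ)).trans ?_
  rw [div_le_div_iff₀ hβ two_pos]
  linarith

/-- Jost columns exist, are bounded on the whole line, and their scattering coefficients are those
of the Volterra system. -/
theorem exists_isVolterraSolution (hQ : IsPotential Q C) {ρ : Fin 3 → ℝ} (hρ : ∀ i, 0 ≤ ρ i)
    (σ : Fin 3 → ℝ) {j : Fin 3} {β : ℝ} (hβ : 0 < β) (hC : 6 * C ≤ β) :
    ∃ f, IsVolterraSolution Q (exponents ρ σ j) j f ∧ (∃ M, ∀ x, ‖f x‖ ≤ M) ∧
      ∀ i, ρ i = 0 → scattering Q (exponents ρ σ j) f i j =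
        systemScattering β hβ (fun i => decayKernel (ρ i)) (phasedCoeff Q σ) i j := by
  set κ : Fin 3 → ℝ →ᵇ ℂ := fun i => decayKernel (ρ i) with hκ
  set m := phasedCoeff Q σ with hm
  set S := systemSol β hβ κ m j with hS
  have hspec := systemSol_spec hβ (norm_systemOp_le_half hQ hρ σ hβ hC) j
  set f : ℝ → Fin 3 → ℂ := fun x i => Complex.exp ((x * (σ i - σ j) : ℝ) * Complex.I) *
    (damping β 0 x : ℝ) * S i x with hf
  have hdc : Continuous fun x => damping β 0 x :=
    (continuous_damping β).comp (Continuous.prodMk_right 0)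
  have hfc : Continuous f := continuous_pi fun i =>
    ((by fun_prop : Continuous fun x : ℝ => Complex.exp ((x * (σ i - σ j) : ℝ) * Complex.I)).mul
      (Complex.continuous_ofReal.comp hdc)).mul (S i).continuous
  have hfb : ∃ M, ∀ x, ‖f x‖ ≤ M := by
    refine ⟨Real.exp (β * Real.pi) * ‖S‖, fun x =>
      (pi_norm_le_iff_of_nonneg (by positivity)).2 fun i => ?_⟩
    rw [hf, norm_mul, norm_mul, Complex.norm_exp_ofReal_mul_I, one_mul, Complex.norm_real,
      Real.norm_of_nonneg (damping_pos _ _ _).le]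
    refine mul_le_mul (Real.exp_le_exp.2 (mul_le_mul_of_nonneg_left ?_ hβ.le))
      (((S i).norm_coe_le_norm x).trans (norm_le_pi_norm S i)) (norm_nonneg _) (Real.exp_pos _).le
    have := Real.neg_pi_div_two_lt_arctan x
    have := Real.pi_pos
    rw [Real.arctan_zero]
    linarith
  -- the coefficient acting on the solution, back in the original picture
  have hcoef : ∀ (i : Fin 3) (y : ℝ), ((damping β 0 y * weight y : ℝ) : ℂ) * ∑ l, m i l y * S l y
      = Complex.exp (-(y * (σ i - σ j) : ℝ) * Complex.I) * (Q y *ᵥ f y) i := by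
    intro i y
    change _ = _ * ∑ l, Q y i l * f y l
    rw [Finset.mul_sum, Finset.mul_sum]
    refine Finset.sum_congr rfl fun l _ => ?_
    rw [hm, phasedCoeff_apply hQ, hf]
    have h1 : Complex.exp (-(y * (σ i - σ l) : ℝ) * Complex.I) =
        Complex.exp (-(y * (σ i - σ j) : ℝ) * Complex.I) *
          Complex.exp ((y * (σ l - σ j) : ℝ) * Complex.I) := by
      rw [← Complex.exp_add]
      push_cast
      ring_nf
    have h2 : (weight y : ℂ) * ((1 + y ^ 2 : ℝ) : ℂ) = 1 := by exact_mod_cast weight_mul y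
    rw [h1]
    push_cast at h2 ⊢
    linear_combination (damping β 0 y * (Complex.exp (-(y * (σ i - σ j)) * Complex.I) *
      Complex.exp (y * (σ l - σ j) * Complex.I) * Q y i l) * S l y : ℂ) * h2
  have hintegrable : ∀ (x : ℝ) (i : Fin 3), IntegrableOn
      (fun y : ℝ => Complex.exp ((x - y) * exponents ρ σ j i) * (Q y *ᵥ f y) i) (Ioi x) :=
    fun x i => by
      obtain ⟨M, hM⟩ := hfb
      exact hQ.integrable_mul hfc measurableSet_Ioi (fun y _ => hM y) (continuous_cexp_sub_mul x _)
        (fun y hy => norm_cexp_mul_le_one (le_of_lt hy) (by rw [exponents_re]; exact hρ i)) i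
  refine ⟨f, ⟨hfc, ?_, hintegrable, fun x i => ?_⟩, hfb, fun i hi => ?_⟩
  · obtain ⟨M, hM⟩ := hfb
    exact IsBigO.of_bound M (Eventually.of_forall fun x => by simpa using hM x)
  · have h1 : f x i = Complex.exp ((x * (σ i - σ j) : ℝ) * Complex.I) * (damping β 0 x : ℝ) *
        ((if i = j then 1 else 0) * (damping β x 0 : ℝ) -
          ∑ l, volterraFun β (κ i) (m i l * S l) x) := by rw [← hspec]
    have hdd : (damping β 0 x : ℂ) * (damping β x 0 : ℝ) = 1 := by
      rw [← Complex.ofReal_mul]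
      unfold damping
      rw [← Real.exp_add]
      simp
    have hdelta : Complex.exp ((x * (σ i - σ j) : ℝ) * Complex.I) *
        (if i = j then (1 : ℂ) else 0) = if i = j then 1 else 0 := by
      by_cases hij : i = j
      · subst hij; simp
      · simp [hij]
    have hsum : ∑ l, volterraFun β (κ i) (m i l * S l) x =
        ∫ y in Ioi x, ∑ l, κ i (y - x) * (damping β x y * weight y : ℝ) * (m i l * S l) y :=
      (integral_finsetSum _ fun l _ => integrableOn_volterraIntegrand hβ _ _ _).symm
    have hker : Complex.exp ((x * (σ i - σ j) : ℝ) * Complex.I) * (damping β 0 x : ℝ) *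
        ∑ l, volterraFun β (κ i) (m i l * S l) x =
        ∫ y in Ioi x, Complex.exp ((x - y) * exponents ρ σ j i) * (Q y *ᵥ f y) i := by
      rw [hsum, ← integral_const_mul]
      refine setIntegral_congr_fun measurableSet_Ioi fun y hy => ?_
      have hxy : x < y := hy
      rw [← Finset.mul_sum]
      have h2 := hcoef i y
      have h3 : κ i (y - x) = Complex.exp ((x - y) * ρ i) := by
        rw [hκ, decayKernel_apply (hρ i), abs_of_pos (by linarith)]
        congr 1
        push_cast
        ring
      have h4 : (damping β 0 x : ℂ) * damping β x y = damping β 0 y := by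
        rw [← Complex.ofReal_mul]
        unfold damping
        rw [← Real.exp_add]
        ring_nf
      have h5 : Complex.exp ((x - y) * exponents ρ σ j i) =
          Complex.exp ((x * (σ i - σ j) : ℝ) * Complex.I) * Complex.exp ((x - y) * ρ i) *
            Complex.exp (-(y * (σ i - σ j) : ℝ) * Complex.I) := by
        rw [← Complex.exp_add, ← Complex.exp_add]
        unfold exponents
        push_cast
        ring_nf
      rw [h5, mul_assoc (_ * _) _ ((Q y *ᵥ f y) i), ← h2, h3]
      simp only [BoundedContinuousFunction.coe_mul, Pi.mul_apply, Complex.ofReal_mul]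
      rw [← h4]
      ring
    rw [h1, mul_sub, hker]
    congr 1
    linear_combination hdelta + (Complex.exp ((x * (σ i - σ j) : ℝ) * Complex.I) *
        (if i = j then (1 : ℂ) else 0)) * hdd
  · unfold scattering systemScattering
    congr 1
    rw [weightedIntegral_apply]
    congr 1
    ext y
    simp only [BoundedContinuousFunction.coe_sum, Finset.sum_apply, BoundedContinuousFunction.coe_mul,
      Pi.mul_apply]
    rw [hcoef]
    unfold exponents
    rw [hi]
    push_cast
    ring_nf

theorem integrable_scattering (hQ : IsPotential Q C) {ρ σ : Fin 3 → ℝ} {j : Fin 3}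
    {f : ℝ → Fin 3 → ℂ} (hf : Continuous f) {M : ℝ} (hM : ∀ x, ‖f x‖ ≤ M) {i : Fin 3}
    (hi : ρ i = 0) :
    Integrable fun y : ℝ => Complex.exp (-y * exponents ρ σ j i) * (Q y *ᵥ f y) i := by
  rw [← integrableOn_univ]
  refine hQ.integrable_mul hf MeasurableSet.univ (fun y _ => hM y) (by fun_prop) (fun y _ => ?_) i
  rw [Complex.norm_exp, Real.exp_le_one_iff]
  simp [exponents, hi]

/-! ### Exponential families of multipliers -/

/-- A continuous multiplier `q` all of whose products with powers of the phase `p` are bounded. -/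
def PhaseDecay (p q : ℝ → ℂ) : Prop :=
  Continuous q ∧ ∀ n : ℕ, ∃ C, ∀ t, ‖p t ^ n * q t‖ ≤ C

theorem PhaseDecay.mul_left {p q : ℝ → ℂ} (hp : Continuous p) (h : PhaseDecay p q) :
    PhaseDecay p (fun t => p t * q t) := by
  refine ⟨hp.mul h.1, fun n => ?_⟩
  obtain ⟨C, hC⟩ := h.2 (n + 1)
  exact ⟨C, fun t => by rw [← mul_assoc, ← pow_succ]; exact hC t⟩

/-- The family `r ↦ e^{r p(·)} q(·)` in `C_b(ℝ, ℂ)`. -/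
def expFamily (p q : ℝ → ℂ) (r : ℝ) : ℝ →ᵇ ℂ := toBCF fun t => Complex.exp (r * p t) * q t

theorem norm_exp_mul_aux {p q : ℝ → ℂ} {r : ℝ} (hr : ∀ t, (r * p t).re ≤ 0) (t : ℝ) :
    ‖Complex.exp (r * p t) * q t‖ ≤ ‖q t‖ := by
  rw [norm_mul, Complex.norm_exp]
  exact mul_le_of_le_one_left (norm_nonneg _) (Real.exp_le_one_iff.2 (hr t))

theorem expFamily_apply {p q : ℝ → ℂ} (hp : Continuous p) (hq : PhaseDecay p q) {r : ℝ}
    (hr : ∀ t, (r * p t).re ≤ 0) (t : ℝ) : expFamily p q r t = Complex.exp (r * p t) * q t := by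
  obtain ⟨C, hC⟩ := hq.2 0
  have := hq.1
  exact toBCF_apply (by fun_prop) (fun t => (norm_exp_mul_aux hr t).trans (by simpa using hC t)) t

/-- In a region where the exponentials are bounded by `1`, the family `e^{r p} q` may be
differentiated in the supremum norm, by a second-order Taylor estimate that only needs `p² q` to be
bounded. -/
theorem hasDerivAt_expFamily {p q : ℝ → ℂ} (hp : Continuous p) (hq : PhaseDecay p q) {U : Set ℝ}
    (hU : IsOpen U) (hre : ∀ r ∈ U, ∀ t, ((r : ℂ) * p t).re ≤ 0) {r : ℝ} (hr : r ∈ U) :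
    HasDerivAt (expFamily p q) (expFamily p (fun t => p t * q t) r) r := by
  obtain ⟨C, hC⟩ := hq.2 2
  have hC0 : 0 ≤ C := (norm_nonneg _).trans (hC 0)
  obtain ⟨δ, hδ, hball⟩ := Metric.isOpen_iff.1 hU r hr
  refine hasDerivAt_of_norm_le (C := C) hδ fun h hh => ?_
  have hseg : ∀ s ∈ uIcc r (r + h), s ∈ U := fun s hs => by
    refine hball ?_
    rw [Metric.mem_ball, Real.dist_eq]
    have := Set.abs_sub_left_of_mem_uIcc hs
    rw [add_sub_cancel_left] at this
    exact this.trans_lt hh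
  refine (BoundedContinuousFunction.norm_le (by positivity)).2 fun t => ?_
  simp only [BoundedContinuousFunction.coe_sub, BoundedContinuousFunction.coe_smul, Pi.sub_apply]
  rw [expFamily_apply hp hq (hre _ (hseg _ right_mem_uIcc)), expFamily_apply hp hq (hre _ hr),
    expFamily_apply hp (hq.mul_left hp) (hre _ hr)]
  have hd : ∀ (c : ℂ) (s : ℝ), HasDerivAt (fun s : ℝ => Complex.exp (s * p t) * c)
      (Complex.exp (s * p t) * (p t * c)) s := fun c s => by
    have := (((Complex.ofRealCLM.hasDerivAt (x := s)).mul_const (p t)).cexp).mul_const c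
    refine this.congr_deriv ?_
    simp
    ring
  exact norm_taylor_le (f := fun s : ℝ => Complex.exp (s * p t) * q t) (fun s _ => hd _ s)
    (fun s _ => hd _ s) fun s hs => (norm_exp_mul_aux (q := fun t => p t * (p t * q t))
      (hre s (hseg s hs)) t).trans (by simpa [pow_two, mul_assoc] using hC t)

theorem BddDerivs.expFamily {p q : ℝ → ℂ} (hp : Continuous p) (hq : PhaseDecay p q) {U : Set ℝ}
    (hU : IsOpen U) (hre : ∀ r ∈ U, ∀ t, ((r : ℂ) * p t).re ≤ 0) {S : Set ℝ} {n : ℕ}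
    {τ τ' : ℝ → ℝ} (hτ : ∀ r ∈ S, τ r ∈ U) (hτd : ∀ r ∈ S, HasDerivAt τ (τ' r) r)
    (hτ' : BddDerivs S n fun _ : Unit => τ') :
    BddDerivs S n fun (_ : Unit) r => expFamily p q (τ r) :=
  BddDerivs.comp_of_step (PhaseDecay p) (Tzitzeica.expFamily p) (fun q t => p t * q t)
    (fun _ h => h.mul_left hp) (fun _ h _ hr => hasDerivAt_expFamily hp h hU hre hr)
    (fun q h => by
      obtain ⟨C, hC⟩ := h.2 0
      exact ⟨C, fun r hr => norm_toBCF_le fun t => (norm_exp_mul_aux (hre r hr) t).trans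
        (by simpa using hC t)⟩)
    (fun _ => hτ) (fun _ => hτd) hτ' hq

end

noncomputable section

/-! ### The Lax operator -/

theorem omega_eq : omega = -1 / 2 + (Real.sqrt 3 / 2 : ℝ) * Complex.I := by
  unfold omega
  have h : (2 * Real.pi * Complex.I / 3 : ℂ) = ((Real.pi - Real.pi / 3 : ℝ) : ℂ) * Complex.I := by
    push_cast
    ring
  rw [h, Complex.exp_mul_I, ← Complex.ofReal_cos, ← Complex.ofReal_sin, Real.cos_pi_sub,
    Real.sin_pi_sub, Real.cos_pi_div_three, Real.sin_pi_div_three]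
  push_cast
  ring

theorem sqrt_three_sq : (Real.sqrt 3 : ℂ) ^ 2 = 3 := by
  rw [← Complex.ofReal_pow, Real.sq_sqrt (by norm_num)]
  norm_num

theorem omega_quadratic : omega ^ 2 + omega + 1 = 0 := by
  rw [omega_eq]
  push_cast
  linear_combination (1 / 4 : ℂ) * Complex.I ^ 2 * sqrt_three_sq + 3 / 4 * Complex.I_sq

theorem omega_cube : omega ^ 3 = 1 := by
  linear_combination (omega - 1) * omega_quadratic

theorem omega_sq : omega ^ 2 = -omega - 1 := by
  linear_combination omega_quadratic

theorem I_mul_sqrt_three : Complex.I * (Real.sqrt 3 : ℂ) = 2 * omega + 1 := by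
  rw [omega_eq]
  push_cast
  ring

theorem conj_omega : (starRingEnd ℂ) omega = omega ^ 2 := by
  rw [omega_sq, omega_eq]
  simp only [map_add, map_mul, map_div₀, map_neg, map_one, Complex.conj_ofReal, Complex.conj_I,
    map_ofNat]
  push_cast
  ring

theorem norm_omega : ‖omega‖ = 1 := by
  have h := congrArg norm omega_cube
  rw [norm_pow, norm_one] at h
  exact (pow_eq_one_iff_of_nonneg (norm_nonneg _) (by norm_num)).1 h

theorem l_zero (z : ℂ) : l z 0 = (omega * z + omega ^ 2 * z⁻¹) / 2 := by
  have h : omega⁻¹ = omega ^ 2 := by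
    rw [inv_eq_iff_eq_inv]
    exact eq_inv_of_mul_eq_one_left (by rw [← omega_cube]; ring)
  have h1 : l z 0 = (omega * z + (omega * z)⁻¹) / 2 := by simp [l]
  rw [h1, mul_inv, h]

theorem l_one (z : ℂ) : l z 1 = (omega ^ 2 * z + omega * z⁻¹) / 2 := by
  have h : (omega ^ 2)⁻¹ = omega := by
    rw [inv_eq_iff_eq_inv]
    exact eq_inv_of_mul_eq_one_left (by rw [← omega_cube]; ring)
  have h1 : l z 1 = (omega ^ 2 * z + (omega ^ 2 * z)⁻¹) / 2 := by norm_num [l]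
  rw [h1, mul_inv, h]

theorem l_two (z : ℂ) : l z 2 = (z + z⁻¹) / 2 := by
  simp [l, omega_cube]

/-- The common factor of the imaginary parts of the exponents at `k > 0`. -/
def phase (k : ℝ) : ℝ := Real.sqrt 3 / 4 * (k - k⁻¹)

/-- The imaginary parts of the exponents at `k > 0`. -/
def imExp (k : ℝ) (i : Fin 3) : ℝ := ![1, -1, 0] i * phase k

/-- The real parts of the differences `l i - l j`, `j = 0, 1`, at `k > 0`. -/
def reExp (k : ℝ) (i : Fin 3) : ℝ := ![0, 0, 3 / 4 * (k + k⁻¹)] i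

theorem reExp_nonneg {k : ℝ} (hk : 0 < k) (i : Fin 3) : 0 ≤ reExp k i := by
  have : 0 < k⁻¹ := inv_pos.2 hk
  fin_cases i <;> simp [reExp]
  positivity

theorem reExp_eq_zero (k : ℝ) {j : Fin 3} (hj : j = 0 ∨ j = 1) : reExp k j = 0 := by
  rcases hj with rfl | rfl <;> simp [reExp]

theorem l_sub_l (k : ℝ) {j : Fin 3} (hj : j = 0 ∨ j = 1) (i : Fin 3) :
    l k i - l k j = exponents (reExp k) (imExp k) j i := by
  have h0 : l (k : ℂ) 0 = -(k + (k : ℂ)⁻¹) / 4 + Complex.I * (phase k : ℝ) := by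
    rw [l_zero, omega_sq, omega_eq, phase]
    push_cast
    ring
  have h1 : l (k : ℂ) 1 = -(k + (k : ℂ)⁻¹) / 4 - Complex.I * (phase k : ℝ) := by
    rw [l_one, omega_sq, omega_eq, phase]
    push_cast
    ring
  have h2 := l_two (k : ℂ)
  rcases hj with rfl | rfl <;> fin_cases i <;> simp [exponents, reExp, imExp, h0, h1, h2] <;> ring

/-- Coefficients of `L₁` along `u₀' + u₁`. -/
def lax0 (i l : Fin 3) : ℂ := U0 1 i l

/-- Coefficients of `L₁` along `z⁻¹ (e^{u₀} - 1)`. -/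
def lax1 : Matrix (Fin 3) (Fin 3) ℂ :=
  (1 / 6 : ℂ) • !![2 * omega ^ 2, -1, -omega; -1, 2 * omega, -omega ^ 2; -omega, -omega ^ 2, 2]

/-- Coefficients of `L₁` along `z⁻¹ (e^{-2u₀} - 1)`. -/
def lax2 : Matrix (Fin 3) (Fin 3) ℂ :=
  (1 / 6 : ℂ) • !![omega ^ 2, 1, omega; 1, omega, omega ^ 2; omega, omega ^ 2, 1]

theorem norm_lax0_le (i l : Fin 3) : ‖lax0 i l‖ ≤ 1 := by
  have h3 : Real.sqrt 3 ≤ 2 := Real.sqrt_le_iff.2 (by norm_num)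
  have h : ‖(Complex.I * (Real.sqrt 3 : ℂ) * ((1 : ℝ) : ℂ) / 6)‖ ≤ 1 := by
    rw [norm_div, norm_mul, norm_mul, Complex.norm_I, Complex.norm_real, Complex.norm_real,
      Real.norm_of_nonneg (Real.sqrt_nonneg _)]
    norm_num
    linarith
  fin_cases i <;> fin_cases l <;> simp [lax0, U0] <;> simpa using h

theorem norm_lax1_le (i l : Fin 3) : ‖lax1 i l‖ ≤ 1 := by
  fin_cases i <;> fin_cases l <;> simp [lax1, norm_omega] <;> norm_num

theorem norm_lax2_le (i l : Fin 3) : ‖lax2 i l‖ ≤ 1 := by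
  fin_cases i <;> fin_cases l <;> simp [lax2, norm_omega] <;> norm_num

variable (u₀ u₁ : SchwartzMap ℝ ℝ)

theorem L1_apply (z : ℂ) (y : ℝ) (i m : Fin 3) :
    L1 u₀ u₁ z y i m = ((deriv u₀ y + u₁ y : ℝ) : ℂ) * lax0 i m +
      z⁻¹ * (((Real.exp (u₀ y) - 1 : ℝ) : ℂ) * lax1 i m +
        ((Real.exp (-2 * u₀ y) - 1 : ℝ) : ℂ) * lax2 i m) := by
  simp only [L1, L, J, lax0, lax1, lax2, U0, U1, Matrix.add_apply, Matrix.sub_apply,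
    Matrix.smul_apply, Matrix.diagonal_apply, smul_eq_mul]
  fin_cases i <;> fin_cases m <;> simp [l_zero, l_one, l_two] <;> ring

/-! ### Rapidly decreasing functions -/

/-- A real function with `n` derivatives, all of them (itself included) decaying faster than every
power of `y`. -/
def RapidDerivs : ℕ → (ℝ → ℝ) → Prop
  | 0, q => ∀ N : ℕ, ∃ C, ∀ y, |y| ^ N * |q y| ≤ C
  | n + 1, q => (∀ N : ℕ, ∃ C, ∀ y, |y| ^ N * |q y| ≤ C) ∧
      ∃ q' : ℝ → ℝ, (∀ y, HasDerivAt q (q' y) y) ∧ RapidDerivs n q'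

theorem RapidDerivs.decay {n : ℕ} {q : ℝ → ℝ} (h : RapidDerivs n q) (N : ℕ) :
    ∃ C, ∀ y, |y| ^ N * |q y| ≤ C := by
  cases n with
  | zero => exact h N
  | succ n => exact h.1 N

theorem RapidDerivs.of_succ {n : ℕ} {q : ℝ → ℝ} (h : RapidDerivs (n + 1) q) : RapidDerivs n q := by
  induction n generalizing q with
  | zero => exact h.1
  | succ n ih =>
    obtain ⟨hb, q', hq', h'⟩ := h
    exact ⟨hb, q', hq', ih h'⟩

theorem RapidDerivs.continuous {n : ℕ} {q : ℝ → ℝ} (h : RapidDerivs (n + 1) q) : Continuous q := by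
  obtain ⟨-, q', hq', -⟩ := h
  exact continuous_iff_continuousAt.2 fun y => (hq' y).continuousAt

theorem RapidDerivs.add {n : ℕ} {p q : ℝ → ℝ} (hp : RapidDerivs n p) (hq : RapidDerivs n q) :
    RapidDerivs n (fun y => p y + q y) := by
  have key : ∀ p q : ℝ → ℝ, (∀ N : ℕ, ∃ C, ∀ y, |y| ^ N * |p y| ≤ C) →
      (∀ N : ℕ, ∃ C, ∀ y, |y| ^ N * |q y| ≤ C) → ∀ N : ℕ, ∃ C, ∀ y, |y| ^ N * |p y + q y| ≤ C := by
    intro p q hp hq N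
    obtain ⟨C, hC⟩ := hp N
    obtain ⟨D, hD⟩ := hq N
    refine ⟨C + D, fun y => ?_⟩
    calc |y| ^ N * |p y + q y| ≤ |y| ^ N * (|p y| + |q y|) := by gcongr; exact abs_add_le _ _
      _ ≤ C + D := by rw [mul_add]; exact add_le_add (hC y) (hD y)
  induction n generalizing p q with
  | zero => exact key p q hp hq
  | succ n ih =>
    obtain ⟨hpb, p', hp', hp⟩ := hp
    obtain ⟨hqb, q', hq', hq⟩ := hq
    exact ⟨key p q hpb hqb, _, fun y => (hp' y).add (hq' y), ih hp hq⟩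

theorem RapidDerivs.mul {n : ℕ} {p q : ℝ → ℝ} (hp : RapidDerivs n p) (hq : RapidDerivs n q) :
    RapidDerivs n (fun y => p y * q y) := by
  have key : ∀ p q : ℝ → ℝ, (∀ N : ℕ, ∃ C, ∀ y, |y| ^ N * |p y| ≤ C) →
      (∀ N : ℕ, ∃ C, ∀ y, |y| ^ N * |q y| ≤ C) → ∀ N : ℕ, ∃ C, ∀ y, |y| ^ N * |p y * q y| ≤ C := by
    intro p q hp hq N
    obtain ⟨C, hC⟩ := hp N
    obtain ⟨D, hD⟩ := hq 0
    refine ⟨C * D, fun y => ?_⟩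
    have h1 := hC y
    have h2 := hD y
    rw [pow_zero, one_mul] at h2
    rw [abs_mul, ← mul_assoc]
    exact mul_le_mul h1 h2 (abs_nonneg _) (le_trans (by positivity) h1)
  induction n generalizing p q with
  | zero => exact key p q hp hq
  | succ n ih =>
    have hp0 := hp.of_succ
    have hq0 := hq.of_succ
    obtain ⟨hpb, p', hp', hp⟩ := hp
    obtain ⟨hqb, q', hq', hq⟩ := hq
    exact ⟨key p q hpb hqb, _, fun y => (hp' y).mul (hq' y), (ih hp hq0).add (ih hp0 hq)⟩

theorem RapidDerivs.const_mul {n : ℕ} {q : ℝ → ℝ} (c : ℝ) (hq : RapidDerivs n q) :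
    RapidDerivs n (fun y => c * q y) := by
  have key : ∀ q : ℝ → ℝ, (∀ N : ℕ, ∃ C, ∀ y, |y| ^ N * |q y| ≤ C) →
      ∀ N : ℕ, ∃ C, ∀ y, |y| ^ N * |c * q y| ≤ C := by
    intro q hq N
    obtain ⟨C, hC⟩ := hq N
    refine ⟨|c| * C, fun y => ?_⟩
    rw [abs_mul, mul_left_comm]
    exact mul_le_mul_of_nonneg_left (hC y) (abs_nonneg _)
  induction n generalizing q with
  | zero => exact key q hq
  | succ n ih =>
    obtain ⟨hqb, q', hq', hq⟩ := hq
    exact ⟨key q hqb, _, fun y => (hq' y).const_mul c, ih hq⟩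

theorem rapidDerivs_schwartz (f : SchwartzMap ℝ ℝ) (n : ℕ) : RapidDerivs n f := by
  have key : ∀ f : SchwartzMap ℝ ℝ, ∀ N : ℕ, ∃ C, ∀ y, |y| ^ N * |f y| ≤ C := fun f N => by
    obtain ⟨C, -, hC⟩ := f.decay N 0
    exact ⟨C, fun y => by simpa using hC y⟩
  induction n generalizing f with
  | zero => exact key f
  | succ n ih =>
    exact ⟨key f, _, fun y => (f.differentiableAt).hasDerivAt, ih (SchwartzMap.derivCLM ℝ ℝ f)⟩

/-- `e^{c u} - 1` is rapidly decreasing: it is bounded by a multiple of `u`, and its derivative is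
`c u' (e^{c u} - 1) + c u'`. -/
theorem rapidDerivs_exp_sub_one (f : SchwartzMap ℝ ℝ) (c : ℝ) (n : ℕ) :
    RapidDerivs n (fun y => Real.exp (c * f y) - 1) := by
  have h0 : ∀ N : ℕ, ∃ C, ∀ y, |y| ^ N * |Real.exp (c * f y) - 1| ≤ C := by
    intro N
    obtain ⟨D, hD⟩ := (rapidDerivs_schwartz f 0) 0
    obtain ⟨C, hC⟩ := (rapidDerivs_schwartz f 0) N
    have hD' : ∀ y, |c * f y| ≤ |c| * D := fun y => by
      rw [abs_mul]
      have := hD y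
      rw [pow_zero, one_mul] at this
      gcongr
    refine ⟨|c| * Real.exp (|c| * D) * C, fun y => ?_⟩
    have h1 : |Real.exp (c * f y) - 1| ≤ |c * f y| * Real.exp (|c| * D) := by
      have h2 : |Real.exp (c * f y) - 1| ≤ |c * f y| * Real.exp |c * f y| := by
        set t := c * f y
        have h3 := Real.add_one_le_exp t
        have h4 := Real.add_one_le_exp (-t)
        have h5 : Real.exp t * Real.exp (-t) = 1 := by rw [← Real.exp_add]; simp
        have h6 := Real.exp_pos t
        rcases le_total 0 t with ht | ht
        · rw [abs_of_nonneg ht, abs_of_nonneg (by linarith)]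
          nlinarith
        · rw [abs_of_nonpos ht, abs_of_nonpos (by linarith [Real.exp_le_one_iff.2 ht])]
          have := Real.one_le_exp (neg_nonneg.2 ht)
          nlinarith
      exact h2.trans (mul_le_mul_of_nonneg_left (Real.exp_le_exp.2 (hD' y)) (abs_nonneg _))
    calc |y| ^ N * |Real.exp (c * f y) - 1| ≤ |y| ^ N * (|c * f y| * Real.exp (|c| * D)) := by
          gcongr
      _ = |c| * Real.exp (|c| * D) * (|y| ^ N * |f y|) := by rw [abs_mul]; ring
      _ ≤ _ := by gcongr; exact hC y
  induction n with
  | zero => exact h0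
  | succ n ih =>
    have hd := (rapidDerivs_schwartz (SchwartzMap.derivCLM ℝ ℝ f) n).const_mul c
    refine ⟨h0, _, fun y => ?_, (hd.mul ih).add hd⟩
    have := ((f.differentiableAt (x := y)).hasDerivAt.const_mul c).exp.sub_const 1
    refine this.congr_deriv ?_
    simp only [SchwartzMap.derivCLM_apply]
    ring

/-- The coefficients of `L₁` along which it is linear. -/
def laxData (u₀ u₁ : SchwartzMap ℝ ℝ) : Fin 3 → ℝ → ℝ :=
  ![fun y => deriv u₀ y + u₁ y, fun y => Real.exp (u₀ y) - 1, fun y => Real.exp (-2 * u₀ y) - 1]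

theorem rapidDerivs_laxData (c : Fin 3) (n : ℕ) : RapidDerivs n (laxData u₀ u₁ c) := by
  fin_cases c
  · exact (rapidDerivs_schwartz (SchwartzMap.derivCLM ℝ ℝ u₀) n).add (rapidDerivs_schwartz u₁ n)
  · have h := rapidDerivs_exp_sub_one u₀ 1 n
    simp only [one_mul] at h
    exact h
  · exact rapidDerivs_exp_sub_one u₀ (-2) n

/-- The constant matrices multiplying `laxData` in `L₁`, including the factors `z⁻¹`. -/
def laxMatrix (z : ℂ) (i m : Fin 3) : Fin 3 → ℂ := ![lax0 i m, z⁻¹ * lax1 i m, z⁻¹ * lax2 i m]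

theorem L1_eq_sum (z : ℂ) (y : ℝ) (i m : Fin 3) :
    L1 u₀ u₁ z y i m = ∑ c, laxMatrix z i m c * (laxData u₀ u₁ c y : ℝ) := by
  rw [L1_apply, Fin.sum_univ_three]
  simp [laxMatrix, laxData]
  ring

theorem norm_laxMatrix_le {k₀ k : ℝ} (hk₀ : 0 < k₀) (hk : k₀ ≤ k) (i m c : Fin 3) :
    ‖laxMatrix k i m c‖ ≤ 1 + k₀⁻¹ := by
  have h1 : ‖(k : ℂ)⁻¹‖ ≤ k₀⁻¹ := by
    rw [norm_inv, Complex.norm_real, Real.norm_of_nonneg (hk₀.le.trans hk)]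
    exact inv_anti₀ hk₀ hk
  have h2 : 0 < k₀⁻¹ := inv_pos.2 hk₀
  have h3 : ∀ w : ℂ, ‖w‖ ≤ 1 → ‖(k : ℂ)⁻¹ * w‖ ≤ 1 + k₀⁻¹ := fun w hw => by
    rw [norm_mul]
    calc _ ≤ k₀⁻¹ * 1 := by gcongr
      _ ≤ _ := by linarith
  fin_cases c
  · exact (norm_lax0_le i m).trans (by linarith)
  · exact h3 _ (norm_lax1_le i m)
  · exact h3 _ (norm_lax2_le i m)

theorem exists_weight_bound {n : ℕ} {q : ℝ → ℝ} (h : RapidDerivs n q) :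
    ∃ C, 0 ≤ C ∧ ∀ y, (1 + y ^ 2) * |q y| ≤ C := by
  obtain ⟨C, hC⟩ := h.decay 0
  obtain ⟨D, hD⟩ := h.decay 2
  refine ⟨C + D, add_nonneg (le_trans (by positivity) (hC 0)) (le_trans (by positivity) (hD 0)),
    fun y => ?_⟩
  have h1 := hC y
  have h2 := hD y
  rw [sq_abs] at h2
  rw [pow_zero] at h1
  linarith

/-- All translates of `L₁` by less than `1` are potentials, with a bound uniform in `k ≥ k₀`. -/
theorem exists_isPotential {k₀ : ℝ} (hk₀ : 0 < k₀) : ∃ C, 0 < C ∧ ∀ k : ℝ, k₀ ≤ k → ∀ a : ℝ,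
    |a| < 1 → IsPotential (fun y => L1 u₀ u₁ k (y + a)) C := by
  have h1 := fun c => exists_weight_bound (rapidDerivs_laxData u₀ u₁ c 0)
  choose D hD0 hD using h1
  have hk₀' : 0 < k₀⁻¹ := inv_pos.2 hk₀
  refine ⟨(∑ c, (1 + k₀⁻¹) * (3 * D c)) + 1, ?_, fun k hk a ha => ⟨fun i m => ?_, fun i m y => ?_⟩⟩
  · have : 0 ≤ ∑ c, (1 + k₀⁻¹) * (3 * D c) :=
      Finset.sum_nonneg fun c _ => by have := hD0 c; positivity
    linarith
  · simp only [L1_eq_sum]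
    refine continuous_finsetSum _ fun c _ => continuous_const.mul (Complex.continuous_ofReal.comp ?_)
    exact (rapidDerivs_laxData u₀ u₁ c 1).continuous.comp (by fun_prop)
  · rw [L1_eq_sum]
    have hw := weight_pos y
    have hterm : ∀ c, ‖laxMatrix k i m c * (laxData u₀ u₁ c (y + a) : ℝ)‖
        ≤ (1 + k₀⁻¹) * (3 * D c) * weight y := fun c => by
      rw [norm_mul, Complex.norm_real, Real.norm_eq_abs, mul_assoc]
      refine mul_le_mul (norm_laxMatrix_le hk₀ hk i m c) ?_ (abs_nonneg _) (by positivity)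
      have h2 := hD c (y + a)
      have h3 : 1 + y ^ 2 ≤ 3 * (1 + (y + a) ^ 2) := by
        have := (abs_lt.1 ha).1
        have := (abs_lt.1 ha).2
        nlinarith [sq_nonneg (y + 2 * a)]
      have h4 : (1 + y ^ 2) * |laxData u₀ u₁ c (y + a)| ≤ 3 * D c := by
        calc _ ≤ 3 * (1 + (y + a) ^ 2) * |laxData u₀ u₁ c (y + a)| := by gcongr
          _ ≤ _ := by linarith
      calc |laxData u₀ u₁ c (y + a)|
          = (1 + y ^ 2) * |laxData u₀ u₁ c (y + a)| * weight y := by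
            linear_combination (-|laxData u₀ u₁ c (y + a)|) * weight_mul y
        _ ≤ _ := by gcongr
    refine (norm_sum_le_of_le _ fun c _ => hterm c).trans ?_
    rw [← Finset.sum_mul]
    gcongr
    linarith

end

noncomputable section

variable (u₀ u₁ : SchwartzMap ℝ ℝ)

/-! ### Jost columns of the Lax operator on the positive axis -/

theorem isJostColumn_iff {k : ℝ} {j : Fin 3} (hj : j = 0 ∨ j = 1) (f : ℝ → Fin 3 → ℂ) :
    IsJostColumn u₀ u₁ k j f ↔
      IsVolterraSolution (L1 u₀ u₁ k) (exponents (reExp k) (imExp k) j) j f := by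
  have h : IsJostColumn u₀ u₁ k j f ↔
      IsVolterraSolution (L1 u₀ u₁ k) (fun i => l k i - l k j) j f :=
    ⟨fun h => ⟨h.1, h.2, h.3, h.4⟩, fun h => ⟨h.1, h.2, h.3, h.4⟩⟩
  rw [h, funext (l_sub_l k hj)]

theorem isPotential_L1 {k : ℝ} (hk : 0 < k) : ∃ C, 0 < C ∧ IsPotential (L1 u₀ u₁ k) C := by
  obtain ⟨C, hC, h⟩ := exists_isPotential u₀ u₁ hk
  exact ⟨C, hC, by simpa using h k le_rfl 0 (by simp)⟩

theorem existsUnique_isJostColumn {k : ℝ} (hk : 0 < k) {j : Fin 3} (hj : j = 0 ∨ j = 1) :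
    ∃! f, IsJostColumn u₀ u₁ k j f := by
  obtain ⟨C, hC, hQ⟩ := isPotential_L1 u₀ u₁ hk
  obtain ⟨f, hf, -, -⟩ := exists_isVolterraSolution hQ (reExp_nonneg hk) (imExp k) (j := j)
    (β := 6 * C) (by positivity) le_rfl
  refine ⟨f, (isJostColumn_iff u₀ u₁ hj f).2 hf, fun g hg => ?_⟩
  exact ((isJostColumn_iff u₀ u₁ hj g).1 hg).unique hQ
    (fun i => by rw [exponents_re]; exact reExp_nonneg hk i) hf

theorem jost_spec {k : ℝ} (hk : 0 < k) {j : Fin 3} (hj : j = 0 ∨ j = 1) :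
    IsVolterraSolution (L1 u₀ u₁ k) (exponents (reExp k) (imExp k) j) j (jost u₀ u₁ k j) := by
  have h := (existsUnique_isJostColumn u₀ u₁ hk hj).exists
  rw [← isJostColumn_iff u₀ u₁ hj, jost, dif_pos h]
  exact h.choose_spec

theorem jost_unique {k : ℝ} (hk : 0 < k) {j : Fin 3} (hj : j = 0 ∨ j = 1) {f : ℝ → Fin 3 → ℂ}
    (hf : IsVolterraSolution (L1 u₀ u₁ k) (exponents (reExp k) (imExp k) j) j f) :
    jost u₀ u₁ k j = f :=
  (existsUnique_isJostColumn u₀ u₁ hk hj).unique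
    ((isJostColumn_iff u₀ u₁ hj _).2 (jost_spec u₀ u₁ hk hj)) ((isJostColumn_iff u₀ u₁ hj f).2 hf)

theorem exists_norm_jost_le {k : ℝ} (hk : 0 < k) {j : Fin 3} (hj : j = 0 ∨ j = 1) :
    ∃ M, ∀ x, ‖jost u₀ u₁ k j x‖ ≤ M := by
  obtain ⟨C, hC, hQ⟩ := isPotential_L1 u₀ u₁ hk
  obtain ⟨f, hf, hM, -⟩ := exists_isVolterraSolution hQ (reExp_nonneg hk) (imExp k) (j := j)
    (β := 6 * C) (by positivity) le_rfl
  rwa [jost_unique u₀ u₁ hk hj hf]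

theorem sIntegrand_eq (k : ℝ) {j : Fin 3} (hj : j = 0 ∨ j = 1) (i : Fin 3) (y : ℝ) :
    sIntegrand u₀ u₁ k i j y = Complex.exp (-y * exponents (reExp k) (imExp k) j i) *
      (L1 u₀ u₁ k y *ᵥ jost u₀ u₁ k j y) i := by
  rw [sIntegrand, l_sub_l k hj]

theorem integrable_sIntegrand {k : ℝ} (hk : 0 < k) {j : Fin 3} (hj : j = 0 ∨ j = 1) :
    Integrable (sIntegrand u₀ u₁ k 0 j) := by
  obtain ⟨C, -, hQ⟩ := isPotential_L1 u₀ u₁ hk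
  obtain ⟨M, hM⟩ := exists_norm_jost_le u₀ u₁ hk hj
  rw [funext (sIntegrand_eq u₀ u₁ k hj 0)]
  exact integrable_scattering hQ (jost_spec u₀ u₁ hk hj).continuous hM
    (reExp_eq_zero k (Or.inl rfl))

theorem s_eq_scattering (k : ℝ) {j : Fin 3} (hj : j = 0 ∨ j = 1) (i : Fin 3) :
    s u₀ u₁ k i j =
      scattering (L1 u₀ u₁ k) (exponents (reExp k) (imExp k) j) (jost u₀ u₁ k j) i j := by
  rw [s, scattering, funext (sIntegrand_eq u₀ u₁ k hj i)]

theorem s_eq_systemScattering {k : ℝ} (hk : 0 < k) {j : Fin 3} (hj : j = 0 ∨ j = 1) {C β : ℝ}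
    (hQ : IsPotential (L1 u₀ u₁ k) C) (hβ : 0 < β) (hC : 6 * C ≤ β) :
    s u₀ u₁ k 0 j = systemScattering β hβ (fun i => decayKernel (reExp k i))
      (phasedCoeff (L1 u₀ u₁ k) (imExp k)) 0 j := by
  obtain ⟨f, hf, -, hs⟩ := exists_isVolterraSolution hQ (reExp_nonneg hk) (imExp k) (j := j) hβ hC
  rw [s_eq_scattering u₀ u₁ k hj, jost_unique u₀ u₁ hk hj hf, hs 0 (reExp_eq_zero k (Or.inl rfl))]

/-! ### Smooth dependence on the spectral parameter -/

theorem bddDerivs_inv {k₀ : ℝ} (hk₀ : 0 < k₀) (n : ℕ) :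
    BddDerivs (Ioi k₀) n fun (_ : Unit) (k : ℝ) => k⁻¹ := by
  have hb : ∃ C : ℝ, ∀ _ : Unit, ∀ k ∈ Ioi k₀, ‖k⁻¹‖ ≤ C := ⟨k₀⁻¹, fun _ k hk => by
    have hk' : k₀ < k := hk
    rw [norm_inv, Real.norm_of_nonneg (hk₀.trans hk').le]
    exact inv_anti₀ hk₀ hk'.le⟩
  induction n with
  | zero => exact hb
  | succ n ih =>
    refine ⟨hb, fun _ k => -(k⁻¹ * k⁻¹), fun _ k hk => ?_, (ih.mul ih).neg⟩
    refine (hasDerivAt_inv (hk₀.trans hk).ne').congr_deriv ?_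
    rw [sq, mul_inv]

theorem hasDerivAt_const_mul_add_inv (c s : ℝ) {k : ℝ} (hk : 0 < k) :
    HasDerivAt (fun k : ℝ => c * (k + s * k⁻¹)) (c * (1 + -s * (k⁻¹ * k⁻¹))) k := by
  refine (((hasDerivAt_id k).add ((hasDerivAt_inv hk.ne').const_mul s)).const_mul c).congr_deriv ?_
  rw [sq, mul_inv]
  ring

theorem bddDerivs_const_mul_add_inv (c s : ℝ) {k₀ : ℝ} (hk₀ : 0 < k₀) (n : ℕ) :
    BddDerivs (Ioi k₀) n fun (_ : Unit) (k : ℝ) => c * (1 + -s * (k⁻¹ * k⁻¹)) :=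
  (BddDerivs.const' c).mul ((BddDerivs.const' 1).add ((BddDerivs.const' (-s)).mul
    ((bddDerivs_inv hk₀ n).mul (bddDerivs_inv hk₀ n))))

theorem phaseDecay_exp_abs :
    PhaseDecay (fun t => -(|t| : ℝ)) (fun t => Complex.exp (-(|t| : ℝ))) := by
  refine ⟨by fun_prop, fun n => ⟨n.factorial, fun t => ?_⟩⟩
  rw [norm_mul, norm_pow, norm_neg, Complex.norm_real, Real.norm_of_nonneg (abs_nonneg t)]
  change |t| ^ n * ‖Complex.exp (-(|t| : ℝ))‖ ≤ _
  rw [← Complex.ofReal_neg, Complex.norm_exp_ofReal, Real.exp_neg]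
  have h := Real.pow_div_factorial_le_exp |t| (abs_nonneg t) n
  rw [← div_eq_mul_inv, div_le_iff₀ (Real.exp_pos _)]
  rw [div_le_iff₀ (by positivity)] at h
  linarith

/-- The third exponent `ρ = 3/4 (k + k⁻¹)` exceeds `1`, and `e^{-ρ|t|} = e^{-(ρ - 1)|t|} e^{-|t|}`
is an exponential family acting on the rapidly decreasing function `e^{-|t|}`. -/
theorem BddDerivs.decayKernel {k₀ : ℝ} (hk₀ : 0 < k₀) (n : ℕ) (i : Fin 3) :
    BddDerivs (Ioi k₀) n fun (_ : Unit) (k : ℝ) => decayKernel (reExp k i) := by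
  have h2 : BddDerivs (Ioi k₀) n fun (_ : Unit) (k : ℝ) =>
      Tzitzeica.decayKernel (3 / 4 * (k + 1 * k⁻¹)) := by
    have hpos : ∀ k ∈ Ioi k₀, 0 < 3 / 4 * (k + 1 * k⁻¹) - 1 := fun k hk => by
      have h0 : 0 < k := hk₀.trans hk
      have h1 : 2 ≤ k + k⁻¹ := by
        have := mul_inv_cancel₀ h0.ne'
        have h3 : 0 < k⁻¹ := inv_pos.2 h0
        nlinarith [sq_nonneg (k - 1)]
      linarith
    have hre : ∀ r ∈ Ioi (0 : ℝ), ∀ t : ℝ, ((r : ℂ) * -(|t| : ℝ)).re ≤ 0 := fun r hr t => by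
      rw [← Complex.ofReal_neg, ← Complex.ofReal_mul, Complex.ofReal_re]
      have hr' : 0 < r := hr
      nlinarith [abs_nonneg t]
    have h := BddDerivs.expFamily (p := fun t => -(|t| : ℝ)) (by fun_prop) phaseDecay_exp_abs
      isOpen_Ioi hre (τ := fun k => 3 / 4 * (k + 1 * k⁻¹) - 1) hpos
      (fun k hk => (hasDerivAt_const_mul_add_inv (3 / 4) 1 (hk₀.trans hk)).sub_const 1)
      (bddDerivs_const_mul_add_inv (3 / 4) 1 hk₀ n)
    refine h.congr isOpen_Ioi fun _ k hk => ?_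
    ext t
    have hk' := hpos k hk
    rw [decayKernel_apply (by linarith),
      expFamily_apply (by fun_prop) phaseDecay_exp_abs (hre _ hk'), ← Complex.exp_add]
    congr 1
    push_cast
    ring
  fin_cases i
  · exact BddDerivs.const' (Tzitzeica.decayKernel 0)
  · exact BddDerivs.const' (Tzitzeica.decayKernel 0)
  · simpa [reExp] using h2

theorem phaseDecay_laxData (c : Fin 3) : PhaseDecay (fun t => -(t * Complex.I))
    (fun t => (((1 + t ^ 2) * laxData u₀ u₁ c t : ℝ) : ℂ)) := by
  refine ⟨?_, fun n => ?_⟩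
  · have := (rapidDerivs_laxData u₀ u₁ c 1).continuous
    fun_prop
  · obtain ⟨C, hC⟩ := (rapidDerivs_laxData u₀ u₁ c 0).decay n
    obtain ⟨D, hD⟩ := (rapidDerivs_laxData u₀ u₁ c 0).decay (n + 2)
    refine ⟨C + D, fun t => ?_⟩
    rw [norm_mul, norm_pow, norm_neg, norm_mul, Complex.norm_I, mul_one, Complex.norm_real,
      Complex.norm_real, Real.norm_eq_abs, Real.norm_eq_abs, abs_mul,
      abs_of_nonneg (by positivity : 0 ≤ 1 + t ^ 2), ← sq_abs t]
    calc _ = |t| ^ n * |laxData u₀ u₁ c t| + |t| ^ (n + 2) * |laxData u₀ u₁ c t| := by ring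
      _ ≤ _ := add_le_add (hC t) (hD t)

theorem BddDerivs.phasedCoeff {k₀ : ℝ} (hk₀ : 0 < k₀) (n : ℕ) (i m : Fin 3) :
    BddDerivs (Ioi k₀) n fun (_ : Unit) (k : ℝ) => phasedCoeff (L1 u₀ u₁ k) (imExp k) i m := by
  set d : ℝ := (![1, -1, 0] : Fin 3 → ℝ) i - (![1, -1, 0] : Fin 3 → ℝ) m with hd
  have hτ : ∀ k : ℝ, imExp k i - imExp k m = d * (Real.sqrt 3 / 4) * (k + -1 * k⁻¹) := fun k => by
    rw [hd, imExp, imExp, phase]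
    ring
  have hre : ∀ r ∈ (univ : Set ℝ), ∀ t : ℝ, ((r : ℂ) * -(t * Complex.I)).re ≤ 0 := fun r _ t => by
    simp
  have hE := fun c => BddDerivs.expFamily (p := fun t => -(t * Complex.I)) (by fun_prop)
    (phaseDecay_laxData u₀ u₁ c) isOpen_univ hre (S := Ioi k₀) (n := n) (fun _ _ => mem_univ _)
    (fun k hk => hasDerivAt_const_mul_add_inv (d * (Real.sqrt 3 / 4)) (-1) (hk₀.trans hk))
    (bddDerivs_const_mul_add_inv (d * (Real.sqrt 3 / 4)) (-1) hk₀ n)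
  have hcoef : ∀ c : Fin 3, BddDerivs (Ioi k₀) n fun (_ : Unit) (k : ℝ) => laxMatrix k i m c := by
    have hinv : BddDerivs (Ioi k₀) n fun (_ : Unit) (k : ℝ) => (k : ℂ)⁻¹ := by
      simpa using (bddDerivs_inv hk₀ n).clm_comp Complex.ofRealCLM
    intro c
    fin_cases c
    · exact BddDerivs.const' (lax0 i m)
    · exact hinv.mul (BddDerivs.const' (lax1 i m))
    · exact hinv.mul (BddDerivs.const' (lax2 i m))
  have hsum : BddDerivs (Ioi k₀) n fun (_ : Unit) (k : ℝ) => ∑ c, laxMatrix k i m c •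
      Tzitzeica.expFamily (fun t => -(t * Complex.I))
        (fun t => (((1 + t ^ 2) * laxData u₀ u₁ c t : ℝ) : ℂ))
        (d * (Real.sqrt 3 / 4) * (k + -1 * k⁻¹)) :=
    BddDerivs.sum _ fun c _ => (hcoef c).bilin (ContinuousLinearMap.lsmul ℝ ℂ) (hE c)
  refine hsum.congr isOpen_Ioi fun _ k hk => ?_
  obtain ⟨C, -, hQ⟩ := isPotential_L1 u₀ u₁ (hk₀.trans hk)
  ext t
  rw [phasedCoeff_apply hQ, hτ, L1_eq_sum]
  simp only [BoundedContinuousFunction.coe_sum, Finset.sum_apply, BoundedContinuousFunction.coe_smul]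
  rw [Finset.mul_sum, Finset.mul_sum]
  refine Finset.sum_congr rfl fun c _ => ?_
  rw [expFamily_apply (by fun_prop) (phaseDecay_laxData u₀ u₁ c) (hre _ (mem_univ _))]
  have : Complex.exp (-(t * (d * (Real.sqrt 3 / 4) * (k + -1 * k⁻¹)) : ℝ) * Complex.I) =
      Complex.exp ((d * (Real.sqrt 3 / 4) * (k + -1 * k⁻¹) : ℝ) * -(t * Complex.I)) := by
    congr 1
    push_cast
    ring
  rw [this]
  simp only [smul_eq_mul]
  push_cast
  ring

theorem bddDerivs_s {k₀ : ℝ} (hk₀ : 0 < k₀) {j : Fin 3} (hj : j = 0 ∨ j = 1) (n : ℕ) :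
    BddDerivs (Ioi k₀) n fun (_ : Unit) (k : ℝ) => s u₀ u₁ k 0 j := by
  obtain ⟨C, hC, hQ⟩ := exists_isPotential u₀ u₁ hk₀
  have hQ' : ∀ k ∈ Ioi k₀, IsPotential (L1 u₀ u₁ k) C := fun k hk => by
    simpa using hQ k (le_of_lt hk) 0 (by simp)
  have hβ : 0 < 6 * C := by positivity
  refine (BddDerivs.systemScattering hβ (BddDerivs.decayKernel hk₀ n)
    (BddDerivs.phasedCoeff u₀ u₁ hk₀ n) (fun _ k hk => ?_) 0 j).congr isOpen_Ioi fun _ k hk => ?_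
  · exact norm_systemOp_le_half (hQ' k hk) (reExp_nonneg (hk₀.trans hk)) _ hβ le_rfl
  · exact s_eq_systemScattering u₀ u₁ (hk₀.trans hk) hj (hQ' k hk) hβ le_rfl

/-! ### Rapid decay of the off-diagonal coefficient -/

/-- The translates `y ↦ (1 + y²) q(y + a)`. -/
def translateFamily (q : ℝ → ℝ) (a : ℝ) : ℝ →ᵇ ℂ :=
  toBCF fun y => (((1 + y ^ 2) * q (y + a) : ℝ) : ℂ)

/-- The range `|a| < 2` leaves room for difference quotients at points with `|a| < 1`. -/
theorem exists_translate_bound {n : ℕ} {q : ℝ → ℝ} (hq : RapidDerivs n q) :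
    ∃ C, 0 ≤ C ∧ ∀ y a : ℝ, |a| < 2 → (1 + y ^ 2) * |q (y + a)| ≤ C := by
  obtain ⟨C, hC0, hC⟩ := exists_weight_bound hq
  refine ⟨9 * C, by positivity, fun y a ha => ?_⟩
  have h3 : 1 + y ^ 2 ≤ 9 * (1 + (y + a) ^ 2) := by
    have := (abs_lt.1 ha).1
    have := (abs_lt.1 ha).2
    nlinarith [sq_nonneg (y + 2 * a)]
  calc _ ≤ 9 * (1 + (y + a) ^ 2) * |q (y + a)| := by gcongr
    _ ≤ _ := by linarith [hC (y + a)]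

theorem translateFamily_apply {n : ℕ} {q : ℝ → ℝ} (hq : RapidDerivs (n + 1) q) {a : ℝ}
    (ha : |a| < 2) (y : ℝ) : translateFamily q a y = (((1 + y ^ 2) * q (y + a) : ℝ) : ℂ) := by
  obtain ⟨C, -, hC⟩ := exists_translate_bound hq
  have := hq.continuous
  refine toBCF_apply (C := C) (by fun_prop) (fun y => ?_) y
  rw [Complex.norm_real, Real.norm_eq_abs, abs_mul, abs_of_nonneg (by positivity)]
  exact hC y a ha

theorem hasDerivAt_translateFamily {q q' q'' : ℝ → ℝ} (h0 : RapidDerivs 1 q)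
    (h1 : ∀ y, HasDerivAt q (q' y) y) (hq' : RapidDerivs 1 q') (h2 : ∀ y, HasDerivAt q' (q'' y) y)
    (h'' : RapidDerivs 0 q'') {a : ℝ} (ha : a ∈ Ioo (-1 : ℝ) 1) :
    HasDerivAt (translateFamily q) (translateFamily q' a) a := by
  obtain ⟨C, hC0, hC⟩ := exists_translate_bound h''
  have ha1 : |a| < 1 := abs_lt.2 ha
  refine hasDerivAt_of_norm_le (C := C) one_pos fun h hh => ?_
  have hah : |a + h| < 2 := (abs_add_le _ _).trans_lt (by linarith)
  refine (BoundedContinuousFunction.norm_le (by positivity)).2 fun y => ?_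
  simp only [BoundedContinuousFunction.coe_sub, BoundedContinuousFunction.coe_smul, Pi.sub_apply]
  rw [translateFamily_apply h0 hah, translateFamily_apply h0 (by linarith),
    translateFamily_apply hq' (by linarith)]
  have hseg : ∀ s ∈ uIcc a (a + h), |s| < 2 := fun s hs => by
    have := Set.abs_sub_left_of_mem_uIcc hs
    rw [add_sub_cancel_left] at this
    calc |s| = |a + (s - a)| := by ring_nf
      _ ≤ |a| + |s - a| := abs_add_le _ _
      _ < 2 := by linarith
  have ht := norm_taylor_le (f := fun s => (1 + y ^ 2) * q (y + s)) (x := a) (h := h) (C := C)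
    (fun s _ => ((h1 (y + s)).comp_const_add y s).const_mul (1 + y ^ 2))
    (fun s _ => ((h2 (y + s)).comp_const_add y s).const_mul (1 + y ^ 2))
    (fun s hs => by
      rw [Real.norm_eq_abs, abs_mul, abs_of_nonneg (by positivity)]
      exact hC y s (hseg s hs))
  rw [Complex.real_smul, ← Complex.ofReal_sub, ← Complex.ofReal_mul, ← Complex.ofReal_sub,
    Complex.norm_real]
  simpa using ht

/-- Differentiability in the supremum norm rests on a second-order Taylor estimate, which costs two
more derivatives of `q` than are obtained for the family. -/
theorem BddDerivs.translateFamily {ι : Type} {n : ℕ} {q : ℝ → ℝ} (hq : RapidDerivs (n + 2) q) :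
    BddDerivs (Ioo (-1 : ℝ) 1) n fun (_ : ι) => translateFamily q := by
  have hb : ∃ C, ∀ _ : ι, ∀ a ∈ Ioo (-1 : ℝ) 1, ‖Tzitzeica.translateFamily q a‖ ≤ C := by
    obtain ⟨C, -, hC⟩ := exists_translate_bound hq
    refine ⟨C, fun _ a ha => norm_toBCF_le fun y => ?_⟩
    rw [Complex.norm_real, Real.norm_eq_abs, abs_mul, abs_of_nonneg (by positivity)]
    exact hC y a ((abs_lt.2 ha).trans one_lt_two)
  induction n generalizing q with
  | zero => exact hb
  | succ n ih =>
    have hq0 := hq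
    obtain ⟨hdec, q', hq', h'⟩ := hq
    have hq1 := h'
    obtain ⟨hdec', q'', hq'', h''⟩ := h'
    refine ⟨hb, fun _ => Tzitzeica.translateFamily q', fun _ a ha => ?_, ih hq1 ?_⟩
    · refine hasDerivAt_translateFamily ⟨hdec, q', hq', hdec'⟩ hq' ⟨hdec', q'', hq'', ?_⟩ hq'' ?_ ha
      · exact h''.decay
      · exact h''.decay
    · obtain ⟨C, -, hC⟩ := exists_translate_bound hq1
      refine ⟨C, fun _ a ha => norm_toBCF_le fun y => ?_⟩
      rw [Complex.norm_real, Real.norm_eq_abs, abs_mul, abs_of_nonneg (by positivity)]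
      exact hC y a ((abs_lt.2 ha).trans one_lt_two)

/-- The oscillating factor of the interaction picture. -/
def oscillation (d : ℝ) : ℝ →ᵇ ℂ := toBCF fun y => Complex.exp (-(y * d : ℝ) * Complex.I)

theorem norm_oscillation_aux (d y : ℝ) : ‖Complex.exp (-(y * d : ℝ) * Complex.I)‖ ≤ 1 := by
  rw [← Complex.ofReal_neg, Complex.norm_exp_ofReal_mul_I]

theorem oscillation_apply (d y : ℝ) :
    oscillation d y = Complex.exp (-(y * d : ℝ) * Complex.I) :=
  toBCF_apply (by fun_prop) (norm_oscillation_aux d) y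

theorem BddDerivs.phasedCoeff_translate {k₀ : ℝ} (hk₀ : 0 < k₀) (n : ℕ) (i m : Fin 3) :
    BddDerivs (Ioo (-1 : ℝ) 1) n fun (k : Ioi k₀) (a : ℝ) =>
      Tzitzeica.phasedCoeff (fun y => L1 u₀ u₁ (k : ℝ) (y + a)) (imExp k) i m := by
  have hosc : BddDerivs (Ioo (-1 : ℝ) 1) n fun (k : Ioi k₀) (_ : ℝ) =>
      oscillation (imExp k i - imExp k m) :=
    BddDerivs.const ⟨1, fun k => norm_toBCF_le (norm_oscillation_aux _)⟩
  have hsum : BddDerivs (Ioo (-1 : ℝ) 1) n fun (k : Ioi k₀) (a : ℝ) =>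
      oscillation (imExp k i - imExp k m) *
        ∑ c, laxMatrix (k : ℝ) i m c • Tzitzeica.translateFamily (laxData u₀ u₁ c) a :=
    hosc.mul <| BddDerivs.sum _ fun c _ => (BddDerivs.const (f := fun k : Ioi k₀ =>
      laxMatrix (k : ℝ) i m c) ⟨1 + k₀⁻¹, fun k => norm_laxMatrix_le hk₀ (le_of_lt k.2) i m c⟩).bilin
        (ContinuousLinearMap.lsmul ℝ ℂ)
        (BddDerivs.translateFamily (rapidDerivs_laxData u₀ u₁ c (n + 2)))
  obtain ⟨C, -, hQ⟩ := exists_isPotential u₀ u₁ hk₀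
  refine hsum.congr isOpen_Ioo fun k a ha => ?_
  have ha1 : |a| < 1 := abs_lt.2 ha
  ext t
  rw [phasedCoeff_apply (hQ k (le_of_lt k.2) a ha1), L1_eq_sum]
  simp only [BoundedContinuousFunction.coe_mul, Pi.mul_apply, BoundedContinuousFunction.coe_sum,
    Finset.sum_apply, BoundedContinuousFunction.coe_smul, oscillation_apply]
  rw [Finset.mul_sum, Finset.mul_sum, Finset.mul_sum]
  refine Finset.sum_congr rfl fun c _ => ?_
  rw [translateFamily_apply (rapidDerivs_laxData u₀ u₁ c 1) (by linarith)]
  simp only [smul_eq_mul]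
  push_cast
  ring

/-- If the functions `a ↦ e^{a c} w` have uniformly bounded derivatives, then each derivative gains
a factor `c` in the bound for `w`. -/
theorem BddDerivs.exp_mul_bound {ι : Type} {n : ℕ} {S : Set ℝ} (hS : IsOpen S) (c : ι → ℂ)
    {w : ι → ℂ} (h : BddDerivs S n fun i (a : ℝ) => Complex.exp (a * c i) * w i) :
    ∃ C, ∀ i, ∀ a ∈ S, ‖c i ^ n * (Complex.exp (a * c i) * w i)‖ ≤ C := by
  induction n generalizing w with
  | zero => simpa using h.bdd
  | succ n ih =>
    have h' := h.deriv hS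
    have hd : ∀ i, _root_.deriv (fun a : ℝ => Complex.exp (a * c i) * w i) =
        fun a : ℝ => Complex.exp (a * c i) * (c i * w i) := fun i => by
      ext a
      have := (((Complex.ofRealCLM.hasDerivAt (x := a)).mul_const (c i)).cexp).mul_const (w i)
      refine HasDerivAt.deriv (this.congr_deriv ?_)
      simp
      ring
    simp only [hd] at h'
    obtain ⟨C, hC⟩ := ih h'
    refine ⟨C, fun i a ha => ?_⟩
    have := hC i a ha
    rwa [show c i ^ (n + 1) * (Complex.exp (a * c i) * w i) =
      c i ^ n * (Complex.exp (a * c i) * (c i * w i)) by ring]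

theorem exponents_zero_one (k : ℝ) :
    exponents (reExp k) (imExp k) 1 0 = Complex.I * ((2 * phase k : ℝ) : ℂ) := by
  simp [exponents, reExp, imExp]
  ring

/-- Translating the potential by `a` multiplies `s₁₂` by `e^{2 i a phase(k)}`, while by smooth
dependence on parameters the derivatives in `a` are bounded uniformly in `k`; hence every power of
the phase times `s₁₂` is bounded. -/
theorem exists_phase_pow_mul_s_le {k₀ : ℝ} (hk₀ : 0 < k₀) (n : ℕ) :
    ∃ C, ∀ k > k₀, ‖(Complex.I * ((2 * phase k : ℝ) : ℂ)) ^ n * s u₀ u₁ k 0 1‖ ≤ C := by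
  obtain ⟨C, hC, hQ⟩ := exists_isPotential u₀ u₁ hk₀
  have hβ : 0 < 6 * C := by positivity
  have hj : (1 : Fin 3) = 0 ∨ (1 : Fin 3) = 1 := Or.inr rfl
  have hbdd : BddDerivs (Ioo (-1 : ℝ) 1) n fun (k : Ioi k₀) (a : ℝ) =>
      Complex.exp (a * (Complex.I * ((2 * phase k : ℝ) : ℂ))) * s u₀ u₁ (k : ℝ) 0 1 := by
    have hκ : ∀ i, BddDerivs (Ioo (-1 : ℝ) 1) n fun (k : Ioi k₀) (_ : ℝ) =>
        Tzitzeica.decayKernel (reExp k i) := fun i => BddDerivs.const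
      ⟨1, fun k => norm_decayKernel_le (reExp_nonneg (hk₀.trans k.2) i)⟩
    refine (BddDerivs.systemScattering hβ hκ (BddDerivs.phasedCoeff_translate u₀ u₁ hk₀ n)
      (fun k a ha => ?_) 0 1).congr isOpen_Ioo fun k a ha => ?_
    · exact norm_systemOp_le_half (hQ k (le_of_lt k.2) a (abs_lt.2 ha))
        (reExp_nonneg (hk₀.trans k.2)) _ hβ le_rfl
    · have hk : 0 < (k : ℝ) := hk₀.trans k.2
      have hQa := hQ k (le_of_lt k.2) a (abs_lt.2 ha)
      obtain ⟨f, hf, -, hs⟩ := exists_isVolterraSolution hQa (reExp_nonneg hk) (imExp k) (j := 1)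
        hβ le_rfl
      have huniq := hf.unique hQa
        (fun i => by rw [exponents_re]; exact reExp_nonneg hk i)
        ((jost_spec u₀ u₁ hk hj).translate a)
      rw [← hs 0 (reExp_eq_zero k (Or.inl rfl)), huniq,
        scattering_translate (L1 u₀ u₁ (k : ℝ)) _ (jost u₀ u₁ (k : ℝ) 1) zero_ne_one a,
        exponents_zero_one, s_eq_scattering u₀ u₁ k hj]
  obtain ⟨D, hD⟩ := hbdd.exp_mul_bound isOpen_Ioo
    (c := fun k : Ioi k₀ => Complex.I * ((2 * phase k : ℝ) : ℂ))
  exact ⟨D, fun k hk => by simpa using hD ⟨k, hk⟩ 0 (by norm_num)⟩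

theorem rapidlyDecays_s : RapidlyDecays fun k => s u₀ u₁ k 0 1 := by
  intro N
  obtain ⟨C, hC⟩ := exists_phase_pow_mul_s_le u₀ u₁ one_pos N
  refine IsBigO.of_bound (4 ^ N * C) ?_
  filter_upwards [eventually_ge_atTop 2] with k hk
  have hk0 : 0 < k := by linarith
  have h := hC k (by linarith)
  have hphase : k / 4 ≤ 2 * phase k := by
    have h1 : k⁻¹ ≤ 1 / 2 := by rw [inv_le_comm₀ hk0 (by norm_num)]; linarith
    have h2 : 1 ≤ Real.sqrt 3 := Real.one_le_sqrt.2 (by norm_num)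
    unfold phase
    nlinarith
  rw [norm_mul, norm_pow, norm_mul, Complex.norm_I, one_mul, Complex.norm_real,
    Real.norm_of_nonneg (by linarith)] at h
  have h1 : (k / 4) ^ N * ‖s u₀ u₁ k 0 1‖ ≤ C := le_trans (by gcongr) h
  rw [Real.norm_of_nonneg (by positivity)]
  rw [div_pow] at h1
  field_simp at h1 ⊢
  linarith

end

noncomputable section

/-! ### Nonvanishing of the diagonal coefficient -/

/-- A system `a i' = d i a i - ∑ b i l a l` with `b ≥ 0` preserves positivity when followed from
`+∞` to the left. -/
theorem pos_of_cooperative {a d : Fin 3 → ℝ → ℝ} {b : Fin 3 → Fin 3 → ℝ → ℝ} {D : ℝ}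
    (ha : ∀ i x, HasDerivAt (a i) (d i x * a i x - ∑ l, b i l x * a l x) x)
    (hb : ∀ i l x, 0 ≤ b i l x) (hd : ∀ i x, d i x ≤ D)
    (hlim : ∀ i, ∀ᶠ x in atTop, 0 < a i x) (i : Fin 3) (x : ℝ) : 0 < a i x := by
  by_contra hneg
  set S : Set ℝ := {y | ∃ i, a i y ≤ 0} with hS
  have hcont : ∀ i, Continuous (a i) := fun i =>
    continuous_iff_continuousAt.2 fun y => (ha i y).continuousAt
  have hclosed : IsClosed S := by
    have : S = ⋃ i, {y | a i y ≤ 0} := by ext y; simp [hS]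
    rw [this]
    exact isClosed_iUnion_of_finite fun i => isClosed_le (hcont i) continuous_const
  have hne : S.Nonempty := ⟨x, i, not_lt.1 hneg⟩
  have hbdd : BddAbove S := by
    obtain ⟨X, hX⟩ := eventually_atTop.1 (eventually_all.2 hlim)
    refine ⟨X, fun y ⟨i, hi⟩ => ?_⟩
    by_contra hy
    push Not at hy
    exact absurd (hX y hy.le i) (not_lt.2 hi)
  -- at the last point `y₀` where some component fails to be positive, that component times
  -- `e^{-D y}` is antitone to the right of `y₀`, although it is positive there
  set y₀ := sSup S with hy₀
  obtain ⟨i₀, hi₀⟩ : y₀ ∈ S := hclosed.csSup_mem hne hbdd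
  have hpos : ∀ y > y₀, ∀ i, 0 < a i y := fun y hy i => by
    by_contra h
    exact absurd (le_csSup hbdd ⟨i, not_lt.1 h⟩) (not_le.2 hy)
  have hanti : AntitoneOn (fun y => a i₀ y * Real.exp (-D * y)) (Ici y₀) := by
    have hder : ∀ y, HasDerivAt (fun y => a i₀ y * Real.exp (-D * y))
        ((d i₀ y * a i₀ y - ∑ l, b i₀ l y * a l y) * Real.exp (-D * y) +
          a i₀ y * (Real.exp (-D * y) * -D)) y := fun y => by
      have h := ((hasDerivAt_id y).const_mul (-D)).exp
      exact (ha i₀ y).mul (h.congr_deriv (by simp))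
    refine antitoneOn_of_deriv_nonpos (convex_Ici _)
      (fun y _ => (hder y).continuousAt.continuousWithinAt)
      (fun y _ => (hder y).differentiableAt.differentiableWithinAt) fun y hy => ?_
    rw [interior_Ici] at hy
    rw [(hder y).deriv]
    have h1 : 0 ≤ ∑ l, b i₀ l y * a l y :=
      Finset.sum_nonneg fun l _ => mul_nonneg (hb _ _ _) (hpos y hy l).le
    have h2 := hd i₀ y
    have h3 := hpos y hy i₀
    have h4 := Real.exp_pos (-D * y)
    have h5 : d i₀ y * a i₀ y - ∑ l, b i₀ l y * a l y - D * a i₀ y ≤ 0 := by nlinarith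
    nlinarith
  have h1 := hanti (mem_Ici.2 le_rfl) (mem_Ici.2 (by linarith : y₀ ≤ y₀ + 1)) (by linarith)
  have h2 := mul_pos (hpos (y₀ + 1) (by linarith) i₀) (Real.exp_pos (-D * (y₀ + 1)))
  have h3 := mul_nonpos_of_nonpos_of_nonneg hi₀ (Real.exp_pos (-D * y₀)).le
  simp only at h1
  linarith

variable (u₀ u₁ : SchwartzMap ℝ ℝ)

theorem hasDerivAt_jost {k : ℝ} (hk : 0 < k) {j : Fin 3} (hj : j = 0 ∨ j = 1) (i : Fin 3) (x : ℝ) :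
    HasDerivAt (fun x => jost u₀ u₁ k j x i)
      ((L u₀ u₁ k x *ᵥ jost u₀ u₁ k j x) i - l k j * jost u₀ u₁ k j x i) x := by
  obtain ⟨C, -, hQ⟩ := isPotential_L1 u₀ u₁ hk
  have h := (jost_spec u₀ u₁ hk hj).hasDerivAt hQ (exponents_self (reExp_eq_zero k hj) _) i x
  refine h.congr_deriv ?_
  rw [← l_sub_l k hj, L1, Matrix.sub_mulVec, Pi.sub_apply, Matrix.mulVec_diagonal]
  ring

/-- The rows of `L`, with `i √3` written as `2 ω + 1`, acting on a vector. -/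
theorem L_mulVec (z : ℂ) (x : ℝ) (v : Fin 3 → ℂ) :
    let p : ℂ := (deriv u₀ x + u₁ x : ℝ)
    let E : ℂ := (Real.exp (u₀ x) : ℝ)
    let F : ℂ := (Real.exp (-2 * u₀ x) : ℝ)
    (L u₀ u₁ z x *ᵥ v) 0 = (z / 2 * omega + z⁻¹ / 6 * omega ^ 2 * (2 * E + F)) * v 0 +
        ((2 * omega + 1) * p / 6 + z⁻¹ / 6 * (F - E)) * v 1 +
        (-(2 * omega + 1) * p / 6 + z⁻¹ / 6 * omega * (F - E)) * v 2 ∧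
      (L u₀ u₁ z x *ᵥ v) 1 = (-(2 * omega + 1) * p / 6 + z⁻¹ / 6 * (F - E)) * v 0 +
        (z / 2 * omega ^ 2 + z⁻¹ / 6 * omega * (2 * E + F)) * v 1 +
        ((2 * omega + 1) * p / 6 + z⁻¹ / 6 * omega ^ 2 * (F - E)) * v 2 ∧
      (L u₀ u₁ z x *ᵥ v) 2 = ((2 * omega + 1) * p / 6 + z⁻¹ / 6 * omega * (F - E)) * v 0 +
        (-(2 * omega + 1) * p / 6 + z⁻¹ / 6 * omega ^ 2 * (F - E)) * v 1 +
        (z / 2 + z⁻¹ / 6 * (2 * E + F)) * v 2 := by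
  intro p E F
  have hrow : ∀ i, (L u₀ u₁ z x *ᵥ v) i = ∑ m, L u₀ u₁ z x i m * v m := fun i => rfl
  rw [hrow 0, hrow 1, hrow 2]
  simp only [Fin.sum_univ_three, L, J, U0, U1, I_mul_sqrt_three]
  refine ⟨?_, ?_, ?_⟩ <;> simp [p, E, F] <;> ring

/-- The Fourier components `∑ ω^{mj} Y_j` of `Y = f × B f̄`, where `B` interchanges the first two
coordinates. Here `f` is the first Jost column, `B f̄` is the second one, and so `Y` solves the
adjoint equation; in Fourier components its matrix is real with off-diagonal entries of one sign. -/
def amplitude (f : Fin 3 → ℂ) (m : Fin 3) : ℝ :=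
  Complex.normSq (f 0) - Complex.normSq (f 1) + 2 * (omega ^ (m : ℕ) *
    (f 1 * (starRingEnd ℂ) (f 2) - f 2 * (starRingEnd ℂ) (f 0))).re

theorem ofReal_amplitude (f : Fin 3 → ℂ) (m : Fin 3) :
    (amplitude f m : ℂ) = f 0 * (starRingEnd ℂ) (f 0) - f 1 * (starRingEnd ℂ) (f 1) +
      (omega ^ (m : ℕ) * (f 1 * (starRingEnd ℂ) (f 2) - f 2 * (starRingEnd ℂ) (f 0)) +
      (omega ^ 2) ^ (m : ℕ) *
        ((starRingEnd ℂ) (f 1) * f 2 - (starRingEnd ℂ) (f 2) * f 0)) := by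
  rw [amplitude]
  push_cast
  rw [Complex.mul_conj, Complex.mul_conj]
  have h := Complex.add_conj (omega ^ (m : ℕ) *
    (f 1 * (starRingEnd ℂ) (f 2) - f 2 * (starRingEnd ℂ) (f 0)))
  rw [Complex.ofReal_mul] at h
  push_cast at h
  rw [← h]
  simp only [map_mul, map_sub, map_pow, Complex.conj_conj, conj_omega]

/-- The average of the amplitudes is the principal `2 × 2` minor `|f₀|² - |f₁|²`. -/
theorem sum_amplitude (f : Fin 3 → ℂ) :
    (amplitude f 0 + amplitude f 1 + amplitude f 2) / 3 =
      Complex.normSq (f 0) - Complex.normSq (f 1) := by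
  have h : ((amplitude f 0 + amplitude f 1 + amplitude f 2 : ℝ) : ℂ) =
      (3 * (Complex.normSq (f 0) - Complex.normSq (f 1)) : ℝ) := by
    push_cast
    rw [ofReal_amplitude, ofReal_amplitude, ofReal_amplitude, Complex.normSq_eq_conj_mul_self,
      Complex.normSq_eq_conj_mul_self]
    have hw := omega_quadratic
    simp only [Fin.val_zero, Fin.val_one, Fin.val_two]
    grind
  have h' := Complex.ofReal_injective h
  rw [h']
  ring

/-- The diagonal of the cooperative system for the amplitudes. -/
def coopDiag (u₀ u₁ : SchwartzMap ℝ ℝ) (k : ℝ) (m : Fin 3) (x : ℝ) : ℝ :=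
  (k + k⁻¹) / 2 + ![0, (deriv u₀ x + u₁ x) / 2, -((deriv u₀ x + u₁ x) / 2)] m

/-- The off-diagonal part of the cooperative system for the amplitudes. -/
def coopOff (u₀ : SchwartzMap ℝ ℝ) (k : ℝ) (i m : Fin 3) (x : ℝ) : ℝ :=
  !![0, k / 2, k⁻¹ / 2 * Real.exp (u₀ x);
     k⁻¹ / 2 * Real.exp (u₀ x), 0, k / 2;
     k / 2, k⁻¹ / 2 * Real.exp (-2 * u₀ x), 0] i m

theorem hasDerivAt_amplitude {k : ℝ} (hk : 0 < k) (m : Fin 3) (x : ℝ) :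
    HasDerivAt (fun x => amplitude (jost u₀ u₁ k 0 x) m)
      (coopDiag u₀ u₁ k m x * amplitude (jost u₀ u₁ k 0 x) m -
        ∑ i, coopOff u₀ k m i x * amplitude (jost u₀ u₁ k 0 x) i) x := by
  set f := jost u₀ u₁ k 0 with hf
  have hd : ∀ i, HasDerivAt (fun x => f x i) ((L u₀ u₁ k x *ᵥ f x) i - l k 0 * f x i) x := fun i =>
    hasDerivAt_jost u₀ u₁ hk (Or.inl rfl) i x
  have hg : ∀ i, HasDerivAt (fun x => (starRingEnd ℂ) (f x i))
      ((starRingEnd ℂ) ((L u₀ u₁ k x *ᵥ f x) i - l k 0 * f x i)) x := fun i =>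
    (Complex.conjCLE.toContinuousLinearMap.hasFDerivAt).comp_hasDerivAt x (hd i)
  have hc := (((hd 0).mul (hg 0)).sub ((hd 1).mul (hg 1))).add
    (((((hd 1).mul (hg 2)).sub ((hd 2).mul (hg 0))).const_mul (omega ^ (m : ℕ))).add
      ((((hg 1).mul (hd 2)).sub ((hg 2).mul (hd 0))).const_mul ((omega ^ 2) ^ (m : ℕ))))
  have hre := (Complex.reCLM.hasFDerivAt).comp_hasDerivAt x hc
  refine (hre.congr_of_eventuallyEq (Eventually.of_forall fun y => ?_)).congr_deriv ?_
  · rw [← Complex.ofReal_re (amplitude (f y) m), ofReal_amplitude]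
    rfl
  rw [← Complex.ofReal_re (coopDiag u₀ u₁ k m x * amplitude (f x) m -
    ∑ i, coopOff u₀ k m i x * amplitude (f x) i), Complex.reCLM_apply]
  congr 1
  obtain ⟨h0, h1, h2⟩ := L_mulVec u₀ u₁ k x (f x)
  have hw := omega_quadratic
  simp only [Fin.sum_univ_three, Complex.ofReal_sub, Complex.ofReal_mul, Complex.ofReal_add,
    ofReal_amplitude]
  rw [h0, h1, h2, l_zero]
  clear hre hc hd hg h0 h1 h2 hf
  simp only [map_mul, map_sub, map_add, map_neg, map_div₀, map_pow, map_inv₀, map_one, map_ofNat,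
    conj_omega, Complex.conj_ofReal]
  generalize f x 0 = a
  generalize f x 1 = b
  generalize f x 2 = c
  generalize (starRingEnd ℂ) a = a'
  generalize (starRingEnd ℂ) b = b'
  generalize (starRingEnd ℂ) c = c'
  fin_cases m <;>
    simp [coopDiag, coopOff] <;>
    generalize (k : ℂ)⁻¹ = K <;>
    generalize omega = w at * <;>
    generalize Complex.exp (u₀ x) = E <;>
    generalize Complex.exp (-(2 * u₀ x)) = F <;>
    generalize ((deriv u₀ x : ℝ) : ℂ) + (u₁ x : ℝ) = p <;>
    clear * - hw <;>
    grind

theorem amplitude_pos {k : ℝ} (hk : 0 < k) (m : Fin 3) (x : ℝ) :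
    0 < amplitude (jost u₀ u₁ k 0 x) m := by
  have hj : (0 : Fin 3) = 0 ∨ (0 : Fin 3) = 1 := Or.inl rfl
  have hK : 0 < k⁻¹ := inv_pos.2 hk
  obtain ⟨P, hP⟩ := (rapidDerivs_laxData u₀ u₁ 0 0).decay 0
  refine pos_of_cooperative (a := fun m x => amplitude (jost u₀ u₁ k 0 x) m)
    (D := (k + k⁻¹) / 2 + P / 2) (hasDerivAt_amplitude u₀ u₁ hk) (fun i l x => ?_) (fun i x => ?_)
    (fun i => ?_) m x
  · fin_cases i <;> fin_cases l <;> simp [coopOff] <;> positivity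
  · have h := hP x
    rw [pow_zero, one_mul] at h
    have h1 := abs_le.1 h
    simp only [laxData, Matrix.cons_val_zero] at h1
    have h2 := h1.1
    have h3 := h1.2
    fin_cases i <;> simp [coopDiag] <;> linarith
  · obtain ⟨C, -, hQ⟩ := isPotential_L1 u₀ u₁ hk
    have ht := (jost_spec u₀ u₁ hk hj).tendsto_atTop
      (fun i => by rw [exponents_re]; exact reExp_nonneg hk i) hQ
    have h0 := ht 0
    have h1 := ht 1
    have h2 := ht 2
    simp only [if_true, one_ne_zero, if_false, (by decide : (2 : Fin 3) ≠ 0)] at h0 h1 h2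
    have hlim : Tendsto (fun x => amplitude (jost u₀ u₁ k 0 x) i) atTop (𝓝 1) := by
      have hcont : Continuous fun v : ℂ × ℂ × ℂ => Complex.normSq v.1 - Complex.normSq v.2.1 +
          2 * (omega ^ (i : ℕ) * (v.2.1 * (starRingEnd ℂ) v.2.2 -
            v.2.2 * (starRingEnd ℂ) v.1)).re := by
        have := Complex.continuous_normSq
        fun_prop
      have := (hcont.tendsto (1, 0, 0)).comp (h0.prodMk_nhds (h1.prodMk_nhds h2))
      simpa [amplitude, Function.comp_def] using this
    exact hlim.eventually (lt_mem_nhds one_pos)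

/-- The minor `|f₀|² - |f₁|²` satisfies a differential inequality with integrable coefficient, hence
stays away from zero, uniformly for `k ≥ k₀`. -/
theorem exists_minor_lower_bound {k₀ : ℝ} (hk₀ : 0 < k₀) : ∃ c > 0, ∀ k : ℝ, k₀ ≤ k → ∀ x,
    c ≤ Complex.normSq (jost u₀ u₁ k 0 x 0) - Complex.normSq (jost u₀ u₁ k 0 x 1) := by
  have h1 := fun c => exists_weight_bound (rapidDerivs_laxData u₀ u₁ c 0)
  choose D hD0 hD using h1
  have hK₀ : 0 < k₀⁻¹ := inv_pos.2 hk₀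
  set c : ℝ := D 0 + k₀⁻¹ * (D 1 + D 2) with hc
  refine ⟨Real.exp (-(c * Real.pi)), Real.exp_pos _, fun k hk x => ?_⟩
  have hk0 : 0 < k := hk₀.trans_le hk
  have hK : 0 < k⁻¹ := inv_pos.2 hk0
  have hKK : k⁻¹ ≤ k₀⁻¹ := inv_anti₀ hk₀ hk
  set f := jost u₀ u₁ k 0 with hf
  set A : ℝ → ℝ := fun x => Complex.normSq (f x 0) - Complex.normSq (f x 1) with hA
  have hAeq : A = fun x => (amplitude (f x) 0 + amplitude (f x) 1 + amplitude (f x) 2) / 3 :=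
    funext fun x => (sum_amplitude _).symm
  have hderiv : ∀ x, HasDerivAt A (((deriv u₀ x + u₁ x) / 2 * (amplitude (f x) 1 -
      amplitude (f x) 2) - k⁻¹ / 2 * ((Real.exp (u₀ x) - 1) * (amplitude (f x) 0 +
      amplitude (f x) 2) + (Real.exp (-2 * u₀ x) - 1) * amplitude (f x) 1)) / 3) x := fun x => by
    rw [hAeq]
    have h := (((hasDerivAt_amplitude u₀ u₁ hk0 0 x).add (hasDerivAt_amplitude u₀ u₁ hk0 1 x)).add
      (hasDerivAt_amplitude u₀ u₁ hk0 2 x)).div_const 3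
    refine h.congr_deriv ?_
    simp only [Fin.sum_univ_three, coopDiag, coopOff]
    simp
    ring
  have hw : ∀ c x, |laxData u₀ u₁ c x| ≤ D c * weight x := fun c x => by
    have h2 := hD c x
    have h3 := weight_pos x
    calc |laxData u₀ u₁ c x| = (1 + x ^ 2) * |laxData u₀ u₁ c x| * weight x := by
          linear_combination (-|laxData u₀ u₁ c x|) * weight_mul x
      _ ≤ _ := by gcongr
  have hanti : Antitone fun x => A x * Real.exp (-(c * Real.arctan x)) := by
    have hd : ∀ x, HasDerivAt (fun x => A x * Real.exp (-(c * Real.arctan x))) _ x := fun x =>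
      (hderiv x).mul (((Real.hasDerivAt_arctan x).const_mul c).neg.exp)
    refine antitone_of_deriv_nonpos (fun x => (hd x).differentiableAt) fun x => ?_
    rw [(hd x).deriv]
    have hp0 := amplitude_pos u₀ u₁ hk0 0 x
    have hp1 := amplitude_pos u₀ u₁ hk0 1 x
    have hp2 := amplitude_pos u₀ u₁ hk0 2 x
    have hAx : 3 * A x = amplitude (f x) 0 + amplitude (f x) 1 + amplitude (f x) 2 := by
      rw [hAeq]; ring
    have hA0 : 0 < A x := by rw [← hf] at hp0 hp1 hp2; linarith
    have hbound : ∀ q b M : ℝ, |q| ≤ M → |b| ≤ 3 * A x → q * b ≤ M * (3 * A x) := by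
      intro q b M hq hb
      calc q * b ≤ |q * b| := le_abs_self _
        _ = |q| * |b| := abs_mul _ _
        _ ≤ M * (3 * A x) := mul_le_mul hq hb (abs_nonneg _) ((abs_nonneg _).trans hq)
    rw [← hf] at hp0 hp1 hp2
    have e0 := hbound (deriv u₀ x + u₁ x) (amplitude (f x) 1 - amplitude (f x) 2) _ (hw 0 x)
      (abs_le.2 ⟨by linarith, by linarith⟩)
    have e1 := hbound (Real.exp (u₀ x) - 1) (-(amplitude (f x) 0 + amplitude (f x) 2)) _ (hw 1 x)
      (abs_le.2 ⟨by linarith, by linarith⟩)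
    have e2 := hbound (Real.exp (-2 * u₀ x) - 1) (-(amplitude (f x) 1)) _ (hw 2 x)
      (abs_le.2 ⟨by linarith, by linarith⟩)
    have hwx := weight_pos x
    have hD1 := hD0 1
    have hD2 := hD0 2
    have e12 : k⁻¹ * ((Real.exp (u₀ x) - 1) * -(amplitude (f x) 0 + amplitude (f x) 2) +
        (Real.exp (-2 * u₀ x) - 1) * -(amplitude (f x) 1)) ≤
        k₀⁻¹ * ((D 1 + D 2) * weight x * (3 * A x)) := by
      calc _ ≤ k⁻¹ * ((D 1 + D 2) * weight x * (3 * A x)) := by gcongr; linarith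
        _ ≤ _ := by gcongr
    have e3 : 0 ≤ c * weight x * A x := by
      have := hD0 0
      positivity
    have hmain : ((deriv u₀ x + u₁ x) / 2 * (amplitude (f x) 1 - amplitude (f x) 2) -
        k⁻¹ / 2 * ((Real.exp (u₀ x) - 1) * (amplitude (f x) 0 + amplitude (f x) 2) +
        (Real.exp (-2 * u₀ x) - 1) * amplitude (f x) 1)) / 3 ≤ c * weight x * A x := by
      rw [hc] at e3 ⊢
      linarith
    have hexp := Real.exp_pos (-(c * Real.arctan x))
    have hweq : c * (1 / (1 + x ^ 2)) = c * weight x := by rw [weight, one_div]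
    rw [hweq]
    have := mul_le_mul_of_nonneg_right hmain hexp.le
    change _ * _ + A x * (Real.exp (-(c * Real.arctan x)) * -(c * weight x)) ≤ 0
    linarith
  have hlim : Tendsto (fun x => A x * Real.exp (-(c * Real.arctan x))) atTop
      (𝓝 (1 * Real.exp (-(c * (Real.pi / 2))))) := by
    obtain ⟨C, -, hQ⟩ := isPotential_L1 u₀ u₁ hk0
    have ht := (jost_spec u₀ u₁ hk0 (j := 0) (Or.inl rfl)).tendsto_atTop
      (fun i => by rw [exponents_re]; exact reExp_nonneg hk0 i) hQ
    have h0 := (Complex.continuous_normSq.tendsto _).comp (ht 0)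
    have h1 := (Complex.continuous_normSq.tendsto _).comp (ht 1)
    have hA1 : Tendsto A atTop (𝓝 1) := by
      have := h0.sub h1
      simpa using this
    have harc : Tendsto Real.arctan atTop (𝓝 (Real.pi / 2)) :=
      tendsto_nhds_of_tendsto_nhdsWithin Real.tendsto_arctan_atTop
    exact hA1.mul ((Real.continuous_exp.tendsto _).comp (harc.const_mul c).neg)
  have hge : 1 * Real.exp (-(c * (Real.pi / 2))) ≤ A x * Real.exp (-(c * Real.arctan x)) :=
    hanti.le_of_tendsto hlim x
  have hc0 : 0 ≤ c := by
    have := hD0 0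
    have := hD0 1
    have := hD0 2
    positivity
  have harc := Real.neg_pi_div_two_lt_arctan x
  have hAx : Real.exp (-(c * (Real.pi / 2))) * Real.exp (c * Real.arctan x) ≤ A x := by
    have h := mul_le_mul_of_nonneg_right hge (Real.exp_pos (c * Real.arctan x)).le
    rw [one_mul, mul_assoc (A x), ← Real.exp_add (-(c * Real.arctan x)), neg_add_cancel,
      Real.exp_zero, mul_one] at h
    exact h
  refine le_trans ?_ hAx
  rw [← Real.exp_add]
  refine Real.exp_le_exp.2 ?_
  nlinarith

/-- The diagonal coefficient `s₁₁` is bounded away from zero on `[k₀, ∞)`. -/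
theorem exists_le_norm_s {k₀ : ℝ} (hk₀ : 0 < k₀) :
    ∃ c > 0, ∀ k : ℝ, k₀ ≤ k → c ≤ ‖s u₀ u₁ k 0 0‖ := by
  obtain ⟨c, hc, h⟩ := exists_minor_lower_bound u₀ u₁ hk₀
  refine ⟨Real.sqrt c, Real.sqrt_pos.2 hc, fun k hk => ?_⟩
  have hk0 : 0 < k := hk₀.trans_le hk
  have hj : (0 : Fin 3) = 0 ∨ (0 : Fin 3) = 1 := Or.inl rfl
  have hself := exponents_self (reExp_eq_zero k hj) (imExp k)
  have hint := integrable_sIntegrand u₀ u₁ hk0 hj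
  rw [funext (sIntegrand_eq u₀ u₁ k hj 0)] at hint
  have hlim := (jost_spec u₀ u₁ hk0 hj).tendsto_scattering hself hint
  rw [← s_eq_scattering u₀ u₁ k hj] at hlim
  refine ge_of_tendsto hlim.norm (Eventually.of_forall fun x => ?_)
  have h1 := h k hk x
  have h2 := Complex.normSq_nonneg (jost u₀ u₁ k 0 x 1)
  rw [hself, mul_zero, Complex.exp_zero, one_mul]
  refine Real.sqrt_le_iff.2 ⟨norm_nonneg _, ?_⟩
  rw [← Complex.normSq_eq_norm_sq]
  linarith

end

noncomputable section

variable (u₀ u₁ : SchwartzMap ℝ ℝ)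

/-! ### The symmetry between the two Jost functions -/

theorem l_neg (z : ℂ) (i : Fin 3) : l (-z) i = -l z i := by
  simp only [l, mul_neg, inv_neg]
  ring

/-- `U₀` is antisymmetric and `U₁` symmetric, so that `-L₁(z)ᵀ = L₁(-z)`. -/
theorem L1_neg (z : ℂ) (x : ℝ) : L1 u₀ u₁ (-z) x = -(L1 u₀ u₁ z x)ᵀ := by
  have h0 : ∀ i m, lax0 i m = -lax0 m i := fun i m => by
    fin_cases i <;> fin_cases m <;> simp [lax0, U0]
  have h1 : ∀ i m, lax1 i m = lax1 m i := fun i m => by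
    fin_cases i <;> fin_cases m <;> simp [lax1]
  have h2 : ∀ i m, lax2 i m = lax2 m i := fun i m => by
    fin_cases i <;> fin_cases m <;> simp [lax2]
  ext i m
  rw [Matrix.neg_apply, Matrix.transpose_apply, L1_apply, L1_apply, h0 i m, h1 i m, h2 i m, inv_neg]
  ring

theorem isCofactorJostColumn_iff (z : ℂ) (j : Fin 3) (f : ℝ → Fin 3 → ℂ) :
    IsCofactorJostColumn u₀ u₁ z j f ↔ IsJostColumn u₀ u₁ (-z) j f := by
  have h : ∀ (x : ℝ) (i : Fin 3), (fun y : ℝ => Complex.exp ((x - y) * (l (-z) i - l (-z) j)) *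
      (L1 u₀ u₁ (-z) y *ᵥ f y) i) = fun y : ℝ => -(Complex.exp (-(x - y) * (l z i - l z j)) *
        ((L1 u₀ u₁ z y)ᵀ *ᵥ f y) i) := fun x i => by
    ext y
    rw [L1_neg, l_neg, l_neg, Matrix.neg_mulVec, Pi.neg_apply, mul_neg]
    ring_nf
  constructor
  · intro hf
    refine ⟨hf.continuous, hf.bounded, fun x i => ?_, fun x i => ?_⟩
    · rw [h]
      exact (hf.integrable x i).neg
    · rw [h, integral_neg, sub_neg_eq_add]
      exact hf.volterra x i
  · intro hf
    refine ⟨hf.continuous, hf.bounded, fun x i => ?_, fun x i => ?_⟩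
    · have := hf.integrable x i
      rw [h] at this
      simpa using this.neg
    · have := hf.volterra x i
      rwa [h, integral_neg, sub_neg_eq_add] at this

theorem cofactorJost_eq (z : ℂ) (j : Fin 3) : cofactorJost u₀ u₁ z j = jost u₀ u₁ (-z) j := by
  have h : IsCofactorJostColumn u₀ u₁ z j = IsJostColumn u₀ u₁ (-z) j :=
    funext fun f => propext (isCofactorJostColumn_iff u₀ u₁ z j f)
  unfold cofactorJost jost
  generalize IsCofactorJostColumn u₀ u₁ z j = P at h
  subst h
  rfl

theorem sAIntegrand_eq (z : ℂ) (i j : Fin 3) :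
    sAIntegrand u₀ u₁ z i j = fun y => -sIntegrand u₀ u₁ (-z) i j y := by
  ext y
  rw [sAIntegrand, sIntegrand, cofactorJost_eq, L1_neg, l_neg, l_neg, Matrix.neg_mulVec,
    Pi.neg_apply, mul_neg, neg_neg]
  ring_nf

theorem sA_eq (z : ℂ) (i j : Fin 3) : sA u₀ u₁ z i j = s u₀ u₁ (-z) i j := by
  rw [sA, s, sAIntegrand_eq, integral_neg, sub_eq_add_neg]

theorem r₂_eq (k : ℝ) : r₂ u₀ u₁ k = r₁ u₀ u₁ (-k) := by
  rw [r₂, r₁, sA_eq, sA_eq, Complex.ofReal_neg]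

/-! ### The inversion of the spectral parameter -/

/-- The coefficient `(1 + e^{-u₀} ω^d + e^{u₀} ω^{2d}) / 3` of the circulant gauge matrix that
relates the Lax operator at `k` to the conjugate of the one at `1 / k`, with `u₁` replaced by
`-u₁`. -/
def inversionCoeff (u₀ : SchwartzMap ℝ ℝ) (d : ℕ) (x : ℝ) : ℂ :=
  (1 + (Real.exp (-u₀ x) : ℝ) * omega ^ d + (Real.exp (u₀ x) : ℝ) * (omega ^ 2) ^ d) / 3

/-- The circulant gauge matrix, applied to a vector. -/
def inversionGauge (u₀ : SchwartzMap ℝ ℝ) (x : ℝ) (v : Fin 3 → ℂ) : Fin 3 → ℂ :=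
  ![inversionCoeff u₀ 0 x * v 0 + inversionCoeff u₀ 2 x * v 1 + inversionCoeff u₀ 1 x * v 2,
    inversionCoeff u₀ 1 x * v 0 + inversionCoeff u₀ 0 x * v 1 + inversionCoeff u₀ 2 x * v 2,
    inversionCoeff u₀ 2 x * v 0 + inversionCoeff u₀ 1 x * v 1 + inversionCoeff u₀ 0 x * v 2]

theorem hasDerivAt_inversionCoeff (d : ℕ) (x : ℝ) :
    HasDerivAt (inversionCoeff u₀ d) ((-(deriv u₀ x : ℝ) * (Real.exp (-u₀ x) : ℝ) * omega ^ d +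
      (deriv u₀ x : ℝ) * (Real.exp (u₀ x) : ℝ) * (omega ^ 2) ^ d) / 3) x := by
  have h := (u₀.differentiableAt (x := x)).hasDerivAt
  have h1 := (((h.neg.exp.ofReal_comp).mul_const (omega ^ d)).const_add 1).add
    ((h.exp.ofReal_comp).mul_const ((omega ^ 2) ^ d))
  refine (h1.div_const 3).congr_deriv ?_
  simp only [Pi.neg_apply]
  push_cast
  ring

theorem tendsto_inversionCoeff {F : Filter ℝ} (hF : F ≤ cocompact ℝ) (d : ℕ) :
    Tendsto (inversionCoeff u₀ d) F (𝓝 ((1 + omega ^ d + (omega ^ 2) ^ d) / 3)) := by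
  have h : Tendsto u₀ F (𝓝 0) := u₀.tendsto_cocompact.mono_left hF
  have hc : Continuous fun v : ℝ => (1 + (Real.exp (-v) : ℝ) * omega ^ d +
      (Real.exp v : ℝ) * (omega ^ 2) ^ d) / 3 := by fun_prop
  have := (hc.tendsto 0).comp h
  rw [neg_zero, Real.exp_zero, Complex.ofReal_one, one_mul, one_mul] at this
  exact this

theorem inversionCoeff_limit (d : Fin 3) :
    (1 + omega ^ (d : ℕ) + (omega ^ 2) ^ (d : ℕ)) / 3 = if d = 0 then 1 else 0 := by
  have hw := omega_quadratic
  fin_cases d <;> simp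
  · norm_num
  · linear_combination hw
  · linear_combination (omega ^ 2 - omega + 1) * hw

theorem conj_l_inv (k : ℝ) {j : Fin 3} : (starRingEnd ℂ) (l ((k⁻¹ : ℝ) : ℂ) j) = l k j := by
  have h4 : (omega ^ 2) ^ 2 = omega := by linear_combination omega * omega_cube
  fin_cases j <;>
    simp [l_zero, l_one, l_two, conj_omega, h4, Complex.conj_ofNat] <;> ring

theorem conj_exponents (k : ℝ) {j : Fin 3} (hj : j = 0 ∨ j = 1) (i : Fin 3) :
    (starRingEnd ℂ) (exponents (reExp k⁻¹) (imExp k⁻¹) j i) = exponents (reExp k) (imExp k) j i := by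
  rw [← l_sub_l _ hj, ← l_sub_l _ hj, map_sub, conj_l_inv, conj_l_inv]

/-- The Jost columns at `k` are the gauge transforms of the conjugated Jost columns at `1 / k` for
the data `(u₀, -u₁)`. -/
theorem jost_inversion {k : ℝ} (hk : 0 < k) {j : Fin 3} (hj : j = 0 ∨ j = 1) :
    jost u₀ u₁ k j = fun x => inversionGauge u₀ x fun i =>
      (starRingEnd ℂ) (jost u₀ (-u₁) ((k⁻¹ : ℝ) : ℂ) j x i) := by
  have hk' : 0 < k⁻¹ := inv_pos.2 hk
  obtain ⟨C, -, hQ⟩ := isPotential_L1 u₀ u₁ hk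
  obtain ⟨C', -, hQ'⟩ := isPotential_L1 u₀ (-u₁) hk'
  set f := jost u₀ (-u₁) ((k⁻¹ : ℝ) : ℂ) j with hf
  set h : ℝ → Fin 3 → ℂ := fun x => inversionGauge u₀ x fun i => (starRingEnd ℂ) (f x i) with hh
  refine jost_unique u₀ u₁ hk hj (IsVolterraSolution.of_hasDerivAt hQ
    (fun i => by rw [exponents_re]; exact reExp_nonneg hk i)
    (exponents_self (reExp_eq_zero k hj) _) (fun i x => ?_) fun i => ?_)
  · have hg : ∀ i, HasDerivAt (fun x => (starRingEnd ℂ) (f x i))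
        ((starRingEnd ℂ) ((L u₀ (-u₁) ((k⁻¹ : ℝ) : ℂ) x *ᵥ f x) i) -
          l k j * (starRingEnd ℂ) (f x i)) x := fun i => by
      have := (Complex.conjCLE.toContinuousLinearMap.hasFDerivAt).comp_hasDerivAt x
        (hasDerivAt_jost u₀ (-u₁) hk' hj i x)
      refine this.congr_deriv ?_
      simp [← conj_l_inv k, hf]
    have hc := fun d => hasDerivAt_inversionCoeff u₀ d x
    have htarget : exponents (reExp k) (imExp k) j i * h x i + (L1 u₀ u₁ k x *ᵥ h x) i =
        (L u₀ u₁ k x *ᵥ h x) i - l k j * h x i := by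
      rw [← l_sub_l k hj, L1, Matrix.sub_mulVec, Pi.sub_apply, Matrix.mulVec_diagonal]
      ring
    rw [htarget]
    obtain ⟨a0, a1, a2⟩ := L_mulVec u₀ u₁ k x (h x)
    obtain ⟨b0, b1, b2⟩ := L_mulVec u₀ (-u₁) ((k⁻¹ : ℝ) : ℂ) x (f x)
    have hw := omega_quadratic
    have hE : ((Real.exp (u₀ x) : ℝ) : ℂ) * ((Real.exp (-u₀ x) : ℝ) : ℂ) = 1 := by
      rw [← Complex.ofReal_mul, ← Real.exp_add, add_neg_cancel, Real.exp_zero, Complex.ofReal_one]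
    have hF : Real.exp (-2 * u₀ x) = Real.exp (-u₀ x) ^ 2 := by
      rw [← Real.exp_nat_mul]
      congr 1
      push_cast
      ring
    have hpot : (-u₁) x = -u₁ x := rfl
    fin_cases i
    · refine ((((hc 0).mul (hg 0)).add ((hc 2).mul (hg 1))).add ((hc 1).mul (hg 2))).congr_deriv ?_
      change _ = (L u₀ u₁ k x *ᵥ h x) 0 - l k j * h x 0
      rw [a0, b0, b1, b2]
      simp only [hh, inversionGauge, inversionCoeff, hF, hpot, Complex.ofReal_inv, inv_inv, map_mul,
        map_sub, map_add, map_neg, map_div₀, map_pow, map_inv₀, map_one, map_ofNat, conj_omega,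
        Complex.conj_ofReal, Complex.ofReal_add, Complex.ofReal_neg, Complex.ofReal_pow,
        Matrix.cons_val]
      generalize (starRingEnd ℂ) (f x 0) = a at *
      generalize (starRingEnd ℂ) (f x 1) = b at *
      generalize (starRingEnd ℂ) (f x 2) = c at *
      generalize ((Real.exp (u₀ x) : ℝ) : ℂ) = E at *
      generalize ((Real.exp (-u₀ x) : ℝ) : ℂ) = E' at *
      generalize ((deriv u₀ x : ℝ) : ℂ) = p
      generalize ((u₁ x : ℝ) : ℂ) = q
      generalize (k : ℂ)⁻¹ = K
      generalize omega = w at *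
      generalize l k j = ell
      clear * - hw hE
      grind
    · refine ((((hc 1).mul (hg 0)).add ((hc 0).mul (hg 1))).add ((hc 2).mul (hg 2))).congr_deriv ?_
      change _ = (L u₀ u₁ k x *ᵥ h x) 1 - l k j * h x 1
      rw [a1, b0, b1, b2]
      simp only [hh, inversionGauge, inversionCoeff, hF, hpot, Complex.ofReal_inv, inv_inv, map_mul,
        map_sub, map_add, map_neg, map_div₀, map_pow, map_inv₀, map_one, map_ofNat, conj_omega,
        Complex.conj_ofReal, Complex.ofReal_add, Complex.ofReal_neg, Complex.ofReal_pow,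
        Matrix.cons_val]
      generalize (starRingEnd ℂ) (f x 0) = a at *
      generalize (starRingEnd ℂ) (f x 1) = b at *
      generalize (starRingEnd ℂ) (f x 2) = c at *
      generalize ((Real.exp (u₀ x) : ℝ) : ℂ) = E at *
      generalize ((Real.exp (-u₀ x) : ℝ) : ℂ) = E' at *
      generalize ((deriv u₀ x : ℝ) : ℂ) = p
      generalize ((u₁ x : ℝ) : ℂ) = q
      generalize (k : ℂ)⁻¹ = K
      generalize omega = w at *
      generalize l k j = ell
      clear * - hw hE
      grind
    · refine ((((hc 2).mul (hg 0)).add ((hc 1).mul (hg 1))).add ((hc 0).mul (hg 2))).congr_deriv ?_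
      change _ = (L u₀ u₁ k x *ᵥ h x) 2 - l k j * h x 2
      rw [a2, b0, b1, b2]
      simp only [hh, inversionGauge, inversionCoeff, hF, hpot, Complex.ofReal_inv, inv_inv, map_mul,
        map_sub, map_add, map_neg, map_div₀, map_pow, map_inv₀, map_one, map_ofNat, conj_omega,
        Complex.conj_ofReal, Complex.ofReal_add, Complex.ofReal_neg, Complex.ofReal_pow,
        Matrix.cons_val]
      generalize (starRingEnd ℂ) (f x 0) = a at *
      generalize (starRingEnd ℂ) (f x 1) = b at *
      generalize (starRingEnd ℂ) (f x 2) = c at *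
      generalize ((Real.exp (u₀ x) : ℝ) : ℂ) = E at *
      generalize ((Real.exp (-u₀ x) : ℝ) : ℂ) = E' at *
      generalize ((deriv u₀ x : ℝ) : ℂ) = p
      generalize ((u₁ x : ℝ) : ℂ) = q
      generalize (k : ℂ)⁻¹ = K
      generalize omega = w at *
      generalize l k j = ell
      clear * - hw hE
      grind
  · have ht := (jost_spec u₀ (-u₁) hk' hj).tendsto_atTop
      (fun i => by rw [exponents_re]; exact reExp_nonneg hk' i) hQ'
    have hg : ∀ i, Tendsto (fun x => (starRingEnd ℂ) (f x i)) atTop (𝓝 (if i = j then 1 else 0)) :=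
      fun i => by
        have := (Complex.continuous_conj.tendsto _).comp (ht i)
        rw [apply_ite (starRingEnd ℂ), map_one, map_zero] at this
        exact this
    have hc : ∀ d : Fin 3, Tendsto (inversionCoeff u₀ d) atTop (𝓝 (if d = 0 then 1 else 0)) :=
      fun d => inversionCoeff_limit d ▸ tendsto_inversionCoeff u₀ atTop_le_cocompact d
    have h0 := hc 0
    have h1 := hc 1
    have h2 := hc 2
    simp only [Fin.isValue, Fin.val_zero, Fin.val_one, Fin.val_two, if_true, one_ne_zero, if_false,
      (by decide : (2 : Fin 3) ≠ 0)] at h0 h1 h2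
    fin_cases i
    · have := ((h0.mul (hg 0)).add (h2.mul (hg 1))).add (h1.mul (hg 2))
      simpa [hh, inversionGauge] using this
    · have := ((h1.mul (hg 0)).add (h0.mul (hg 1))).add (h2.mul (hg 2))
      simpa [hh, inversionGauge] using this
    · have := ((h2.mul (hg 0)).add (h1.mul (hg 1))).add (h0.mul (hg 2))
      simpa [hh, inversionGauge] using this

theorem s_inversion {k : ℝ} (hk : 0 < k) {j : Fin 3} (hj : j = 0 ∨ j = 1) :
    s u₀ u₁ k 0 j = (starRingEnd ℂ) (s u₀ (-u₁) ((k⁻¹ : ℝ) : ℂ) 0 j) := by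
  have hk' : 0 < k⁻¹ := inv_pos.2 hk
  have key : ∀ (v : SchwartzMap ℝ ℝ) {k : ℝ}, 0 < k → Tendsto (fun x : ℝ =>
      Complex.exp (-x * exponents (reExp k) (imExp k) j 0) * jost u₀ v k j x 0) atBot
      (𝓝 (s u₀ v k 0 j)) := fun v k hk => by
    have hint := integrable_sIntegrand u₀ v hk hj
    rw [funext (sIntegrand_eq u₀ v k hj 0)] at hint
    rw [s_eq_scattering u₀ v k hj]
    exact (jost_spec u₀ v hk hj).tendsto_scattering (exponents_self (reExp_eq_zero k hj) _) hint
  obtain ⟨M, hM⟩ := exists_norm_jost_le u₀ (-u₁) hk' hj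
  have hc : ∀ d : Fin 3, Tendsto (inversionCoeff u₀ d) atBot (𝓝 (if d = 0 then 1 else 0)) :=
    fun d => inversionCoeff_limit d ▸ tendsto_inversionCoeff u₀ atBot_le_cocompact d
  have h1 := (Complex.continuous_conj.tendsto _).comp (key (-u₁) hk')
  have hbdd : ∀ i, ∀ x : ℝ, ‖Complex.exp (-x * exponents (reExp k) (imExp k) j 0) *
      (starRingEnd ℂ) (jost u₀ (-u₁) ((k⁻¹ : ℝ) : ℂ) j x i)‖ ≤ M := fun i x => by
    have hre : (-(x : ℂ) * exponents (reExp k) (imExp k) j 0).re = 0 := by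
      rw [← Complex.ofReal_neg, Complex.re_ofReal_mul, exponents_re,
        reExp_eq_zero k (Or.inl rfl), mul_zero]
    rw [norm_mul, Complex.norm_exp, hre, Real.exp_zero, one_mul, RCLike.norm_conj]
    exact (norm_le_pi_norm _ i).trans (hM x)
  have hsmall : ∀ d : Fin 3, d ≠ 0 → ∀ i, Tendsto (fun x : ℝ => inversionCoeff u₀ d x *
      (Complex.exp (-x * exponents (reExp k) (imExp k) j 0) *
      (starRingEnd ℂ) (jost u₀ (-u₁) ((k⁻¹ : ℝ) : ℂ) j x i))) atBot (𝓝 0) := fun d hd i => by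
    have h := hc d
    rw [if_neg hd] at h
    exact h.zero_mul_isBoundedUnder_le (isBoundedUnder_of ⟨M, hbdd i⟩)
  -- the off-diagonal entries of the gauge matrix disappear in the limit
  have h2 := (((hc 0).mul h1).add (hsmall 2 (by decide) 1)).add (hsmall 1 (by decide) 2)
  rw [if_pos rfl, one_mul, add_zero, add_zero] at h2
  refine tendsto_nhds_unique (key u₁ hk) (h2.congr fun x => ?_)
  have hexp : (starRingEnd ℂ) (Complex.exp (-x * exponents (reExp k⁻¹) (imExp k⁻¹) j 0)) =
      Complex.exp (-x * exponents (reExp k) (imExp k) j 0) := by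
    rw [← Complex.exp_conj, map_mul, map_neg, Complex.conj_ofReal, conj_exponents k hj]
  rw [jost_inversion u₀ u₁ hk hj, Function.comp_apply, map_mul, hexp]
  simp only [inversionGauge, Matrix.cons_val, Fin.val_zero, Fin.val_one, Fin.val_two]
  ring

/-- Exchanging `k` and `1 / k` amounts to complex conjugation and time reversal. This turns the
behaviour of `r₁` at `0` into its behaviour at `+∞`. -/
theorem r₁_inversion {k : ℝ} (hk : 0 < k) :
    r₁ u₀ u₁ k = (starRingEnd ℂ) (r₁ u₀ (-u₁) k⁻¹) := by
  rw [r₁, r₁, s_inversion u₀ u₁ hk (Or.inl rfl), s_inversion u₀ u₁ hk (Or.inr rfl), map_div₀]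

end

noncomputable section

/-! ### Rapid decay at `+∞` and at `0` -/

theorem RapidlyDecays.of_isBigO {f g : ℝ → ℂ} (hg : RapidlyDecays g) (h : f =O[atTop] g) :
    RapidlyDecays f := fun N => h.trans (hg N)

theorem RapidlyDecays.add {f g : ℝ → ℂ} (hf : RapidlyDecays f) (hg : RapidlyDecays g) :
    RapidlyDecays fun k => f k + g k := fun N => (hf N).add (hg N)

theorem RapidlyDecays.ofReal_mul {g : ℝ → ℂ} (hg : RapidlyDecays g) :
    RapidlyDecays fun k => (k : ℂ) * g k := fun N => by
  have h1 : (fun k : ℝ => (k : ℂ)) =O[atTop] fun k : ℝ => k :=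
    IsBigO.of_bound 1 (Eventually.of_forall fun k => by simp)
  refine (h1.mul (hg (N + 1))).congr' EventuallyEq.rfl ?_
  filter_upwards [eventually_gt_atTop 0] with k hk
  rw [pow_succ, mul_inv, mul_comm (k ^ N)⁻¹, mul_inv_cancel_left₀ hk.ne']

/-- The function `g` and its first `n` derivatives on `(a, ∞)` decay rapidly at `+∞`. -/
def RapidDerivsAtTop (a : ℝ) : ℕ → (ℝ → ℂ) → Prop
  | 0, g => RapidlyDecays g
  | n + 1, g => RapidlyDecays g ∧ ∃ g', (∀ k ∈ Ioi a, HasDerivAt g (g' k) k) ∧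
      RapidDerivsAtTop a n g'

namespace RapidDerivsAtTop

variable {a : ℝ} {n : ℕ} {f g : ℝ → ℂ}

theorem rapidlyDecays (h : RapidDerivsAtTop a n g) : RapidlyDecays g := by
  cases n with
  | zero => exact h
  | succ n => exact h.1

theorem of_succ (h : RapidDerivsAtTop a (n + 1) g) : RapidDerivsAtTop a n g := by
  induction n generalizing g with
  | zero => exact h.1
  | succ n ih =>
    obtain ⟨h0, g', h1, h2⟩ := h
    exact ⟨h0, g', h1, ih h2⟩

theorem add (hf : RapidDerivsAtTop a n f) (hg : RapidDerivsAtTop a n g) :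
    RapidDerivsAtTop a n fun k => f k + g k := by
  induction n generalizing f g with
  | zero => exact RapidlyDecays.add hf hg
  | succ n ih =>
    obtain ⟨f0, f', f1, f2⟩ := hf
    obtain ⟨g0, g', g1, g2⟩ := hg
    exact ⟨f0.add g0, _, fun k hk => (f1 k hk).add (g1 k hk), ih f2 g2⟩

theorem neg (hg : RapidDerivsAtTop a n g) : RapidDerivsAtTop a n fun k => -g k := by
  induction n generalizing g with
  | zero => exact fun N => (hg N).neg_left
  | succ n ih =>
    obtain ⟨g0, g', g1, g2⟩ := hg
    exact ⟨fun N => (g0 N).neg_left, _, fun k hk => (g1 k hk).neg, ih g2⟩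

theorem ofReal_mul (hg : RapidDerivsAtTop a n g) :
    RapidDerivsAtTop a n fun k => (k : ℂ) * g k := by
  induction n generalizing g with
  | zero => exact RapidlyDecays.ofReal_mul hg
  | succ n ih =>
    obtain ⟨g0, g', g1, g2⟩ := id hg
    refine ⟨g0.ofReal_mul, _, fun k hk => ?_, hg.of_succ.add (ih g2)⟩
    refine ((hasDerivAt_id k).ofReal_comp.mul (g1 k hk)).congr_deriv ?_
    rw [Complex.ofReal_one, one_mul]
    rfl

theorem of_bddDerivs (hg : RapidlyDecays g) (h : ∀ n, BddDerivs (Ioi a) n fun _ : Unit => g)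
    (n : ℕ) : RapidDerivsAtTop a n g := by
  induction n generalizing g with
  | zero => exact hg
  | succ n ih =>
    refine ⟨hg, deriv g, fun k hk => ?_, ih ?_ fun n => (h (n + 1)).deriv isOpen_Ioi⟩
    · obtain ⟨-, g', hg', -⟩ := h 1
      exact (hg' () k hk).differentiableAt.hasDerivAt
    · simpa only [iteratedDeriv_one] using hg.iteratedDeriv h 1

/-- Rapid decay of `g` and its derivatives at `+∞` gives infinite order of vanishing of `k ↦ g k⁻¹`
at `0`: the derivative of the latter is again of this form, with `-x² g' x` in place of `g x`. -/
theorem iteratedDeriv_isBigO (ha : 0 < a) (hg : RapidDerivsAtTop a n g)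
    (hf : ∀ k ∈ Ioo 0 a⁻¹, f k = g k⁻¹) (N : ℕ) :
    iteratedDeriv n f =O[𝓝[>] 0] fun k : ℝ => k ^ N := by
  induction n generalizing f g with
  | zero =>
    refine ((hg.rapidlyDecays N).comp_tendsto tendsto_inv_nhdsGT_zero).congr' ?_ ?_
    · filter_upwards [Ioo_mem_nhdsGT (inv_pos.2 ha)] with k hk
      rw [iteratedDeriv_zero, hf k hk]
      rfl
    · exact Eventually.of_forall fun k => by simp
  | succ n ih =>
    obtain ⟨-, g', g1, g2⟩ := hg
    rw [iteratedDeriv_succ']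
    refine ih g2.ofReal_mul.ofReal_mul.neg fun k hk => ?_
    have hka : k⁻¹ ∈ Ioi a := (lt_inv_comm₀ hk.1 ha).1 hk.2
    have h := (g1 k⁻¹ hka).scomp k (hasDerivAt_inv hk.1.ne')
    have heq : f =ᶠ[𝓝 k] g ∘ fun k => k⁻¹ := by
      filter_upwards [isOpen_Ioo.mem_nhds hk] with k hk using hf k hk
    rw [heq.deriv_eq, h.deriv]
    simp only [Complex.real_smul]
    push_cast
    ring

end RapidDerivsAtTop

variable (u₀ u₁ : SchwartzMap ℝ ℝ)

theorem bddDerivs_r₁ {k₀ : ℝ} (hk₀ : 0 < k₀) (n : ℕ) :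
    BddDerivs (Ioi k₀) n fun _ : Unit => r₁ u₀ u₁ := by
  obtain ⟨c, hc, h⟩ := exists_le_norm_s u₀ u₁ hk₀
  exact (bddDerivs_s u₀ u₁ hk₀ (Or.inr rfl) n).mul
    ((bddDerivs_s u₀ u₁ hk₀ (Or.inl rfl) n).inv hc fun _ _ hk => h _ (le_of_lt hk))

theorem contDiffOn_r₁ : ContDiffOn ℝ ∞ (r₁ u₀ u₁) (Ioi 0) := fun _ hk =>
  ((BddDerivs.contDiffOn isOpen_Ioi (bddDerivs_r₁ u₀ u₁ (half_pos hk)) ()).contDiffAt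
    (Ioi_mem_nhds (half_lt_self hk))).contDiffWithinAt

theorem rapidlyDecays_r₁ : RapidlyDecays (r₁ u₀ u₁) := by
  obtain ⟨c, hc, h⟩ := exists_le_norm_s u₀ u₁ one_pos
  refine (rapidlyDecays_s u₀ u₁).of_isBigO (IsBigO.of_bound c⁻¹ ?_)
  filter_upwards [eventually_ge_atTop 1] with k hk
  rw [r₁, norm_div, div_eq_inv_mul]
  gcongr
  exact h k hk

theorem iteratedDeriv_r₁_isBigO (m N : ℕ) :
    iteratedDeriv m (r₁ u₀ u₁) =O[𝓝[>] 0] fun k : ℝ => k ^ N := by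
  refine RapidDerivsAtTop.iteratedDeriv_isBigO (a := 1)
    (g := fun k => (starRingEnd ℂ) (r₁ u₀ (-u₁) k)) one_pos
    (.of_bddDerivs ?_ (fun n => ?_) m) (fun k hk => r₁_inversion u₀ u₁ hk.1) N
  · exact (rapidlyDecays_r₁ u₀ (-u₁)).of_isBigO (IsBigO.of_bound 1
      (Eventually.of_forall fun k => by rw [RCLike.norm_conj, one_mul]))
  · exact (bddDerivs_r₁ u₀ (-u₁) one_pos n).clm_comp Complex.conjCLE.toContinuousLinearMap

theorem s_ne_zero {k : ℝ} (hk : 0 < k) : s u₀ u₁ k 0 0 ≠ 0 := by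
  obtain ⟨c, hc, h⟩ := exists_le_norm_s u₀ u₁ hk
  exact norm_pos_iff.1 (hc.trans_le (h k le_rfl))

end

end Tzitzeica

theorem theorem2p1 (u₀ u₁ : SchwartzMap ℝ ℝ) :
    -- the reflection coefficient `r₁` is well defined on `(0, ∞)`
    (∀ k : ℝ, 0 < k →
      (∀ j : Fin 3, j = 0 ∨ j = 1 →
        (∃! f : ℝ → Fin 3 → ℂ, Tzitzeica.IsJostColumn u₀ u₁ (k : ℂ) j f) ∧
        MeasureTheory.Integrable (Tzitzeica.sIntegrand u₀ u₁ (k : ℂ) 0 j)) ∧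
      Tzitzeica.s u₀ u₁ (k : ℂ) 0 0 ≠ 0) ∧
    -- the reflection coefficient `r₂` is well defined on `(-∞, 0)`
    (∀ k : ℝ, k < 0 →
      (∀ j : Fin 3, j = 0 ∨ j = 1 →
        (∃! f : ℝ → Fin 3 → ℂ, Tzitzeica.IsCofactorJostColumn u₀ u₁ (k : ℂ) j f) ∧
        MeasureTheory.Integrable (Tzitzeica.sAIntegrand u₀ u₁ (k : ℂ) 0 j)) ∧
      Tzitzeica.sA u₀ u₁ (k : ℂ) 0 0 ≠ 0) ∧
    -- smoothness on the domains
    ContDiffOn ℝ ∞ (Tzitzeica.r₁ u₀ u₁) (Set.Ioi 0) ∧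
    ContDiffOn ℝ ∞ (Tzitzeica.r₂ u₀ u₁) (Set.Iio 0) ∧
    -- rapid decay at infinity
    (∀ N : ℕ, Tzitzeica.r₁ u₀ u₁ =O[Filter.atTop] (fun k : ℝ => (k ^ N)⁻¹)) ∧
    (∀ N : ℕ, Tzitzeica.r₂ u₀ u₁ =O[Filter.atBot] (fun k : ℝ => (k ^ N)⁻¹)) ∧
    -- rapid decay at zero, together with all derivatives
    (∀ m N : ℕ, iteratedDeriv m (Tzitzeica.r₁ u₀ u₁)
      =O[nhdsWithin 0 (Set.Ioi 0)] (fun k : ℝ => k ^ N)) ∧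
    (∀ m N : ℕ, iteratedDeriv m (Tzitzeica.r₂ u₀ u₁)
      =O[nhdsWithin 0 (Set.Iio 0)] (fun k : ℝ => k ^ N)) := by
  have hr₂ : Tzitzeica.r₂ u₀ u₁ = fun k => Tzitzeica.r₁ u₀ u₁ (-k) :=
    funext (Tzitzeica.r₂_eq u₀ u₁)
  refine ⟨fun k hk => ⟨fun j hj => ⟨Tzitzeica.existsUnique_isJostColumn u₀ u₁ hk hj,
    Tzitzeica.integrable_sIntegrand u₀ u₁ hk hj⟩, Tzitzeica.s_ne_zero u₀ u₁ hk⟩,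
    fun k hk => ⟨fun j hj => ⟨?_, ?_⟩, ?_⟩, Tzitzeica.contDiffOn_r₁ u₀ u₁, ?_,
    Tzitzeica.rapidlyDecays_r₁ u₀ u₁, fun N => ?_, Tzitzeica.iteratedDeriv_r₁_isBigO u₀ u₁,
    fun m N => ?_⟩
  · simp only [Tzitzeica.isCofactorJostColumn_iff, ← Complex.ofReal_neg]
    exact Tzitzeica.existsUnique_isJostColumn u₀ u₁ (neg_pos.2 hk) hj
  · rw [Tzitzeica.sAIntegrand_eq, ← Complex.ofReal_neg]
    exact (Tzitzeica.integrable_sIntegrand u₀ u₁ (neg_pos.2 hk) hj).neg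
  · rw [Tzitzeica.sA_eq, ← Complex.ofReal_neg]
    exact Tzitzeica.s_ne_zero u₀ u₁ (neg_pos.2 hk)
  · rw [hr₂]
    exact (Tzitzeica.contDiffOn_r₁ u₀ u₁).comp contDiff_neg.contDiffOn fun k hk =>
      Set.mem_Ioi.2 (neg_pos.2 hk)
  · have h := (Tzitzeica.rapidlyDecays_r₁ u₀ u₁ N).comp_tendsto Filter.tendsto_neg_atBot_atTop
    rw [hr₂]
    refine h.trans (Asymptotics.IsBigO.of_bound 1 (Filter.Eventually.of_forall fun k => ?_))
    simp
  · have hneg : Filter.Tendsto (fun k : ℝ => -k) (nhdsWithin 0 (Set.Iio 0))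
        (nhdsWithin 0 (Set.Ioi 0)) := by
      simpa using tendsto_neg_nhdsLT (a := (0 : ℝ))
    have h := (Tzitzeica.iteratedDeriv_r₁_isBigO u₀ u₁ m N).comp_tendsto hneg
    rw [hr₂]
    have hpow : ((fun k : ℝ => k ^ N) ∘ fun k => -k) =O[nhdsWithin 0 (Set.Iio 0)]
        fun k : ℝ => k ^ N :=
      Asymptotics.IsBigO.of_bound 1 (Filter.Eventually.of_forall fun k => by simp)
    refine Asymptotics.IsBigO.trans ?_ (h.trans hpow)
    refine Asymptotics.IsBigO.of_bound 1 (Filter.Eventually.of_forall fun k => ?_)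
    rw [iteratedDeriv_comp_neg]
    simp
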